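/- Let $\|\cdot\|$ be the Euclidean norm on $\mathbb R^d$, $B_r=\{x\in\mathbb R^d:\|x\|\le r\}$ for $r\ge0$, $B_r^c=\mathbb R^d\setminus B_r$, $\mathcal S=\{x\in\mathbb R^d:\|x\|=1\}$. Let $\overline{\mathbb R^d}$ be the compactification of $\mathbb R^d$ obtained by adding a sphere at infinity (i.e. the closed unit ball, with $\mathbb R^d$ embedded radially as the open unit ball); measures on subsets of $\mathbb R^d$ are extended by giving no mass to the points at infinity. Vague convergence $m_n\stackrel v\to m$ on $\overline{\mathbb R^d}\setminus B_r$ means that $m$ is Radon (finite on compact subsets of $\overline{\mathbb R^d}\setminus B_r$) and $\int f\,dm_n\to\int f\,dm$ for every continuous compactly supported $f:\overline{\mathbb R^d}\setminus B_r\to\mathbb R$. Let $H$ be an $\mathbb R^d$-valued random variable, $\mu$ a non-null measure on $\mathbb R^d\setminus\{0\}$ and $a_n\to\infty$ a sequence such that $nP(a_n^{-1}H\in\cdot)\stackrel v\to\mu$ on $\overline{\mathbb R^d}\setminus\{0\}$. Then $P(\|H\|>\cdot)$ is regularly varying with index $-\alpha$ for a unique $\alpha>0$. Assume that $H$ has a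 symmetric law if $\alpha=1$, and that $E(H)=0$ if $\alpha>1$. Let $H_1,H_2,\dots$ be i.i.d. copies of $H$, and let $L_1,L_2,\dots$ be i.i.d. copies of a $[0,\infty)$-valued random variable $L$, the sequence $(L_j)$ being independent of $(H_j)$. Let $M_n>0$ with $M_n\to\infty$, and set $$X_{nj}=H_j\mathbf 1(\|H_j\|\le M_n)+\frac{H_j}{\|H_j\|}(M_n+L_j)\mathbf 1(\|H_j\|>M_n),\qquad S_n=\sum_{j=1}^nX_{nj}.$$ Assume that $nP(\|H\|>M_n)\to0$ (soft truncation), that $M_n/\sqrt{n^{1+\gamma}}\to\infty$ for some $\gamma>0$ if $\alpha=2$, and that $M_n/\sqrt{n\log M_n}\to\infty$ if $\alpha>2$. Define the measures $$\sigma(A)=\frac{\mu(\{x:\|x\|\ge1,\ x/\|x\|\in A\})}{\mu(B_1^c)},\quad \nu(A)=\frac{\mu(A\cap B_1)}{\mu(B_1^c)}+\sigma(A\cap\mathcal S),\quad \nu^{(k)}(A)=\int\cdots\int\mathbf 1\Big(\sum_{j=1}^kx_j\in A\Big)\nu(dx_1)\cdots\nu(dx_k).$$ **Theorem.** Let $k\ge1$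 be an integer and suppose that $P(L>x)=o\big(P(\|H\|>x)^{k-1}\big)$ as $x\to\infty$. Then, as $n\to\infty$, $$\frac{P(M_n^{-1}S_n\in\cdot)}{\{nP(\|H\|>M_n)\}^k}\stackrel v\longrightarrow\frac1{k!}\,\nu^{(k)}(\cdot)\qquad\text{on }\overline{\mathbb R^d}\setminus B_{k-1}.$$ Consequently, for every $r\in(k-1,k)$ with $\nu^{(k)}(\{x:\|x\|=r\})=0$, there is $C_r\in(0,\infty)$ such that $$P(\|S_n\|>rM_n)\sim C_r\{nP(\|H\|>M_n)\}^k\qquad(n\to\infty),$$ and this condition on $r$ holds for all but countably many $r\in(k-1,k)$. -/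

import Mathlib

open MeasureTheory ProbabilityTheory Filter Topology Asymptotics
open scoped ENNReal CompactlySupported

noncomputable section

namespace TruncatedTails

/-- `ℝ^d` with the Euclidean (`L²`) norm. -/
abbrev Vec (d : ℕ) : Type := EuclideanSpace ℝ (Fin d)

/-! ### The compactified space -/

/-- The compactification of `ℝ^d` by a sphere at infinity, realised as the closed unit ball:
the open unit ball is a copy of `ℝ^d` (see `toCompactified`), and the unit sphere consists of
the points at infinity. -/
abbrev Compactified (d : ℕ) : Type := ↥(Metric.closedBall (0 : Vec d) 1)

/-- The inclusion of `ℝ^d` into its compactification, `x ↦ x / √(1 + ‖x‖²)`. -/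
def toCompactified {d : ℕ} (x : Vec d) : Compactified d :=
  ⟨(Homeomorph.unitBall x : Vec d), Metric.ball_subset_closedBall (Homeomorph.unitBall x).2⟩

theorem isOpenEmbedding_toCompactified {d : ℕ} :
    IsOpenEmbedding (toCompactified : Vec d → Compactified d) := by
  have h1 : IsOpenEmbedding (fun x : Vec d => ((Homeomorph.unitBall x : Vec d))) :=
    Metric.isOpen_ball.isOpenEmbedding_subtypeVal.comp Homeomorph.unitBall.isOpenEmbedding
  have hc : Continuous (toCompactified : Vec d → Compactified d) := h1.continuous.subtype_mk _
  have hr : Set.range (toCompactified : Vec d → Compactified d) =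
      Subtype.val ⁻¹' Metric.ball (0 : Vec d) 1 := by
    ext y
    constructor
    · rintro ⟨x, rfl⟩
      exact (Homeomorph.unitBall x).2
    · intro hy
      refine ⟨Homeomorph.unitBall.symm ⟨y, hy⟩, ?_⟩
      apply Subtype.ext
      simp [toCompactified]
  refine ⟨IsEmbedding.of_comp hc continuous_subtype_val h1.isEmbedding, ?_⟩
  rw [hr]
  exact Metric.isOpen_ball.preimage continuous_subtype_val

/-- The compactified space with the closed ball of `ℝ^d` of radius `r` about the origin removed. -/
abbrev CompactifiedMinusBall (d : ℕ) (r : ℝ) : Type :=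
  {y : Compactified d // y ∉ toCompactified '' Metric.closedBall (0 : Vec d) r}

/-- A measure on `ℝ^d`, restricted to the complement of the closed ball of radius `r` and extended
to the compactified space minus that ball by giving no mass to the points at infinity. -/
def extendOutside {d : ℕ} (r : ℝ) (m : Measure (Vec d)) : Measure (CompactifiedMinusBall d r) :=
  (m.map toCompactified).comap Subtype.val

theorem extendOutside_apply {d : ℕ} (r : ℝ) (m : Measure (Vec d))
    (A : Set (CompactifiedMinusBall d r)) :
    extendOutside r m A =
      m {x | ∃ h : toCompactified x ∉ toCompactified '' Metric.closedBall (0 : Vec d) r,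
        (⟨toCompactified x, h⟩ : CompactifiedMinusBall d r) ∈ A} := by
  have hme := (isOpenEmbedding_toCompactified (d := d)).measurableEmbedding
  have hs : MeasurableSet
      {y : Compactified d | y ∉ toCompactified '' Metric.closedBall (0 : Vec d) r} :=
    (hme.measurableSet_image.2 Metric.isClosed_closedBall.measurableSet).compl
  have hv : MeasurableEmbedding (Subtype.val : CompactifiedMinusBall d r → Compactified d) :=
    MeasurableEmbedding.subtype_coe hs
  rw [extendOutside, hv.comap_apply, hme.map_apply]
  congr 1
  ext x
  simp

/-- Vague convergence of a sequence of measures to a Radon measure: convergence of the integrals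
of all compactly supported continuous functions. (On the spaces used here a Borel measure is Radon
iff it is finite on compact sets.) -/
def VagueTendsto {X : Type*} [TopologicalSpace X] [MeasurableSpace X]
    (m : ℕ → Measure X) (m' : Measure X) : Prop :=
  IsFiniteMeasureOnCompacts m' ∧
    ∀ f : C_c(X, ℝ), Tendsto (fun n => ∫ x, f x ∂(m n)) atTop (𝓝 (∫ x, f x ∂m'))

/-- Vague convergence, on the compactified space minus the closed ball of radius `r`, of measures
on `ℝ^d` that give no mass to infinity. -/
def VagueTendstoOutside {d : ℕ} (r : ℝ) (m : ℕ → Measure (Vec d)) (m' : Measure (Vec d)) : Prop :=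
  VagueTendsto (fun n => extendOutside r (m n)) (extendOutside r m')

/-! ### The limit measures -/

/-- The spectral measure of `μ`, as a measure on `ℝ^d` carried by the unit sphere. -/
def spectralMeasure {d : ℕ} (μ : Measure (Vec d)) : Measure (Vec d) :=
  (μ (Metric.closedBall 0 1)ᶜ)⁻¹ •
    (μ.restrict {x | 1 ≤ ‖x‖}).map (fun x => (‖x‖)⁻¹ • x)

/-- `ν(A) = μ(A ∩ B_1) / μ(B_1ᶜ) + σ(A ∩ S)`. -/
def nu {d : ℕ} (μ : Measure (Vec d)) : Measure (Vec d) :=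
  (μ (Metric.closedBall 0 1)ᶜ)⁻¹ • μ.restrict (Metric.closedBall 0 1) +
    (spectralMeasure μ).restrict (Metric.sphere 0 1)

/-- The `k`-fold convolution of `ν`: the image of the product measure `ν ⊗ ⋯ ⊗ ν` under
`(x_1, …, x_k) ↦ x_1 + ⋯ + x_k`. -/
def nuConv {d : ℕ} (μ : Measure (Vec d)) (k : ℕ) : Measure (Vec d) :=
  (Measure.pi (fun _ : Fin k => nu μ)).map (fun x => ∑ j, x j)

/-! ### The model -/

section Model

variable {Ω : Type*} [MeasurableSpace Ω] {d : ℕ}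

/-- The tail function `x ↦ P(‖H‖ > x)`. -/
def normTail (P : Measure Ω) (H : Ω → Vec d) (x : ℝ) : ℝ := P.real {ω | x < ‖H ω‖}

/-- `P(‖H‖ > ·)` is regularly varying with index `-α`, where `α > 0`. -/
def IsTailIndex (P : Measure Ω) (H : Ω → Vec d) (α : ℝ) : Prop :=
  0 < α ∧ ∀ t : ℝ, 0 < t →
    Tendsto (fun x => normTail P H (t * x) / normTail P H x) atTop (𝓝 (t ^ (-α)))

/-- The vector `h` truncated at level `M`, with radial excess `l` beyond `M`. -/
def truncate (M : ℝ) (h : Vec d) (l : ℝ) : Vec d :=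
  if ‖h‖ ≤ M then h else (M + l) • ((‖h‖)⁻¹ • h)

/-- The `n`-th row sum `S_n` of the truncated array, with level `M n` in row `n`. -/
def rowSum (M : ℕ → ℝ) (Hs : ℕ → Ω → Vec d) (Ls : ℕ → Ω → ℝ) (n : ℕ) (ω : Ω) : Vec d :=
  ∑ j ∈ Finset.range n, truncate (M n) (Hs j ω) (Ls j ω)

end Model

end TruncatedTails

end

/-! Truncation at `M` followed by division by `M` is, up to the excess `L`, the radial retraction
`ballRetract` of `H / M` to the unit ball. A single term therefore has norm at most about one. For
`M⁻¹ S_n` to leave the ball of radius `k - 1` by a margin `δ`, at least `k` terms must be comparable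
to `M`, which has probability of order `(n P(‖H‖ > M))^k`. Having more than `k` such terms costs a
further factor `n P(‖H‖ > M) → 0`. With exactly `k` of them, `M⁻¹ S_n` is close to a sum of `k`
independent retracted vectors. The law of `ballRetract (M⁻¹ • H)` divided by `P(‖H‖ > M)` converges
away from the origin to `ν`, because `ν` is the image of `μ` under the retraction, divided by
`μ(B_1ᶜ)`. The choice of the `k` indices contributes `n.choose k ~ n^k / k!`.

The comparison of `f (M⁻¹ S_n)` with the sum over `k`-subsets is made pathwise in
`abs_sub_sum_powersetCard_le` and integrated in `abs_integral_rowSum_sub_le`. The limit of the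
`k`-subset term is `tendsto_integral_pi_sum_div`, fed by `tendsto_integral_ballRetract_div`.

Two error events remain. A large excess `L` at a large jump is controlled by independence and the
tail assumption on `L`. A large sum of the jumps below `ε M` is controlled by exponential Chebyshev
bounds, with a parameter growing like `log (1 / (n P(‖H‖ > M)))` when `α ≤ 2` and like `log M` when
`α > 2`. Symmetry, centering and the growth conditions on `M` enter only here
(`exists_forall_isLittleO_smallSum_of_le_two`, `exists_forall_isLittleO_smallSum_of_two_lt`).

Regular variation is derived rather than assumed: `ScaledTailLimit.exists_rpow` shows that the tail
of `μ` is `κ x^(-α)`, and the inversion `m = ⌊1 / P(‖H‖ > M)⌋` transfers limits along `a_n` to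
arbitrary levels. Doubling arguments supply the moment bounds usually taken from Karamata's theorem.
-/

noncomputable section

namespace TruncatedTails

/-! ### Integrals on the compactified space -/

section Compactification

variable {d : ℕ}

/-- The radial retraction of `ℝ^d` onto the closed unit ball. -/
def ballRetract (x : Vec d) : Vec d := (max 1 ‖x‖)⁻¹ • x

theorem continuous_ballRetract : Continuous (ballRetract : Vec d → Vec d) := by
  unfold ballRetract
  exact Continuous.smul (Continuous.inv₀ (f := fun x : Vec d => max 1 ‖x‖) (by fun_prop)
    fun x => by positivity) continuous_id

theorem norm_ballRetract (x : Vec d) : ‖ballRetract x‖ = min ‖x‖ 1 := by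
  rw [ballRetract, norm_smul, norm_inv, Real.norm_of_nonneg (by positivity)]
  rcases le_total ‖x‖ 1 with h | h
  · simp [h]
  · rw [max_eq_right h, min_eq_right h, inv_mul_cancel₀ (by positivity)]

theorem coe_toCompactified (x : Vec d) :
    ((toCompactified x : Compactified d) : Vec d) = (√(1 + ‖x‖ ^ 2))⁻¹ • x := by
  simp [toCompactified, Homeomorph.unitBall_apply_coe, OpenPartialHomeomorph.univUnitBall_apply]

theorem norm_coe_toCompactified (x : Vec d) :
    ‖((toCompactified x : Compactified d) : Vec d)‖ = ‖x‖ / √(1 + ‖x‖ ^ 2) := by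
  rw [coe_toCompactified, norm_smul, norm_inv, Real.norm_of_nonneg (by positivity)]
  ring

theorem div_sqrt_one_add_sq_le_iff {s t : ℝ} (hs : 0 ≤ s) (ht : 0 ≤ t) :
    s / √(1 + s ^ 2) ≤ t / √(1 + t ^ 2) ↔ s ≤ t := by
  rw [div_le_div_iff₀ (by positivity) (by positivity), ← sq_le_sq₀ (by positivity) (by positivity),
    mul_pow, mul_pow, Real.sq_sqrt (by positivity), Real.sq_sqrt (by positivity),
    ← sq_le_sq₀ hs ht]
  constructor <;> intro h <;> nlinarith

theorem exists_toCompactified_eq {y : Compactified d} (hy : ‖(y : Vec d)‖ < 1) :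
    ∃ x : Vec d, toCompactified x = y :=
  ⟨Homeomorph.unitBall.symm ⟨y, by simpa using hy⟩, by apply Subtype.ext; simp [toCompactified]⟩

theorem toCompactified_mem_image_closedBall {r : ℝ} {x : Vec d} :
    toCompactified x ∈ toCompactified '' Metric.closedBall (0 : Vec d) r ↔ ‖x‖ ≤ r := by
  rw [isOpenEmbedding_toCompactified.injective.mem_set_image]
  simp

theorem integral_extendOutside (r : ℝ) (m : Measure (Vec d)) (g : Compactified d → ℝ)
    (hg : ∀ x : Vec d, ‖x‖ ≤ r → g (toCompactified x) = 0) :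
    ∫ y : CompactifiedMinusBall d r, g y ∂(extendOutside r m) =
      ∫ x, g (toCompactified x) ∂m := by
  have hme := (isOpenEmbedding_toCompactified (d := d)).measurableEmbedding
  have hs : MeasurableSet
      {y : Compactified d | y ∉ toCompactified '' Metric.closedBall (0 : Vec d) r} :=
    (hme.measurableSet_image.2 Metric.isClosed_closedBall.measurableSet).compl
  rw [extendOutside, ← hme.integral_map]
  refine (integral_subtype_comap hs g).trans ?_
  refine setIntegral_eq_integral_of_forall_compl_eq_zero fun y hy => ?_
  simp only [Set.mem_ofPred_eq, not_not] at hy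
  obtain ⟨x, hx, rfl⟩ := hy
  exact hg x (by simpa using hx)

/-- The image of a compact set is closed and misses the compact ball, hence it also misses a closed
thickening of that ball, which is again a ball. Compact support thus becomes vanishing on a slightly
larger ball. -/
theorem exists_pos_forall_notMem_of_isCompact {r : ℝ} (hr : 0 ≤ r)
    {K : Set (CompactifiedMinusBall d r)} (hK : IsCompact K) :
    ∃ δ : ℝ, 0 < δ ∧ ∀ x : Vec d, ‖x‖ ≤ r + δ → toCompactified x ∉ Subtype.val '' K := by
  have hK' : IsClosed (Subtype.val '' K : Set (Compactified d)) :=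
    (hK.image continuous_subtype_val).isClosed
  have hO : IsOpen (toCompactified ⁻¹' (Subtype.val '' K : Set (Compactified d)))ᶜ :=
    (hK'.preimage isOpenEmbedding_toCompactified.continuous).isOpen_compl
  have hsub : Metric.closedBall (0 : Vec d) r ⊆
      (toCompactified ⁻¹' (Subtype.val '' K : Set (Compactified d)))ᶜ := by
    rintro x hx ⟨y, -, hy⟩
    exact y.2 ⟨x, hx, hy.symm⟩
  obtain ⟨δ, hδ, h⟩ := (isCompact_closedBall (0 : Vec d) r).exists_cthickening_subset_open hO hsub
  rw [cthickening_closedBall hδ.le hr] at h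
  exact ⟨δ, hδ, fun x hx => h (by simpa [add_comm] using hx)⟩

/-- This removes the compactification from the conclusion: extended by zero, a test function becomes
a bounded continuous function on `ℝ^d` vanishing near the ball. Boundedness comes from compactness
of `Compactified d`. -/
theorem exists_continuous_integral_extendOutside_eq {r : ℝ} (hr : 0 ≤ r)
    (f : C_c(CompactifiedMinusBall d r, ℝ)) :
    ∃ g : Vec d → ℝ, Continuous g ∧ (∃ C, ∀ x, |g x| ≤ C) ∧
      (∃ δ : ℝ, 0 < δ ∧ ∀ x, ‖x‖ ≤ r + δ → g x = 0) ∧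
      ∀ m : Measure (Vec d), ∫ y, f y ∂(extendOutside r m) = ∫ x, g x ∂m := by
  obtain ⟨δ, hδ, h⟩ := exists_pos_forall_notMem_of_isCompact hr f.hasCompactSupport
  have hopen : IsOpen
      {y : Compactified d | y ∉ toCompactified '' Metric.closedBall (0 : Vec d) r} :=
    ((isCompact_closedBall (0 : Vec d) r).image
      isOpenEmbedding_toCompactified.continuous).isClosed.isOpen_compl
  let G : Compactified d → ℝ := Function.extend Subtype.val f 0
  have hG : Continuous G := by
    exact f.hasCompactSupport.continuous_extend_zero (U := {y : Compactified d |
      y ∉ toCompactified '' Metric.closedBall (0 : Vec d) r}) hopen f.continuous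
  have hGf : ∀ y : CompactifiedMinusBall d r, G y = f y := fun y =>
    Subtype.val_injective.extend_apply _ _ _
  have hG0 : ∀ x : Vec d, ‖x‖ ≤ r + δ → G (toCompactified x) = 0 := by
    intro x hx
    by_cases hx' : toCompactified x ∉ toCompactified '' Metric.closedBall (0 : Vec d) r
    · have h1 := hGf ⟨toCompactified x, hx'⟩
      simp only at h1
      rw [h1]
      by_contra h2
      exact h x hx ⟨⟨toCompactified x, hx'⟩, subset_tsupport _ h2, rfl⟩
    · refine Function.extend_apply' _ _ _ ?_
      rintro ⟨y, hy⟩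
      exact hx' (hy ▸ y.2)
  obtain ⟨C, hC⟩ := isCompact_univ.exists_bound_of_continuousOn hG.continuousOn
  refine ⟨fun x => G (toCompactified x), hG.comp isOpenEmbedding_toCompactified.continuous,
    ⟨C, fun x => hC _ trivial⟩, ⟨δ, hδ, hG0⟩, fun m => ?_⟩
  rw [← integral_extendOutside r m G fun x hx => hG0 x (by linarith)]
  simp_rw [hGf]

theorem isFiniteMeasureOnCompacts_extendOutside {r : ℝ} (hr : 0 ≤ r) {m : Measure (Vec d)}
    (h : ∀ δ : ℝ, 0 < δ → m {x | r + δ < ‖x‖} < ∞) :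
    IsFiniteMeasureOnCompacts (extendOutside r m) := by
  refine ⟨fun K hK => ?_⟩
  obtain ⟨δ, hδ, hKδ⟩ := exists_pos_forall_notMem_of_isCompact hr hK
  rw [extendOutside_apply]
  refine lt_of_le_of_lt (measure_mono ?_) (h δ hδ)
  rintro x ⟨hx, hxK⟩
  by_contra hlt
  exact hKδ x (not_lt.1 hlt) ⟨_, hxK, rfl⟩

theorem isCompact_setOf_le_norm_coe {s : ℝ} (hs : 0 < s) :
    IsCompact {y : CompactifiedMinusBall d 0 | s ≤ ‖((y : Compactified d) : Vec d)‖} := by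
  rw [Topology.IsEmbedding.subtypeVal.isCompact_iff]
  have : (Subtype.val '' {y : CompactifiedMinusBall d 0 | s ≤ ‖((y : Compactified d) : Vec d)‖} :
      Set (Compactified d)) = {y : Compactified d | s ≤ ‖(y : Vec d)‖} := by
    ext y
    constructor
    · rintro ⟨y, hy, rfl⟩
      exact hy
    · intro hy
      refine ⟨⟨y, ?_⟩, hy, rfl⟩
      rintro ⟨x, hx, rfl⟩
      have hx0 : x = 0 := by simpa using hx
      subst hx0
      simp only [Set.mem_ofPred_eq, norm_coe_toCompactified, norm_zero, zero_div] at hy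
      linarith
  rw [this]
  exact (isClosed_le continuous_const (by fun_prop)).isCompact

theorem measure_setOf_le_norm_lt_top {μ : Measure (Vec d)}
    (h : IsFiniteMeasureOnCompacts (extendOutside 0 μ)) {δ : ℝ} (hδ : 0 < δ) :
    μ {x | δ ≤ ‖x‖} < ∞ := by
  have h1 := (isCompact_setOf_le_norm_coe (d := d) (s := δ / √(1 + δ ^ 2))
    (by positivity)).measure_lt_top (μ := extendOutside 0 μ)
  rw [extendOutside_apply] at h1
  refine lt_of_le_of_lt (measure_mono fun x hx => ?_) h1
  refine ⟨?_, ?_⟩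
  · rw [toCompactified_mem_image_closedBall]
    simp only [Set.mem_ofPred_eq] at hx
    linarith
  · simp only [Set.mem_ofPred_eq, norm_coe_toCompactified]
    rwa [div_sqrt_one_add_sq_le_iff hδ.le (norm_nonneg _)]

theorem tendsto_integral_of_vagueTendstoOutside_zero {m : ℕ → Measure (Vec d)} {μ : Measure (Vec d)}
    (h : VagueTendstoOutside 0 m μ) (G : Compactified d → ℝ) (hG : Continuous G) {δ : ℝ}
    (hδ : 0 < δ) (hG0 : ∀ x, ‖x‖ ≤ δ → G (toCompactified x) = 0) :
    Tendsto (fun n => ∫ x, G (toCompactified x) ∂(m n)) atTop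
      (𝓝 (∫ x, G (toCompactified x) ∂μ)) := by
  let f : C_c(CompactifiedMinusBall d 0, ℝ) :=
    { toFun := fun y => G y
      continuous_toFun := by fun_prop
      hasCompactSupport' := by
        refine HasCompactSupport.of_support_subset_isCompact
          (isCompact_setOf_le_norm_coe (s := δ / √(1 + δ ^ 2)) (by positivity)) fun y hy => ?_
        by_contra hlt
        simp only [Set.mem_ofPred_eq, not_le] at hlt
        have h1 : δ / √(1 + δ ^ 2) ≤ 1 := by
          rw [div_le_one (by positivity)]
          exact Real.le_sqrt_of_sq_le (by linarith)
        obtain ⟨x, hx⟩ := exists_toCompactified_eq (hlt.trans_le h1)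
        rw [← hx, norm_coe_toCompactified] at hlt
        apply hy
        simp only
        rw [← hx]
        exact hG0 x ((div_sqrt_one_add_sq_le_iff (norm_nonneg _) hδ.le).1 hlt.le) }
  have := h.2 f
  have e : ∀ m : Measure (Vec d),
      ∫ y, f y ∂(extendOutside 0 m) = ∫ x, G (toCompactified x) ∂m := fun m =>
    integral_extendOutside 0 m G fun x hx => hG0 x (by linarith)
  simpa only [e] using this

/-- The continuous extension of `x ↦ ballRetract (s • x)` to the compactified space. -/
def ballRetractExt (s : ℝ) (y : Compactified d) : Vec d :=
  (max (√(1 - ‖(y : Vec d)‖ ^ 2)) (s * ‖(y : Vec d)‖))⁻¹ • (s • (y : Vec d))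

theorem continuous_ballRetractExt {s : ℝ} (hs : 0 < s) :
    Continuous (ballRetractExt s : Compactified d → Vec d) := by
  unfold ballRetractExt
  refine Continuous.smul (Continuous.inv₀ (f := fun y : Compactified d =>
    max (√(1 - ‖(y : Vec d)‖ ^ 2)) (s * ‖(y : Vec d)‖)) (by fun_prop) fun y => ne_of_gt ?_)
    (continuous_subtype_val.const_smul s)
  rcases eq_or_ne (‖(y : Vec d)‖) 0 with h | h
  · simp [h]
  · exact lt_max_of_lt_right (by positivity)

/-- For `y = x / w` with `w = √(1 + ‖x‖²)` one has `√(1 - ‖y‖²) = 1 / w`, so `1 / w` cancels between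
the maximum and the vector. The resulting formula still makes sense where `‖y‖ = 1`. -/
theorem ballRetractExt_toCompactified {s : ℝ} (hs : 0 < s) (x : Vec d) :
    ballRetractExt s (toCompactified x) = ballRetract (s • x) := by
  have hw : 0 < √(1 + ‖x‖ ^ 2) := by positivity
  have hsq : √(1 + ‖x‖ ^ 2) ^ 2 = 1 + ‖x‖ ^ 2 := Real.sq_sqrt (by positivity)
  have h1 : √(1 - (‖x‖ / √(1 + ‖x‖ ^ 2)) ^ 2) = (√(1 + ‖x‖ ^ 2))⁻¹ := by
    rw [Real.sqrt_eq_iff_eq_sq, div_pow, inv_pow, hsq]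
    · field_simp
      ring
    · rw [div_pow, hsq, sub_nonneg, div_le_one (by positivity)]
      linarith
    · positivity
  have h2 : max (√(1 + ‖x‖ ^ 2))⁻¹ (s * (‖x‖ / √(1 + ‖x‖ ^ 2))) =
      (√(1 + ‖x‖ ^ 2))⁻¹ * max 1 (s * ‖x‖) := by
    rw [mul_max_of_nonneg _ _ (by positivity)]
    ring_nf
  rw [ballRetractExt, norm_coe_toCompactified, h1, h2, coe_toCompactified, ballRetract, norm_smul,
    Real.norm_of_nonneg hs.le, smul_smul, smul_smul, smul_smul]
  congr 1
  field_simp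

/-- Functions of the retracted vector extend continuously to the points at infinity, so they are
admissible test functions. No other consequence of the vague convergence of the scaled laws is
needed later. -/
theorem tendsto_integral_ballRetract {m : ℕ → Measure (Vec d)} {μ : Measure (Vec d)}
    (h : VagueTendstoOutside 0 m μ) {s : ℝ} (hs : 0 < s) (g : Vec d → ℝ) (hg : Continuous g) {δ : ℝ}
    (hδ : 0 < δ) (hg0 : ∀ x, ‖x‖ ≤ δ → g x = 0) :
    Tendsto (fun n => ∫ x, g (ballRetract (s • x)) ∂(m n)) atTop
      (𝓝 (∫ x, g (ballRetract (s • x)) ∂μ)) := by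
  have := tendsto_integral_of_vagueTendstoOutside_zero h (fun y => g (ballRetractExt s y))
    (hg.comp (continuous_ballRetractExt hs)) (δ := δ / s) (by positivity) (fun x hx => by
      simp only [ballRetractExt_toCompactified hs]
      refine hg0 _ ?_
      rw [norm_ballRetract, norm_smul, Real.norm_of_nonneg hs.le]
      rw [le_div_iff₀ hs] at hx
      exact (min_le_left _ _).trans (by linarith))
  simpa only [ballRetractExt_toCompactified hs] using this

end Compactification

/-! ### Regular variation from the convergence of scaled tails -/

section ScaledTails

/-- `n F(a_n x) → G(x)` at the continuity points of the tail function `G`, which is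
right-continuous, vanishes at infinity and does not vanish identically. -/
structure ScaledTailLimit (F : ℝ → ℝ) (a : ℕ → ℝ) (G : ℝ → ℝ) : Prop where
  anti : Antitone F
  nonneg : ∀ x, 0 ≤ F x
  scale : Tendsto a atTop atTop
  limAnti : AntitoneOn G (Set.Ioi 0)
  limNonneg : ∀ x, 0 ≤ G x
  limRight : ∀ x, 0 < x → ∀ c, c < G x → ∃ y, x < y ∧ c < G y
  limZero : Tendsto G atTop (𝓝 0)
  limPos : ∃ x, 0 < x ∧ 0 < G x
  -- Continuous test functions give an upper bound only with a gap `x' < x`, as continuity of `G` is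
  -- not yet known. The lower bound needs no gap because `G` is right-continuous.
  upper : ∀ x' x, 0 < x' → x' < x → ∀ c, G x' < c → ∀ᶠ n : ℕ in atTop, n * F (a n * x) < c
  lower : ∀ x, 0 < x → ∀ c, c < G x → ∀ᶠ n : ℕ in atTop, c < n * F (a n * x)

namespace ScaledTailLimit

variable {F G : ℝ → ℝ} {a : ℕ → ℝ}

theorem tendsto_floor_mul {t : ℝ} (ht : 0 < t) :
    Tendsto (fun n : ℕ => ⌊(n : ℝ) * t⌋₊) atTop atTop :=
  tendsto_nat_floor_atTop.comp (tendsto_natCast_atTop_atTop.atTop_mul_const ht)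

theorem tendsto_div_floor_mul {t : ℝ} (ht : 0 < t) :
    Tendsto (fun n : ℕ => (n : ℝ) / (⌊(n : ℝ) * t⌋₊ : ℝ)) atTop (𝓝 t⁻¹) := by
  have h := (tendsto_nat_floor_mul_div_atTop (R := ℝ) ht.le).comp tendsto_natCast_atTop_atTop
    (β := ℝ)
  have := h.inv₀ ht.ne'
  refine this.congr fun n => ?_
  simp [mul_comm t]

/-- Passing from the index `n` to `⌊n t⌋` divides the limit by `t`, since `n / ⌊n t⌋ → 1 / t`. -/
theorem upper_floor (h : ScaledTailLimit F a G) {t : ℝ} (ht : 0 < t) {x' x : ℝ} (hx' : 0 < x')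
    (hx : x' < x) {c : ℝ} (hc : G x' / t < c) :
    ∀ᶠ n : ℕ in atTop, n * F (a ⌊(n : ℝ) * t⌋₊ * x) < c := by
  rw [div_lt_iff₀ ht] at hc
  obtain ⟨c', h1, h2⟩ := exists_between hc
  have e1 := (tendsto_floor_mul ht).eventually (h.upper x' x hx' hx c' h1)
  have e2 : ∀ᶠ n : ℕ in atTop, (n : ℝ) / (⌊(n : ℝ) * t⌋₊ : ℝ) * c' < c := by
    refine ((tendsto_div_floor_mul ht).mul_const c').eventually_lt_const ?_
    rwa [inv_mul_lt_iff₀ ht, mul_comm]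
  filter_upwards [e1, e2, (tendsto_floor_mul ht).eventually_gt_atTop 0] with n h3 h4 h5
  have h5' : (0 : ℝ) < ⌊(n : ℝ) * t⌋₊ := by exact_mod_cast h5
  refine lt_of_le_of_lt ?_ h4
  rw [div_mul_eq_mul_div, le_div_iff₀ h5']
  have := mul_le_mul_of_nonneg_left h3.le (Nat.cast_nonneg (α := ℝ) n)
  linarith

theorem lower_floor (h : ScaledTailLimit F a G) {t : ℝ} (ht : 0 < t) {x : ℝ} (hx : 0 < x)
    {c : ℝ} (hc : c < G x / t) :
    ∀ᶠ n : ℕ in atTop, c < n * F (a ⌊(n : ℝ) * t⌋₊ * x) := by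
  rw [lt_div_iff₀ ht] at hc
  obtain ⟨c', h1, h2⟩ := exists_between hc
  have e1 := (tendsto_floor_mul ht).eventually (h.lower x hx c' h2)
  have e2 : ∀ᶠ n : ℕ in atTop, c < (n : ℝ) / (⌊(n : ℝ) * t⌋₊ : ℝ) * c' := by
    refine ((tendsto_div_floor_mul ht).mul_const c').eventually_const_lt ?_
    rwa [lt_inv_mul_iff₀ ht, mul_comm]
  filter_upwards [e1, e2, (tendsto_floor_mul ht).eventually_gt_atTop 0] with n h3 h4 h5
  have h5' : (0 : ℝ) < ⌊(n : ℝ) * t⌋₊ := by exact_mod_cast h5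
  refine lt_of_lt_of_le h4 ?_
  rw [div_mul_eq_mul_div, div_le_iff₀ h5']
  have := mul_le_mul_of_nonneg_left h3.le (Nat.cast_nonneg (α := ℝ) n)
  linarith

/-- The ratios `a_⌊nt⌋ / a_n` stay in a compact subset of `(0, ∞)`, because otherwise monotonicity
of `F` would contradict the limits at `x₀` or near infinity. Along a subsequence they converge to
some `c`, and computing the limit of `n F(a_⌊nt⌋ x)` through `a_⌊nt⌋` and through `c a_n` gives the
identity. -/
theorem exists_scaling (h : ScaledTailLimit F a G) {t : ℝ} (ht : 0 < t) :
    ∃ c : ℝ, 0 < c ∧ ∀ x, 0 < x → G (c * x) = G x / t := by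
  obtain ⟨x₀, hx₀, hG₀⟩ := h.limPos
  have hapos := h.scale.eventually_gt_atTop 0
  have hhi : ∃ A : ℝ, 0 < A ∧ ∀ᶠ n : ℕ in atTop, a ⌊(n : ℝ) * t⌋₊ / a n ≤ A := by
    have hp : 0 < G x₀ / (2 * t) := by positivity
    obtain ⟨y, hy, hy0⟩ := ((h.limZero.eventually_lt_const hp).and (eventually_gt_atTop 0)).exists
    refine ⟨2 * y / x₀, by positivity, ?_⟩
    have hlt : G x₀ / (2 * t) < G x₀ / t := by
      apply div_lt_div_of_pos_left hG₀ ht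
      linarith
    filter_upwards [h.upper y (2 * y) hy0 (by linarith) _ hy, h.lower_floor ht hx₀ hlt, hapos]
      with n h1 h2 h3
    by_contra hcon
    rw [not_le, lt_div_iff₀ h3, div_mul_eq_mul_div, div_lt_iff₀ hx₀] at hcon
    have h4 : F (a ⌊(n : ℝ) * t⌋₊ * x₀) ≤ F (a n * (2 * y)) := h.anti (by linarith)
    have := mul_le_mul_of_nonneg_left h4 (Nat.cast_nonneg (α := ℝ) n)
    linarith
  have hlo : ∃ B : ℝ, 0 < B ∧ ∀ᶠ n : ℕ in atTop, B ≤ a ⌊(n : ℝ) * t⌋₊ / a n := by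
    have hp : 0 < G x₀ / 2 * t := by positivity
    obtain ⟨y, hy, hy0⟩ := ((h.limZero.eventually_lt_const hp).and (eventually_gt_atTop 0)).exists
    refine ⟨x₀ / (2 * y), by positivity, ?_⟩
    have hy' : G y / t < G x₀ / 2 := by rwa [div_lt_iff₀ ht]
    filter_upwards [h.upper_floor ht hy0 (by linarith : y < 2 * y) hy',
      h.lower x₀ hx₀ _ (half_lt_self hG₀), hapos] with n h1 h2 h3
    by_contra hcon
    rw [not_le, div_lt_iff₀ h3, div_mul_eq_mul_div, lt_div_iff₀ (by positivity)] at hcon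
    have h4 : F (a n * x₀) ≤ F (a ⌊(n : ℝ) * t⌋₊ * (2 * y)) := h.anti (by linarith)
    have := mul_le_mul_of_nonneg_left h4 (Nat.cast_nonneg (α := ℝ) n)
    linarith
  obtain ⟨A, hA, hA'⟩ := hhi
  obtain ⟨B, hB, hB'⟩ := hlo
  obtain ⟨c, hc, φ, hφ, hlim⟩ := (isCompact_Icc (a := B) (b := A)).tendsto_subseq'
    (x := fun n : ℕ => a ⌊(n : ℝ) * t⌋₊ / a n)
    ((hB'.and hA').mono fun n hn => ⟨hn.1, hn.2⟩).frequently
  have hc0 : 0 < c := hB.trans_le hc.1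
  refine ⟨c, hc0, ?_⟩
  have key1 : ∀ x y, 0 < x → 0 < y → y < c * x → G x / t ≤ G y := by
    intro x y hx hy hyx
    by_contra hcon
    rw [not_le] at hcon
    obtain ⟨e, he1, he2⟩ := exists_between hcon
    obtain ⟨y', hy1, hy2⟩ := exists_between hyx
    have e3 : ∀ᶠ n in atTop, y' / x < ((fun n : ℕ => a ⌊(n : ℝ) * t⌋₊ / a n) ∘ φ) n :=
      hlim.eventually_const_lt (by rwa [div_lt_iff₀ hx])
    obtain ⟨n, h1, h2, h3, h4⟩ := ((hφ.tendsto_atTop.eventually (h.upper y y' hy hy1 e he1)).and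
      ((hφ.tendsto_atTop.eventually (h.lower_floor ht hx he2)).and
      (e3.and (hφ.tendsto_atTop.eventually hapos)))).exists
    simp only [Function.comp] at h3
    rw [lt_div_iff₀ h4, div_mul_eq_mul_div, div_lt_iff₀ hx] at h3
    have h5 := h.anti (by linarith : a (φ n) * y' ≤ a ⌊(φ n : ℝ) * t⌋₊ * x)
    have := mul_le_mul_of_nonneg_left h5 (Nat.cast_nonneg (α := ℝ) (φ n))
    linarith
  have key2 : ∀ x y, 0 < x → 0 < y → x < y → G (c * y) ≤ G x / t := by
    intro x y hx hy hyx
    by_contra hcon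
    rw [not_le] at hcon
    obtain ⟨e, he1, he2⟩ := exists_between hcon
    obtain ⟨z, hz1, hz2⟩ := h.limRight (c * y) (by positivity) e he2
    have e3 : ∀ᶠ n in atTop, ((fun n : ℕ => a ⌊(n : ℝ) * t⌋₊ / a n) ∘ φ) n < z / y :=
      hlim.eventually_lt_const (by rwa [lt_div_iff₀ hy])
    obtain ⟨n, h1, h2, h3, h4⟩ := ((hφ.tendsto_atTop.eventually
      (h.lower z ((by positivity : 0 < c * y).trans hz1) e hz2)).and
      ((hφ.tendsto_atTop.eventually (h.upper_floor ht hx hyx he1)).and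
      (e3.and (hφ.tendsto_atTop.eventually hapos)))).exists
    simp only [Function.comp] at h3
    rw [div_lt_iff₀ h4, div_mul_eq_mul_div, lt_div_iff₀ hy] at h3
    have h5 := h.anti (by linarith : a ⌊(φ n : ℝ) * t⌋₊ * y ≤ a (φ n) * z)
    have := mul_le_mul_of_nonneg_left h5 (Nat.cast_nonneg (α := ℝ) (φ n))
    linarith
  -- Both inequalities hold with a gap in the argument, and right-continuity of `G` closes it.
  intro x hx
  apply le_antisymm
  · by_contra hcon
    rw [not_le] at hcon
    obtain ⟨y, hy1, hy2⟩ := h.limRight _ (mul_pos hc0 hx) _ hcon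
    have := key2 x (y / c) hx (div_pos ((mul_pos hc0 hx).trans hy1) hc0) (by
      rwa [lt_div_iff₀ hc0, mul_comm])
    rw [mul_div_cancel₀ _ hc0.ne'] at this
    linarith
  · by_contra hcon
    rw [not_le, lt_div_iff₀ ht] at hcon
    obtain ⟨y, hy1, hy2⟩ := h.limRight _ hx _ hcon
    have := key1 y (c * x) (hx.trans hy1) (by positivity) (by gcongr)
    rw [div_le_iff₀ ht] at this
    linarith

/-- If `c < c'`, then `G` would be invariant under multiplication of its argument by `c' / c > 1`,
contradicting `G → 0` at infinity. -/
theorem scaling_unique (h : ScaledTailLimit F a G) {c c' : ℝ} (hc : 0 < c)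
    (heq : ∀ x, 0 < x → G (c * x) = G (c' * x)) : c' ≤ c := by
  by_contra hcon
  rw [not_le] at hcon
  obtain ⟨x₀, hx₀, hG₀⟩ := h.limPos
  have hρ : 1 < c' / c := by rwa [one_lt_div hc]
  have hstep : ∀ n : ℕ, G ((c' / c) ^ n * x₀) = G x₀ := by
    intro n
    induction n with
    | zero => simp
    | succ n ih =>
      have := heq ((c' / c) ^ n * x₀ / c) (by positivity)
      rw [mul_div_cancel₀ _ hc.ne', ih] at this
      rw [this]
      congr 1
      ring
  have hlim := h.limZero.comp ((tendsto_pow_atTop_atTop_of_one_lt hρ).atTop_mul_const hx₀)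
  have : (G ∘ fun n : ℕ => (c' / c) ^ n * x₀) = fun _ => G x₀ := funext hstep
  rw [this, tendsto_const_nhds_iff] at hlim
  exact hG₀.ne' hlim

/-- Let `c u` be the scaling factor for `t = exp u`. Uniqueness makes `c` multiplicative in `u`, so
`log c` is additive; being monotone it is measurable, hence continuous and linear. Solving `c u = x`
expresses `G x` as a power of `x` times `G 1`. -/
theorem exists_rpow (h : ScaledTailLimit F a G) :
    ∃ α κ : ℝ, 0 < α ∧ 0 < κ ∧ ∀ x, 0 < x → G x = κ * x ^ (-α) := by
  obtain ⟨x₀, hx₀, hG₀⟩ := h.limPos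
  choose c hc0 hc using fun u : ℝ => h.exists_scaling (Real.exp_pos u)
  have hadd : ∀ u v, c (u + v) = c u * c v := by
    intro u v
    have e : ∀ x, 0 < x → G (c (u + v) * x) = G (c u * c v * x) := by
      intro x hx
      rw [hc _ x hx, mul_assoc, hc u _ (mul_pos (hc0 v) hx), hc v x hx, Real.exp_add, div_div,
        mul_comm (Real.exp u)]
    exact le_antisymm (h.scaling_unique (mul_pos (hc0 u) (hc0 v)) fun x hx => (e x hx).symm)
      (h.scaling_unique (hc0 _) e)
  have hstrict : ∀ u, 0 < u → 1 < c u := by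
    intro u hu
    by_contra hcon
    rw [not_lt] at hcon
    have h1 : G x₀ ≤ G (c u * x₀) := h.limAnti (mul_pos (hc0 u) hx₀) hx₀ (by nlinarith)
    rw [hc u x₀ hx₀] at h1
    have : G x₀ / Real.exp u < G x₀ := div_lt_self hG₀ (by simpa using hu)
    linarith
  have hzero : c 0 = 1 := by
    have := hadd 0 0
    rw [add_zero] at this
    have h2 := hc0 0
    nlinarith
  let L : ℝ →+ ℝ :=
    { toFun := fun u => Real.log (c u)
      map_zero' := by simp [hzero]
      map_add' := fun u v => by rw [hadd, Real.log_mul (hc0 u).ne' (hc0 v).ne'] }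
  have hmono : Monotone L := by
    intro u v huv
    have h1 : L v = L u + L (v - u) := by rw [← map_add]; congr 1; ring
    have h2 : 0 ≤ L (v - u) := by
      rcases huv.eq_or_lt with rfl | hlt
      · simp
      · exact Real.log_nonneg (hstrict _ (by linarith)).le
    linarith
  have hcont : Continuous L :=
    MeasureTheory.Measure.AddMonoidHom.continuous_of_measurable L hmono.measurable
  have hlin : ∀ u, L u = u * L 1 := by
    intro u
    have := (L.toRealLinearMap hcont).map_smul u 1
    simpa using this
  have hβ : 0 < L 1 := Real.log_pos (hstrict 1 one_pos)
  have hpow : ∀ x, 0 < x → G x = G 1 * x ^ (-(L 1)⁻¹) := by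
    intro x hx
    have h1 := hlin (Real.log x / L 1)
    rw [div_mul_cancel₀ _ hβ.ne'] at h1
    have h2 : c (Real.log x / L 1) = x := Real.log_injOn_pos (hc0 _) hx h1
    have h3 := hc (Real.log x / L 1) 1 one_pos
    rw [h2, mul_one] at h3
    rw [h3, Real.rpow_def_of_pos hx, div_eq_mul_inv, ← Real.exp_neg]
    congr 2
    field_simp
  refine ⟨(L 1)⁻¹, G 1, by positivity, ?_, hpow⟩
  rcases (h.limNonneg 1).eq_or_lt with h0 | h0
  · rw [hpow x₀ hx₀, ← h0, zero_mul] at hG₀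
    exact absurd hG₀ (lt_irrefl _)
  · exact h0

theorem tendsto_mul (h : ScaledTailLimit F a G) {α κ : ℝ}
    (hG : ∀ x, 0 < x → G x = κ * x ^ (-α)) {x : ℝ} (hx : 0 < x) :
    Tendsto (fun n : ℕ => n * F (a n * x)) atTop (𝓝 (κ * x ^ (-α))) := by
  rw [tendsto_order]
  refine ⟨fun c hc => h.lower x hx c (by rwa [hG x hx]), fun c hc => ?_⟩
  have hcont : ContinuousAt (fun y : ℝ => κ * y ^ (-α)) x :=
    (Real.continuousAt_rpow_const x (-α) (Or.inl hx.ne')).const_mul κ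
  have h1 : ∀ᶠ y in 𝓝[<] x, κ * y ^ (-α) < c :=
    (hcont.tendsto.mono_left nhdsWithin_le_nhds).eventually_lt_const hc
  have h2 : ∀ᶠ y in 𝓝[<] x, 0 < y :=
    nhdsWithin_le_nhds (lt_mem_nhds hx)
  obtain ⟨y, hy1, hy2, hy3⟩ := (h1.and (h2.and self_mem_nhdsWithin)).exists
  exact h.upper y x hy2 hy3 c (by rwa [hG y hy2])

theorem pos (h : ScaledTailLimit F a G) (x : ℝ) : 0 < F x := by
  obtain ⟨x₀, hx₀, hG₀⟩ := h.limPos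
  obtain ⟨n, h1, h2⟩ := ((h.lower x₀ hx₀ 0 hG₀).and
    ((h.scale.atTop_mul_const hx₀).eventually_ge_atTop x)).exists
  exact lt_of_lt_of_le (pos_of_mul_pos_right h1 (Nat.cast_nonneg n)) (h.anti h2)

/-! ### Transfer from the norming sequence to arbitrary levels -/

section Inverse

variable {ι : Type*} {l : Filter ι} {M : ι → ℝ} {α κ : ℝ}

/-- The index `m = ⌊1 / F(M)⌋` inverts the scale: `m F(M) → 1`, so that `a_m` is comparable to the
level `M`. The filter is arbitrary so that `M` may be a sequence or the identity on `ℝ`. -/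
theorem tendsto_floor_inv (h : ScaledTailLimit F a G) (hF : Tendsto F atTop (𝓝 0))
    (hM : Tendsto M l atTop) : Tendsto (fun i => ⌊(F (M i))⁻¹⌋₊) l atTop := by
  refine tendsto_nat_floor_atTop.comp (tendsto_inv_nhdsGT_zero.comp ?_)
  exact tendsto_nhdsWithin_iff.2 ⟨hF.comp hM, Eventually.of_forall fun i => h.pos _⟩

theorem tendsto_floor_inv_mul (h : ScaledTailLimit F a G) (hF : Tendsto F atTop (𝓝 0))
    (hM : Tendsto M l atTop) : Tendsto (fun i => (⌊(F (M i))⁻¹⌋₊ : ℝ) * F (M i)) l (𝓝 1) := by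
  have h1 : Tendsto (fun i => (F (M i))⁻¹) l atTop := tendsto_inv_nhdsGT_zero.comp
    (tendsto_nhdsWithin_iff.2 ⟨hF.comp hM, Eventually.of_forall fun i => h.pos _⟩)
  refine ((tendsto_nat_floor_div_atTop (R := ℝ)).comp h1).congr fun i => ?_
  simp

/-- The limit `κ b^(-α)` of `m F(a_m b)` is strictly decreasing in `b` and equals `1 = lim m F(M)`
exactly at `b = κ^(1/α)`. Monotonicity of `F` then traps `M / a_m` there. -/
theorem tendsto_div_scale (h : ScaledTailLimit F a G) (hF : Tendsto F atTop (𝓝 0))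
    (hα : 0 < α) (hκ : 0 < κ) (hG : ∀ x, 0 < x → G x = κ * x ^ (-α)) (hM : Tendsto M l atTop) :
    Tendsto (fun i => M i / a ⌊(F (M i))⁻¹⌋₊) l (𝓝 (κ ^ α⁻¹)) := by
  have hm := h.tendsto_floor_inv hF hM
  have h1 := h.tendsto_floor_inv_mul hF hM
  have hb : κ * (κ ^ α⁻¹) ^ (-α) = 1 := by
    rw [← Real.rpow_mul hκ.le, mul_neg, inv_mul_cancel₀ hα.ne', Real.rpow_neg_one,
      mul_inv_cancel₀ hκ.ne']
  have hb0 : 0 < κ ^ α⁻¹ := by positivity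
  have hstrict : ∀ x y, 0 < x → x < y → κ * y ^ (-α) < κ * x ^ (-α) := fun x y hx hxy =>
    mul_lt_mul_of_pos_left (Real.rpow_lt_rpow_of_neg hx hxy (by linarith)) hκ
  have hapos := hm.eventually (h.scale.eventually_gt_atTop 0)
  rw [tendsto_order]
  constructor
  · intro b hb'
    rcases le_or_gt b 0 with hb0' | hb0'
    · filter_upwards [hapos, hM.eventually_gt_atTop 0] with i h2 h3
      exact hb0'.trans_lt (by positivity)
    · have h2 := hstrict b _ hb0' hb'
      rw [hb] at h2
      obtain ⟨e, he1, he2⟩ := exists_between h2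
      filter_upwards [hapos, h1.eventually_lt_const he1,
        (((h.tendsto_mul hG hb0').comp hm).eventually_const_lt he2)] with i h3 h4 h5
      rw [lt_div_iff₀ h3]
      by_contra hcon
      have h6 := h.anti (by linarith : M i ≤ a ⌊(F (M i))⁻¹⌋₊ * b)
      have := mul_le_mul_of_nonneg_left h6 (Nat.cast_nonneg (α := ℝ) ⌊(F (M i))⁻¹⌋₊)
      simp only [Function.comp] at h5
      linarith
  · intro b hb'
    have h2 := hstrict _ b hb0 hb'
    rw [hb] at h2
    obtain ⟨e, he1, he2⟩ := exists_between h2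
    filter_upwards [hapos, h1.eventually_const_lt he2,
      (((h.tendsto_mul hG (hb0.trans hb')).comp hm).eventually_lt_const he1)] with i h3 h4 h5
    rw [div_lt_iff₀ h3]
    by_contra hcon
    have h6 := h.anti (by linarith : a ⌊(F (M i))⁻¹⌋₊ * b ≤ M i)
    have := mul_le_mul_of_nonneg_left h6 (Nat.cast_nonneg (α := ℝ) ⌊(F (M i))⁻¹⌋₊)
    simp only [Function.comp] at h5
    linarith

theorem tendsto_ratio (h : ScaledTailLimit F a G) (hF : Tendsto F atTop (𝓝 0))
    (hα : 0 < α) (hκ : 0 < κ) (hG : ∀ x, 0 < x → G x = κ * x ^ (-α)) (hM : Tendsto M l atTop)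
    {t : ℝ} (ht : 0 < t) :
    Tendsto (fun i => F (t * M i) / F (M i)) l (𝓝 (t ^ (-α))) := by
  have hm := h.tendsto_floor_inv hF hM
  have h1 := h.tendsto_floor_inv_mul hF hM
  have hs := h.tendsto_div_scale hF hα hκ hG hM
  have hb0 : 0 < κ ^ α⁻¹ := by positivity
  have hb : κ * (t * κ ^ α⁻¹) ^ (-α) = t ^ (-α) := by
    rw [Real.mul_rpow ht.le hb0.le, ← Real.rpow_mul hκ.le, mul_neg, inv_mul_cancel₀ hα.ne',
      Real.rpow_neg_one]
    field_simp
  have hcont : ContinuousAt (fun y : ℝ => κ * y ^ (-α)) (t * κ ^ α⁻¹) :=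
    (Real.continuousAt_rpow_const _ (-α) (Or.inl (by positivity))).const_mul κ
  have hts := hs.const_mul t
  have hapos := hm.eventually (h.scale.eventually_gt_atTop 0)
  have hnum : Tendsto (fun i => (⌊(F (M i))⁻¹⌋₊ : ℝ) * F (t * M i)) l (𝓝 (t ^ (-α))) := by
    rw [← hb, tendsto_order]
    constructor
    · intro e he
      obtain ⟨y, hy1, hy2⟩ := (((hcont.tendsto.mono_left
        nhdsWithin_le_nhds).eventually_const_lt he).and
        (self_mem_nhdsWithin : Set.Ioi (t * κ ^ α⁻¹) ∈ 𝓝[>] (t * κ ^ α⁻¹))).exists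
      have hy0 : 0 < y := (by positivity : 0 < t * κ ^ α⁻¹).trans hy2
      filter_upwards [hapos, ((h.tendsto_mul hG hy0).comp hm).eventually_const_lt hy1,
        hts.eventually_lt_const hy2] with i h3 h4 h5
      rw [← mul_div_assoc, div_lt_iff₀ h3] at h5
      have h6 := h.anti (by linarith : t * M i ≤ a ⌊(F (M i))⁻¹⌋₊ * y)
      have := mul_le_mul_of_nonneg_left h6 (Nat.cast_nonneg (α := ℝ) ⌊(F (M i))⁻¹⌋₊)
      simp only [Function.comp] at h4
      linarith
    · intro e he
      have hpos : ∀ᶠ y in 𝓝[<] (t * κ ^ α⁻¹), 0 < y :=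
        nhdsWithin_le_nhds (lt_mem_nhds (by positivity))
      obtain ⟨y, hy1, hy0, hy2⟩ := (((hcont.tendsto.mono_left
        nhdsWithin_le_nhds).eventually_lt_const he).and (hpos.and
        (self_mem_nhdsWithin : Set.Iio (t * κ ^ α⁻¹) ∈ 𝓝[<] (t * κ ^ α⁻¹)))).exists
      filter_upwards [hapos, ((h.tendsto_mul hG hy0).comp hm).eventually_lt_const hy1,
        hts.eventually_const_lt hy2] with i h3 h4 h5
      rw [← mul_div_assoc, lt_div_iff₀ h3] at h5
      have h6 := h.anti (by linarith : a ⌊(F (M i))⁻¹⌋₊ * y ≤ t * M i)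
      have := mul_le_mul_of_nonneg_left h6 (Nat.cast_nonneg (α := ℝ) ⌊(F (M i))⁻¹⌋₊)
      simp only [Function.comp] at h4
      linarith
  have := hnum.div h1 one_ne_zero
  rw [div_one] at this
  refine this.congr' ?_
  filter_upwards [hm.eventually_gt_atTop 0] with i hi
  have hi' : (0 : ℝ) < ⌊(F (M i))⁻¹⌋₊ := by exact_mod_cast hi
  simp only [Pi.div_apply]
  rw [mul_div_mul_left _ _ hi'.ne']

end Inverse

end ScaledTailLimit

end ScaledTails

/-! ### Tail functions of measures and their approximation by ramps -/

section TailMeasure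

variable {d : ℕ}

theorem measurableSet_lt_norm (x : ℝ) : MeasurableSet {y : Vec d | x < ‖y‖} :=
  measurableSet_lt measurable_const measurable_norm

theorem tendsto_measureReal_setOf_lt_norm (m : Measure (Vec d)) {x₀ : ℝ}
    (h : m {y | x₀ < ‖y‖} ≠ ∞) :
    Tendsto (fun x => m.real {y | x < ‖y‖}) atTop (𝓝 0) := by
  have h1 : Tendsto (fun x : ℝ => m {y | x < ‖y‖}) atTop (𝓝 (m (⋂ x : ℝ, {y | x < ‖y‖}))) :=
    tendsto_measure_iInter_atTop (fun x => (measurableSet_lt_norm x).nullMeasurableSet)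
      (fun x y hxy z hz => lt_of_le_of_lt hxy hz) ⟨x₀, h⟩
  have h2 : (⋂ x : ℝ, {y : Vec d | x < ‖y‖}) = ∅ := by
    ext y
    simp only [Set.mem_iInter, Set.mem_ofPred_eq, Set.mem_empty_iff_false, iff_false, not_forall]
    exact ⟨‖y‖, lt_irrefl _⟩
  rw [h2, measure_empty] at h1
  exact (ENNReal.tendsto_toReal ENNReal.zero_ne_top).comp h1

theorem tendsto_measure_setOf_add_lt_norm (m : Measure (Vec d)) (x : ℝ) :
    Tendsto (fun n : ℕ => m {y | x + 1 / ((n : ℝ) + 1) < ‖y‖}) atTop (𝓝 (m {y | x < ‖y‖})) := by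
  have hmono : Monotone fun n : ℕ => {y : Vec d | x + 1 / ((n : ℝ) + 1) < ‖y‖} := by
    intro n k hnk y hy
    simp only [Set.mem_ofPred_eq] at hy ⊢
    refine lt_of_le_of_lt ?_ hy
    have := Nat.one_div_le_one_div (α := ℝ) hnk
    linarith
  have : {y : Vec d | x < ‖y‖} = ⋃ n : ℕ, {y : Vec d | x + 1 / ((n : ℝ) + 1) < ‖y‖} := by
    ext y
    simp only [Set.mem_iUnion, Set.mem_ofPred_eq]
    constructor
    · intro h
      obtain ⟨n, hn⟩ := exists_nat_one_div_lt (sub_pos.2 h)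
      exact ⟨n, by linarith⟩
    · rintro ⟨n, hn⟩
      exact lt_trans (lt_add_of_pos_right _ Nat.one_div_pos_of_nat) hn
  rw [this]
  exact tendsto_measure_iUnion_atTop hmono

theorem exists_lt_measureReal_setOf_lt_norm {m : Measure (Vec d)} {x : ℝ}
    (h : m {y | x < ‖y‖} ≠ ∞) {c : ℝ} (hc : c < m.real {y | x < ‖y‖}) :
    ∃ z, x < z ∧ c < m.real {y | z < ‖y‖} := by
  have h1 := (ENNReal.tendsto_toReal h).comp (tendsto_measure_setOf_add_lt_norm m x)
  obtain ⟨n, hn⟩ := (h1.eventually_const_lt hc).exists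
  exact ⟨_, lt_add_of_pos_right x Nat.one_div_pos_of_nat, hn⟩

theorem antitone_normTail {Ω : Type*} [MeasurableSpace Ω] (P : Measure Ω) [IsFiniteMeasure P]
    (H : Ω → Vec d) : Antitone (normTail P H) := fun _ _ hxy =>
  measureReal_mono fun _ hω => lt_of_le_of_lt hxy hω

theorem normTail_eq_map {Ω : Type*} [MeasurableSpace Ω] (P : Measure Ω)
    {H : Ω → Vec d} (hH : Measurable H) (x : ℝ) :
    normTail P H x = (P.map H).real {y | x < ‖y‖} := by
  rw [map_measureReal_apply hH (measurableSet_lt_norm x)]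
  rfl

theorem tendsto_normTail {Ω : Type*} [MeasurableSpace Ω] (P : Measure Ω) [IsFiniteMeasure P]
    {H : Ω → Vec d} (hH : Measurable H) : Tendsto (normTail P H) atTop (𝓝 0) := by
  simp_rw [funext (normTail_eq_map P hH)]
  exact tendsto_measureReal_setOf_lt_norm _ (x₀ := 0) (measure_ne_top _ _)

/-- The piecewise linear function that is `0` up to `p` and `1` from `q` on. -/
def ramp (p q u : ℝ) : ℝ := max 0 (min 1 ((u - p) / (q - p)))

theorem continuous_ramp (p q : ℝ) : Continuous (ramp p q) := by
  unfold ramp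
  fun_prop

theorem ramp_nonneg (p q u : ℝ) : 0 ≤ ramp p q u := le_max_left _ _

theorem ramp_le_one (p q u : ℝ) : ramp p q u ≤ 1 := max_le zero_le_one (min_le_left _ _)

theorem ramp_eq_zero {p q u : ℝ} (hpq : p < q) (hu : u ≤ p) : ramp p q u = 0 := by
  rw [ramp, max_eq_left]
  exact (min_le_right _ _).trans (div_nonpos_of_nonpos_of_nonneg (by linarith) (by linarith))

theorem ramp_eq_one {p q u : ℝ} (hpq : p < q) (hu : q ≤ u) : ramp p q u = 1 := by
  have : 1 ≤ (u - p) / (q - p) := by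
    rw [one_le_div (by linarith)]
    linarith
  rw [ramp, min_eq_left this]
  simp

theorem ramp_le_indicator {p q : ℝ} (hpq : p < q) (y : Vec d) :
    ramp p q ‖y‖ ≤ Set.indicator {y : Vec d | p < ‖y‖} (fun _ => (1 : ℝ)) y := by
  by_cases h : p < ‖y‖
  · rw [Set.indicator_of_mem (by exact h)]
    exact ramp_le_one _ _ _
  · rw [Set.indicator_of_notMem (by exact h), ramp_eq_zero hpq (not_lt.1 h)]

theorem indicator_le_ramp {p q : ℝ} (hpq : p < q) (y : Vec d) :
    Set.indicator {y : Vec d | q < ‖y‖} (fun _ => (1 : ℝ)) y ≤ ramp p q ‖y‖ := by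
  by_cases h : q < ‖y‖
  · rw [Set.indicator_of_mem (by exact h), ramp_eq_one hpq (le_of_lt h)]
  · rw [Set.indicator_of_notMem (by exact h)]
    exact ramp_nonneg _ _ _

theorem integrable_ramp_norm {m : Measure (Vec d)} {p q : ℝ} (hpq : p < q)
    (h : m {y | p < ‖y‖} ≠ ∞) : Integrable (fun y => ramp p q ‖y‖) m := by
  have h1 : Integrable (Set.indicator {y : Vec d | p < ‖y‖} (fun _ => (1 : ℝ))) m :=
    (integrable_indicator_iff (measurableSet_lt_norm p)).2 (integrableOn_const h)
  refine h1.mono' ((continuous_ramp p q).comp continuous_norm).aestronglyMeasurable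
    (Eventually.of_forall fun y => ?_)
  rw [Real.norm_of_nonneg (ramp_nonneg _ _ _)]
  exact ramp_le_indicator hpq y

theorem integral_ramp_norm_le {m : Measure (Vec d)} {p q : ℝ} (hpq : p < q)
    (h : m {y | p < ‖y‖} ≠ ∞) : ∫ y, ramp p q ‖y‖ ∂m ≤ m.real {y | p < ‖y‖} := by
  rw [← integral_indicator_one (measurableSet_lt_norm p)]
  exact integral_mono (integrable_ramp_norm hpq h)
    ((integrable_indicator_iff (measurableSet_lt_norm p)).2 (integrableOn_const h))
    (ramp_le_indicator hpq)

theorem le_integral_ramp_norm {m : Measure (Vec d)} {p q : ℝ} (hpq : p < q)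
    (h : m {y | p < ‖y‖} ≠ ∞) : m.real {y | q < ‖y‖} ≤ ∫ y, ramp p q ‖y‖ ∂m := by
  have h' : m {y | q < ‖y‖} ≠ ∞ :=
    ne_top_of_le_ne_top h (measure_mono fun y hy => hpq.trans hy)
  rw [← integral_indicator_one (measurableSet_lt_norm q)]
  exact integral_mono ((integrable_indicator_iff (measurableSet_lt_norm q)).2
    (integrableOn_const h')) (integrable_ramp_norm hpq h) (indicator_le_ramp hpq)

/-- A ramp that is constant from `x` on does not see how far beyond `x` the vector lies, so it
factors through the retraction at scale `x`. -/
theorem ramp_norm_ballRetract {p x' x : ℝ} (hx : 0 < x) (hp : p = x' / x) (hxx : x' < x)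
    (y : Vec d) : ramp p 1 ‖ballRetract (x⁻¹ • y)‖ = ramp x' x ‖y‖ := by
  have hp1 : p < 1 := by rw [hp]; exact (div_lt_one hx).2 hxx
  rw [norm_ballRetract, norm_smul, norm_inv, Real.norm_of_nonneg hx.le]
  rcases le_total ‖y‖ x with h | h
  · have : x⁻¹ * ‖y‖ ≤ 1 := by rwa [inv_mul_le_iff₀ hx, mul_one]
    rw [min_eq_left this, ramp, ramp, hp]
    congr 2
    field_simp
  · have : 1 ≤ x⁻¹ * ‖y‖ := by rwa [le_inv_mul_iff₀ hx, mul_one]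
    rw [min_eq_right this, ramp_eq_one hp1 le_rfl, ramp_eq_one hxx h]

end TailMeasure

section Scale

variable {Ω : Type*} [MeasurableSpace Ω] {P : Measure Ω} {d : ℕ} {H : Ω → Vec d}

theorem normTail_smul_inv {c x : ℝ} (hc : 0 < c) (hH : Measurable H) :
    (P.map (fun ω => c⁻¹ • H ω)).real {y | x < ‖y‖} = normTail P H (c * x) := by
  rw [map_measureReal_apply (by fun_prop) (measurableSet_lt_norm x), normTail]
  congr 1
  ext ω
  simp only [Set.mem_preimage, Set.mem_ofPred_eq]
  rw [norm_smul, norm_inv, Real.norm_of_nonneg hc.le, lt_inv_mul_iff₀ hc]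

theorem measureReal_lt_norm_smul_inv {c x : ℝ} (hc : 0 < c) :
    P.real {ω | x < ‖c⁻¹ • H ω‖} = normTail P H (c * x) := by
  rw [normTail]
  congr 1
  ext ω
  simp only [Set.mem_ofPred_eq]
  rw [norm_smul, norm_inv, Real.norm_of_nonneg hc.le, lt_inv_mul_iff₀ hc]

end Scale

/-! ### The scaled law of `H` and its retraction at arbitrary levels -/

section Limit

variable {Ω : Type*} [MeasurableSpace Ω] {P : Measure Ω} [IsProbabilityMeasure P] {d : ℕ}
  {H : Ω → Vec d} {μ : Measure (Vec d)} {a : ℕ → ℝ}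

theorem scaledTailLimit (hH : Measurable H) (hμ0 : μ {0} = 0) (hμ : μ ≠ 0)
    (ha : Tendsto a atTop atTop)
    (hHμ : VagueTendstoOutside 0 (fun n => (n : ℝ≥0∞) • P.map (fun ω => (a n)⁻¹ • H ω)) μ) :
    ScaledTailLimit (normTail P H) a (fun x => μ.real {y | x < ‖y‖}) := by
  have hfin : ∀ x : ℝ, 0 < x → μ {y | x < ‖y‖} ≠ ∞ := fun x hx =>
    ne_top_of_le_ne_top (measure_setOf_le_norm_lt_top hHμ.1 hx).ne
      (measure_mono fun y hy => (le_of_lt hy : x ≤ ‖y‖))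
  have hramp : ∀ x' x, 0 < x' → x' < x →
      Tendsto (fun n : ℕ => (n : ℝ) * ∫ y, ramp x' x ‖y‖ ∂(P.map (fun ω => (a n)⁻¹ • H ω))) atTop
        (𝓝 (∫ y, ramp x' x ‖y‖ ∂μ)) := by
    intro x' x hx' hx
    have hx0 := hx'.trans hx
    have hp : x' / x < 1 := (div_lt_one hx0).2 hx
    have := tendsto_integral_ballRetract hHμ (inv_pos.2 hx0) (fun y => ramp (x' / x) 1 ‖y‖)
      ((continuous_ramp _ _).comp continuous_norm) (δ := x' / x) (by positivity)
      (fun y hy => ramp_eq_zero hp hy)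
    simp only [ramp_norm_ballRetract hx0 rfl hx, integral_smul_measure] at this
    simpa using this
  have hapos := ha.eventually_gt_atTop 0
  refine ⟨antitone_normTail P H, fun x => measureReal_nonneg, ha, ?_, fun x => measureReal_nonneg,
    fun x hx c hc => exists_lt_measureReal_setOf_lt_norm (hfin x hx) hc,
    tendsto_measureReal_setOf_lt_norm μ (hfin 1 one_pos), ?_, ?_, ?_⟩
  · intro x hx y hy hxy
    exact measureReal_mono (fun z hz => lt_of_le_of_lt hxy hz) (hfin x hx)
  -- If every tail of `μ` at a positive level vanished, `μ` would be carried by the origin, where it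
  -- has no mass.
  · by_contra! hcon
    have h1 : ∀ n : ℕ, μ {y | (0 : ℝ) + 1 / ((n : ℝ) + 1) < ‖y‖} = 0 := by
      intro n
      have hn : (0 : ℝ) < 0 + 1 / ((n : ℝ) + 1) := by positivity
      have := le_antisymm (hcon _ hn) measureReal_nonneg
      rwa [measureReal_eq_zero_iff (hfin _ hn)] at this
    have h2 := tendsto_measure_setOf_add_lt_norm μ 0
    simp only [h1] at h2
    have h3 : μ {y | 0 < ‖y‖} = 0 := (tendsto_nhds_unique h2 tendsto_const_nhds)
    apply hμ
    rw [← Measure.measure_univ_eq_zero]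
    have : (Set.univ : Set (Vec d)) = {0} ∪ {y | 0 < ‖y‖} := by
      ext y
      simp [eq_or_ne]
    rw [this]
    exact measure_union_null hμ0 h3
  · intro x' x hx' hx c hc
    filter_upwards [((hramp x' x hx' hx).eventually_lt_const
      (lt_of_le_of_lt (integral_ramp_norm_le hx (hfin x' hx')) hc)), hapos] with n h1 h2
    refine lt_of_le_of_lt ?_ h1
    rw [← normTail_smul_inv h2 hH]
    gcongr
    exact le_integral_ramp_norm hx
      (@measure_ne_top _ _ _ (Measure.isFiniteMeasure_map _ _) _)
  · intro x hx c hc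
    obtain ⟨z, hz, hz2⟩ := exists_lt_measureReal_setOf_lt_norm (hfin x hx) hc
    filter_upwards [((hramp x z hx hz).eventually_const_lt
      (lt_of_lt_of_le hz2 (le_integral_ramp_norm hz (hfin x hx)))), hapos] with n h1 h2
    refine lt_of_lt_of_le h1 ?_
    rw [← normTail_smul_inv h2 hH]
    gcongr
    exact integral_ramp_norm_le hz (@measure_ne_top _ _ _ (Measure.isFiniteMeasure_map _ _) _)

/-- The displacement is radial, of size `|min (ρ‖x‖) 1 - min ‖x‖ 1|`. The bound is uniform in `x`,
although `ρ • x - x` is unbounded; this permits replacing one normalization by an asymptotically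
equal one. -/
theorem norm_ballRetract_smul_sub_le {ρ : ℝ} (hρ : 0 < ρ) (x : Vec d) :
    ‖ballRetract (ρ • x) - ballRetract x‖ ≤ |ρ - 1| := by
  have h1 : ballRetract (ρ • x) - ballRetract x =
      ((max 1 (ρ * ‖x‖))⁻¹ * ρ - (max 1 ‖x‖)⁻¹) • x := by
    rw [ballRetract, ballRetract, norm_smul, Real.norm_of_nonneg hρ.le, sub_smul, smul_smul]
  rw [h1, norm_smul, Real.norm_eq_abs, ← abs_of_nonneg (norm_nonneg x), ← abs_mul,
    abs_of_nonneg (norm_nonneg x), sub_mul]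
  have e : ∀ t : ℝ, 0 ≤ t → (max 1 t)⁻¹ * t = min t 1 := by
    intro t ht
    rcases le_total t 1 with h | h
    · simp [h]
    · rw [max_eq_right h, min_eq_right h, inv_mul_cancel₀ (by positivity)]
  rw [mul_assoc, e _ (by positivity), e _ (norm_nonneg x)]
  have hx := norm_nonneg x
  rcases le_total ‖x‖ 1 with h2 | h2 <;> rcases le_total (ρ * ‖x‖) 1 with h3 | h3 <;>
    rcases le_total ρ 1 with h4 | h4 <;> simp only [h2, h3, min_eq_left, min_eq_right] <;>
    rw [abs_le] <;> (first | rw [abs_of_nonneg (by linarith : 0 ≤ ρ - 1)] |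
      rw [abs_of_nonpos (by linarith : ρ - 1 ≤ 0)]) <;> constructor <;> nlinarith

theorem abs_comp_ballRetract_sub_le {g : Vec d → ℝ} {δ e η : ℝ} (he : 0 ≤ e)
    (hg0 : ∀ x, ‖x‖ ≤ δ → g x = 0)
    (hunif : ∀ x y, ‖x‖ ≤ 1 → ‖y‖ ≤ 1 → ‖x - y‖ < η → |g x - g y| ≤ e) {x y : Vec d}
    (hxy : ‖ballRetract x - ballRetract y‖ < η) :
    |g (ballRetract x) - g (ballRetract y)| ≤
      e * (Set.indicator {y : Vec d | δ < ‖y‖} (fun _ => (1 : ℝ)) x +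
        Set.indicator {y : Vec d | δ < ‖y‖} (fun _ => (1 : ℝ)) y) := by
  have hb : ∀ z : Vec d, ‖ballRetract z‖ ≤ 1 := fun z => by
    rw [norm_ballRetract]; exact min_le_right _ _
  have h1 := hunif _ _ (hb x) (hb y) hxy
  have hz : ∀ z : Vec d, ¬ δ < ‖z‖ → g (ballRetract z) = 0 := fun z hz =>
    hg0 _ (by rw [norm_ballRetract]; exact (min_le_left _ _).trans (not_lt.1 hz))
  have hi : ∀ z : Vec d, 0 ≤ Set.indicator {y : Vec d | δ < ‖y‖} (fun _ => (1 : ℝ)) z :=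
    fun z => Set.indicator_nonneg (fun _ _ => zero_le_one) z
  by_cases hx : δ < ‖x‖
  · rw [Set.indicator_of_mem (by exact hx)]
    nlinarith [hi y]
  by_cases hy : δ < ‖y‖
  · rw [Set.indicator_of_mem (s := {y : Vec d | δ < ‖y‖}) (a := y) (by exact hy)]
    nlinarith [hi x]
  · rw [hz x hx, hz y hy, sub_zero, abs_zero]
    have := hi x
    have := hi y
    positivity

theorem integrable_comp_ballRetract {g : Vec d → ℝ} (hg : Continuous g) {Y : Ω → Vec d}
    (hY : Measurable Y) : Integrable (fun ω => g (ballRetract (Y ω))) P := by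
  obtain ⟨C, hC⟩ := (isCompact_closedBall (0 : Vec d) 1).exists_bound_of_continuousOn
    hg.continuousOn
  refine Integrable.of_bound
    ((hg.comp continuous_ballRetract).measurable.comp hY).aestronglyMeasurable C
    (Eventually.of_forall fun ω => hC _ ?_)
  rw [mem_closedBall_zero_iff, norm_ballRetract]
  exact min_le_right _ _

variable {ι : Type*} {l : Filter ι} {M : ι → ℝ} {α κ : ℝ}

/-- With `m = ⌊1 / P(‖H‖ > M)⌋` and `b = κ^(1/α)`, the level `M` may be replaced by `b a_m`. By
uniform continuity of `g` on the unit ball the error is a small constant times the probabilities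
that `‖H‖` exceeds `δ M` or `δ b a_m`, and `m` times these stays bounded. -/
theorem tendsto_integral_ballRetract_div_aux (hH : Measurable H)
    (hHμ : VagueTendstoOutside 0 (fun n => (n : ℝ≥0∞) • P.map (fun ω => (a n)⁻¹ • H ω)) μ)
    {G : ℝ → ℝ} (hS : ScaledTailLimit (normTail P H) a G)
    (hα : 0 < α) (hκ : 0 < κ) (hG : ∀ x, 0 < x → G x = κ * x ^ (-α)) (hM : Tendsto M l atTop)
    (g : Vec d → ℝ) (hg : Continuous g) {δ : ℝ} (hδ : 0 < δ) (hg0 : ∀ x, ‖x‖ ≤ δ → g x = 0) :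
    Tendsto (fun i => (∫ ω, g (ballRetract ((M i)⁻¹ • H ω)) ∂P) / normTail P H (M i)) l
      (𝓝 (∫ x, g (ballRetract ((κ ^ α⁻¹)⁻¹ • x)) ∂μ)) := by
  set b := κ ^ α⁻¹ with hbdef
  have hb : 0 < b := by positivity
  have hF := tendsto_normTail P hH
  have hm := hS.tendsto_floor_inv hF hM
  have h1 := hS.tendsto_floor_inv_mul hF hM
  have hs := hS.tendsto_div_scale hF hα hκ hG hM
  set m : ι → ℕ := fun i => ⌊(normTail P H (M i))⁻¹⌋₊ with hmdef
  have hA : Tendsto (fun i => (m i : ℝ) * ∫ ω, g (ballRetract (b⁻¹ • (a (m i))⁻¹ • H ω)) ∂P) l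
      (𝓝 (∫ x, g (ballRetract (b⁻¹ • x)) ∂μ)) := by
    have := (tendsto_integral_ballRetract hHμ (inv_pos.2 hb) g hg hδ hg0).comp hm
    refine this.congr fun i => ?_
    simp only [Function.comp, integral_smul_measure]
    rw [integral_map (by fun_prop)]
    · simp
    · refine (hg.comp (continuous_ballRetract.comp ?_)).aestronglyMeasurable
      fun_prop
  have hdiff : Tendsto (fun i => (m i : ℝ) * (∫ ω, g (ballRetract ((M i)⁻¹ • H ω)) ∂P) -
      (m i : ℝ) * ∫ ω, g (ballRetract (b⁻¹ • (a (m i))⁻¹ • H ω)) ∂P) l (𝓝 0) := by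
    have hK1 : Tendsto (fun i => (m i : ℝ) * normTail P H (δ * M i)) l (𝓝 (δ ^ (-α))) := by
      have := h1.mul (hS.tendsto_ratio hF hα hκ hG hM hδ)
      rw [one_mul] at this
      refine this.congr fun i => ?_
      rw [mul_assoc, mul_div_cancel₀ _ (hS.pos (M i)).ne']
    have hK2 : Tendsto (fun i => (m i : ℝ) * normTail P H (a (m i) * (b * δ))) l
        (𝓝 (κ * (b * δ) ^ (-α))) := (hS.tendsto_mul hG (by positivity)).comp hm
    have hK := hK1.add hK2
    set K := δ ^ (-α) + κ * (b * δ) ^ (-α) with hKdef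
    have hK0 : 0 < K := by positivity
    rw [Metric.tendsto_nhds]
    intro e he
    -- Here `K` is the limit of `m` times the two tail probabilities, so eventually the total error
    -- is at most `(K + 1) * e / (2 * (K + 1)) = e / 2`.
    have he' : 0 < e / (2 * (K + 1)) := by positivity
    obtain ⟨η, hη, hunif⟩ := Metric.uniformContinuousOn_iff.1
      ((isCompact_closedBall (0 : Vec d) 1).uniformContinuousOn_of_continuous hg.continuousOn)
      _ he'
    have hρ : Tendsto (fun i => b * a (m i) / M i) l (𝓝 1) := by
      have := (hs.inv₀ hb.ne').const_mul b
      rw [mul_inv_cancel₀ hb.ne'] at this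
      refine this.congr fun i => ?_
      rw [inv_div, mul_div_assoc]
    have hρ' : ∀ᶠ i in l, |b * a (m i) / M i - 1| < η := by
      have := (Metric.tendsto_nhds.1 hρ) η hη
      simpa [Real.dist_eq] using this
    filter_upwards [hρ', hK.eventually_lt_const (lt_add_one K), hM.eventually_gt_atTop 0,
      hm.eventually (hS.scale.eventually_gt_atTop 0)] with i h3 h4 h5 h6
    rw [dist_zero_right, ← mul_sub, norm_mul, Real.norm_natCast,
      ← integral_sub (integrable_comp_ballRetract hg (by fun_prop))
        (integrable_comp_ballRetract hg (by fun_prop))]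
    have hba : 0 < b * a (m i) := by positivity
    have hms : ∀ c : ℝ, MeasurableSet {ω | δ < ‖c⁻¹ • H ω‖} := fun c =>
      measurableSet_lt measurable_const (by fun_prop)
    have h7 : ‖∫ ω, (g (ballRetract ((M i)⁻¹ • H ω)) -
        g (ballRetract (b⁻¹ • (a (m i))⁻¹ • H ω))) ∂P‖ ≤
        ∫ ω, e / (2 * (K + 1)) * (Set.indicator {ω | δ < ‖(M i)⁻¹ • H ω‖} (fun _ => (1 : ℝ)) ω +
          Set.indicator {ω | δ < ‖(b * a (m i))⁻¹ • H ω‖} (fun _ => (1 : ℝ)) ω) ∂P := by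
      refine norm_integral_le_of_norm_le (Integrable.const_mul (Integrable.add
        (IntegrableOn.integrable_indicator (integrableOn_const (measure_ne_top _ _)) (hms _))
        (IntegrableOn.integrable_indicator (integrableOn_const (measure_ne_top _ _)) (hms _))) _)
        (Eventually.of_forall fun ω => ?_)
      have e1 : b⁻¹ • (a (m i))⁻¹ • H ω = (b * a (m i))⁻¹ • H ω := by
        rw [smul_smul, mul_inv]
      have e2 : (M i)⁻¹ • H ω = (b * a (m i) / M i) • ((b * a (m i))⁻¹ • H ω) := by
        rw [smul_smul]
        congr 1
        field_simp
      rw [Real.norm_eq_abs, e1]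
      refine abs_comp_ballRetract_sub_le he'.le hg0 (η := η) (fun x y hx hy hxy => ?_) ?_
      · have := hunif x (by simpa using hx) y (by simpa using hy) (by rwa [dist_eq_norm])
        exact (by simpa [Real.dist_eq] using this.le)
      · rw [e2]
        exact lt_of_le_of_lt (norm_ballRetract_smul_sub_le (by positivity) _) h3
    rw [integral_const_mul, integral_add
        (IntegrableOn.integrable_indicator (integrableOn_const (measure_ne_top _ _)) (hms _))
        (IntegrableOn.integrable_indicator (integrableOn_const (measure_ne_top _ _)) (hms _))] at h7
    have h8 : ∀ c : ℝ, 0 < c → ∫ ω, Set.indicator {ω | δ < ‖c⁻¹ • H ω‖} (fun _ => (1 : ℝ)) ω ∂P =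
        normTail P H (c * δ) := by
      intro c hc
      rw [← measureReal_lt_norm_smul_inv hc]
      exact integral_indicator_one (hms c)
    rw [h8 _ h5, h8 _ hba] at h7
    have h9 := mul_le_mul_of_nonneg_left h7 (Nat.cast_nonneg (α := ℝ) (m i))
    refine lt_of_le_of_lt h9 ?_
    have e3 : (m i : ℝ) * (e / (2 * (K + 1)) *
        (normTail P H (M i * δ) + normTail P H (b * a (m i) * δ))) =
        e / (2 * (K + 1)) * ((m i : ℝ) * normTail P H (δ * M i) +
          (m i : ℝ) * normTail P H (a (m i) * (b * δ))) := by
      rw [mul_comm δ, show b * a (m i) * δ = a (m i) * (b * δ) by ring]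
      ring
    rw [e3]
    calc _ ≤ e / (2 * (K + 1)) * (K + 1) := by gcongr
      _ = e / 2 := by field_simp
      _ < e := half_lt_self he
  have hnum := hdiff.add hA
  simp only [sub_add_cancel, zero_add] at hnum
  have := hnum.div h1 one_ne_zero
  rw [div_one] at this
  refine this.congr' ?_
  filter_upwards [hm.eventually_gt_atTop 0] with i hi
  have hi' : (0 : ℝ) < m i := by exact_mod_cast hi
  simp only [Pi.div_apply]
  rw [mul_div_mul_left _ _ hi'.ne']

/-- The limit in the auxiliary lemma does not depend on the levels. Taking the levels to be `a_n`
itself identifies it, which avoids proving homogeneity of `μ` as a measure. -/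
theorem tendsto_integral_ballRetract_div (hH : Measurable H)
    (hHμ : VagueTendstoOutside 0 (fun n => (n : ℝ≥0∞) • P.map (fun ω => (a n)⁻¹ • H ω)) μ)
    {G : ℝ → ℝ} (hS : ScaledTailLimit (normTail P H) a G)
    (hα : 0 < α) (hκ : 0 < κ) (hG : ∀ x, 0 < x → G x = κ * x ^ (-α)) (hM : Tendsto M l atTop)
    (g : Vec d → ℝ) (hg : Continuous g) {δ : ℝ} (hδ : 0 < δ) (hg0 : ∀ x, ‖x‖ ≤ δ → g x = 0) :
    Tendsto (fun i => (∫ ω, g (ballRetract ((M i)⁻¹ • H ω)) ∂P) / normTail P H (M i)) l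
      (𝓝 (κ⁻¹ * ∫ x, g (ballRetract x) ∂μ)) := by
  have h1 := tendsto_integral_ballRetract_div_aux hH hHμ hS hα hκ hG hM g hg hδ hg0
  have h2 := tendsto_integral_ballRetract_div_aux hH hHμ hS hα hκ hG hS.scale g hg hδ hg0
  have h3 := tendsto_integral_ballRetract hHμ one_pos g hg hδ hg0
  have h4 := hS.tendsto_mul hG one_pos
  rw [Real.one_rpow, mul_one] at h4
  have h5 := h3.div h4 hκ.ne'
  have h6 : Tendsto (fun n : ℕ => (∫ ω, g (ballRetract ((a n)⁻¹ • H ω)) ∂P) /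
      normTail P H (a n)) atTop (𝓝 ((∫ x, g (ballRetract ((1 : ℝ) • x)) ∂μ) / κ)) := by
    refine h5.congr' ?_
    filter_upwards [eventually_gt_atTop 0] with n hn
    have hn' : (0 : ℝ) < n := by exact_mod_cast hn
    simp only [Pi.div_apply, integral_smul_measure, mul_one]
    rw [integral_map (by fun_prop)]
    · simp only [one_smul, ENNReal.toReal_natCast, smul_eq_mul]
      rw [mul_div_mul_left _ _ hn'.ne']
    · refine (hg.comp (continuous_ballRetract.comp ?_)).aestronglyMeasurable
      fun_prop
  have h7 := tendsto_nhds_unique h2 h6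
  rw [h7] at h1
  simpa [div_eq_inv_mul] using h1

theorem isTailIndex_of_scaledTailLimit (hH : Measurable H)
    {G : ℝ → ℝ} (hS : ScaledTailLimit (normTail P H) a G)
    (hα : 0 < α) (hκ : 0 < κ) (hG : ∀ x, 0 < x → G x = κ * x ^ (-α)) : IsTailIndex P H α :=
  ⟨hα, fun _ ht => hS.tendsto_ratio (tendsto_normTail P hH) hα hκ hG tendsto_id ht⟩

end Limit

/-! ### Moment bounds for regularly varying tails -/

section Dyadic

theorem dyadic_induction {p : ℝ → Prop} {x₀ : ℝ} (hx₀ : 0 < x₀)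
    (base : ∀ x, x₀ ≤ x → x ≤ 2 * x₀ → p x) (step : ∀ x, x₀ ≤ x → p x → p (2 * x)) :
    ∀ x, x₀ ≤ x → p x := by
  have key : ∀ n : ℕ, ∀ x, x₀ ≤ x → x ≤ 2 ^ (n + 1) * x₀ → p x := by
    intro n
    induction n with
    | zero => intro x h1 h2; exact base x h1 (by simpa using h2)
    | succ n ih =>
      intro x h1 h2
      rcases le_total x (2 * x₀) with h | h
      · exact base x h1 h
      · have := step (x / 2) (by linarith) (ih (x / 2) (by linarith) (by
          rw [pow_succ] at h2; linarith))
        rwa [mul_div_cancel₀ _ two_ne_zero] at this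
  intro x hx
  obtain ⟨n, hn⟩ := pow_unbounded_of_one_lt (x / x₀) one_lt_two
  rw [div_lt_iff₀ hx₀] at hn
  refine key n x hx (hn.le.trans ?_)
  gcongr
  · norm_num
  · omega

/-- Over one doubling `V` gains at most `D u`, while `u` grows by the factor `ρ > 1`. The gains form
a geometric series dominated by its last term; `D / (ρ - 1)` is its sum and `B / b` covers the
initial interval. -/
theorem exists_forall_le_mul_of_dyadic {V u w : ℝ → ℝ} {D ρ x₀ B b : ℝ} (hx₀ : 0 < x₀)
    (hρ : 1 < ρ) (hD : 0 ≤ D) (hB : 0 ≤ B) (hb : 0 < b)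
    (hV : ∀ x, x₀ ≤ x → V (2 * x) ≤ V x + w x) (hw : ∀ x, x₀ ≤ x → w x ≤ D * u x)
    (hu0 : ∀ x, x₀ ≤ x → 0 ≤ u x)
    (hu : ∀ x, x₀ ≤ x → ρ * u x ≤ u (2 * x)) (hVB : ∀ x, x₀ ≤ x → x ≤ 2 * x₀ → V x ≤ B)
    (hub : ∀ x, x₀ ≤ x → x ≤ 2 * x₀ → b ≤ u x) :
    ∃ C, 0 ≤ C ∧ ∀ x, x₀ ≤ x → V x ≤ C * u x := by
  have hρ' : 0 < ρ - 1 := by linarith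
  refine ⟨D / (ρ - 1) + B / b, by positivity, dyadic_induction hx₀ ?_ ?_⟩
  · intro x h1 h2
    have h3 : B ≤ B / b * u x := by
      rw [div_mul_eq_mul_div, le_div_iff₀ hb]
      exact mul_le_mul_of_nonneg_left (hub x h1 h2) hB
    have h4 : 0 ≤ D / (ρ - 1) * u x := mul_nonneg (by positivity) (hu0 x h1)
    have := hVB x h1 h2
    linarith [add_mul (D / (ρ - 1)) (B / b) (u x)]
  · intro x h1 h2
    have h3 : V (2 * x) ≤ (D / (ρ - 1) + B / b + D) * u x := by
      have := hV x h1
      have := hw x h1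
      linarith [add_mul (D / (ρ - 1) + B / b) D (u x)]
    have h4 : (D / (ρ - 1) + B / b) * (ρ * u x) ≤ (D / (ρ - 1) + B / b) * u (2 * x) :=
      mul_le_mul_of_nonneg_left (hu x h1) (by positivity)
    refine h3.trans (le_trans ?_ h4)
    rw [← mul_assoc]
    refine mul_le_mul_of_nonneg_right ?_ (hu0 x h1)
    have h5 : D / (ρ - 1) * ρ = D / (ρ - 1) + D := by
      field_simp
      ring
    rw [add_mul, h5]
    have : B / b ≤ B / b * ρ := le_mul_of_one_le_right (by positivity) hρ.le
    linarith

end Dyadic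

/-! ### Power bounds for a tail with a limiting doubling ratio -/

section RegularVariation

variable {F : ℝ → ℝ} {α : ℝ}

theorem tendsto_rpow_mul_ratio (hpos : ∀ x, 0 < F x)
    (hF : Tendsto (fun x => F (2 * x) / F x) atTop (𝓝 ((2 : ℝ) ^ (-α)))) (β : ℝ) :
    Tendsto (fun x => ((2 * x) ^ β * F (2 * x)) / (x ^ β * F x)) atTop
      (𝓝 ((2 : ℝ) ^ (β - α))) := by
  rw [sub_eq_add_neg, Real.rpow_add two_pos]
  refine (hF.const_mul ((2 : ℝ) ^ β)).congr' ?_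
  filter_upwards [eventually_gt_atTop 0] with x hx
  rw [Real.mul_rpow two_pos.le hx.le]
  have := hpos x
  have : 0 < x ^ β := by positivity
  field_simp

theorem eventually_mul_le_of_lt (hpos : ∀ x, 0 < F x)
    (hF : Tendsto (fun x => F (2 * x) / F x) atTop (𝓝 ((2 : ℝ) ^ (-α)))) {β ρ : ℝ}
    (hρ : ρ < (2 : ℝ) ^ (β - α)) :
    ∀ᶠ x in atTop, ρ * (x ^ β * F x) ≤ (2 * x) ^ β * F (2 * x) := by
  filter_upwards [(tendsto_rpow_mul_ratio hpos hF β).eventually_const_lt hρ,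
    eventually_gt_atTop 0] with x h hx
  have := hpos x
  rw [lt_div_iff₀ (by positivity)] at h
  exact h.le

theorem eventually_le_mul_of_lt (hpos : ∀ x, 0 < F x)
    (hF : Tendsto (fun x => F (2 * x) / F x) atTop (𝓝 ((2 : ℝ) ^ (-α)))) {β ρ : ℝ}
    (hρ : (2 : ℝ) ^ (β - α) < ρ) :
    ∀ᶠ x in atTop, (2 * x) ^ β * F (2 * x) ≤ ρ * (x ^ β * F x) := by
  filter_upwards [(tendsto_rpow_mul_ratio hpos hF β).eventually_lt_const hρ,
    eventually_gt_atTop 0] with x h hx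
  have := hpos x
  rw [div_lt_iff₀ (by positivity)] at h
  exact h.le

theorem exists_pos_forall_of_eventually_atTop {p : ℝ → Prop} (h : ∀ᶠ x in atTop, p x) :
    ∃ x₀ : ℝ, 0 < x₀ ∧ ∀ x, x₀ ≤ x → p x := by
  obtain ⟨x₀, hx₀⟩ := eventually_atTop.1 h
  exact ⟨max x₀ 1, by positivity, fun x hx => hx₀ x ((le_max_left _ _).trans hx)⟩

theorem exists_eventually_le_rpow (hanti : Antitone F) (hpos : ∀ x, 0 < F x)
    (hF : Tendsto (fun x => F (2 * x) / F x) atTop (𝓝 ((2 : ℝ) ^ (-α)))) {β : ℝ} (hβ0 : 0 ≤ β)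
    (hβ : β < α) : ∃ C, 0 < C ∧ ∀ᶠ x in atTop, x ^ β * F x ≤ C := by
  have h1 : (2 : ℝ) ^ (β - α) < 1 := Real.rpow_lt_one_of_one_lt_of_neg one_lt_two (by linarith)
  obtain ⟨x₀, hx₀, h⟩ := exists_pos_forall_of_eventually_atTop (eventually_le_mul_of_lt hpos hF h1)
  refine ⟨(2 * x₀) ^ β * F x₀, by have := hpos x₀; positivity, ?_⟩
  filter_upwards [eventually_ge_atTop x₀] with x hx
  refine dyadic_induction (p := fun x => x ^ β * F x ≤ (2 * x₀) ^ β * F x₀) hx₀ ?_ ?_ x hx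
  · intro y hy1 hy2
    have := hanti hy1
    have := (hpos y).le
    gcongr
    linarith
  · intro y hy1 hy2
    have := h y hy1
    linarith

theorem exists_eventually_ge_rpow (hanti : Antitone F) (hpos : ∀ x, 0 < F x)
    (hF : Tendsto (fun x => F (2 * x) / F x) atTop (𝓝 ((2 : ℝ) ^ (-α)))) {β : ℝ} (hβ0 : 0 ≤ β)
    (hβ : α < β) : ∃ c, 0 < c ∧ ∀ᶠ x in atTop, c ≤ x ^ β * F x := by
  have h1 : 1 < (2 : ℝ) ^ (β - α) := Real.one_lt_rpow one_lt_two (by linarith)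
  obtain ⟨x₀, hx₀, h⟩ := exists_pos_forall_of_eventually_atTop (eventually_mul_le_of_lt hpos hF h1)
  refine ⟨x₀ ^ β * F (2 * x₀), by have := hpos (2 * x₀); positivity, ?_⟩
  filter_upwards [eventually_ge_atTop x₀] with x hx
  refine dyadic_induction (p := fun x => x₀ ^ β * F (2 * x₀) ≤ x ^ β * F x) hx₀ ?_ ?_ x hx
  · intro y hy1 hy2
    have := hanti hy2
    have := (hpos (2 * x₀)).le
    have : 0 < y := by linarith
    gcongr
  · intro y hy1 hy2
    have := h y hy1
    linarith

/-- The lower bound is taken at the intermediate exponent `(α + β) / 2`; the remaining power of `x`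
absorbs its constant. -/
theorem eventually_rpow_neg_le (hanti : Antitone F) (hpos : ∀ x, 0 < F x)
    (hF : Tendsto (fun x => F (2 * x) / F x) atTop (𝓝 ((2 : ℝ) ^ (-α)))) {β : ℝ} (hα : 0 < α)
    (hβ : α < β) : ∀ᶠ x in atTop, x ^ (-β) ≤ F x := by
  obtain ⟨c, hc, h⟩ := exists_eventually_ge_rpow hanti hpos hF (β := (α + β) / 2) (by linarith)
    (by linarith)
  have h1 : Tendsto (fun x : ℝ => x ^ ((β - α) / 2)) atTop atTop :=
    tendsto_rpow_atTop (by linarith)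
  filter_upwards [h, h1.eventually_ge_atTop c⁻¹, eventually_gt_atTop 0] with x h2 h3 h4
  have h5 : 0 < x ^ ((α + β) / 2) := by positivity
  have h6 : x ^ (-β) = (x ^ ((β - α) / 2))⁻¹ * (x ^ ((α + β) / 2))⁻¹ := by
    rw [← Real.rpow_neg h4.le, ← Real.rpow_neg h4.le, ← Real.rpow_add h4]
    congr 1
    ring
  rw [h6, ← div_eq_mul_inv, div_le_iff₀ h5, mul_comm (F x)]
  refine le_trans ?_ h2
  rw [← inv_inv c]
  exact inv_anti₀ (by positivity) h3

end RegularVariation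

/-! ### Truncated moments and tail moments of `‖H‖` -/

section Moments

variable {Ω : Type*} [MeasurableSpace Ω] {P : Measure Ω} [IsProbabilityMeasure P] {d : ℕ}
  {H : Ω → Vec d} {α : ℝ}

/-- The moment of order `p` of `‖H‖`, truncated at level `x`. -/
def truncMoment (P : Measure Ω) (H : Ω → Vec d) (p : ℕ) (x : ℝ) : ℝ :=
  ∫ ω, Set.indicator {ω | ‖H ω‖ ≤ x} (fun ω => ‖H ω‖ ^ p) ω ∂P

theorem measurableSet_norm_le (hH : Measurable H) (x : ℝ) : MeasurableSet {ω | ‖H ω‖ ≤ x} :=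
  measurableSet_le hH.norm measurable_const

theorem measurableSet_lt_norm_comp (hH : Measurable H) (x : ℝ) : MeasurableSet {ω | x < ‖H ω‖} :=
  measurableSet_lt measurable_const hH.norm

theorem integrable_truncMoment (hH : Measurable H) (p : ℕ) (x : ℝ) :
    Integrable (Set.indicator {ω | ‖H ω‖ ≤ x} (fun ω => ‖H ω‖ ^ p)) P := by
  refine Integrable.of_bound ((hH.norm.pow_const p).indicator
    (measurableSet_norm_le hH x)).aestronglyMeasurable (|x| ^ p) (Eventually.of_forall fun ω => ?_)
  by_cases h : ‖H ω‖ ≤ x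
  · rw [Set.indicator_of_mem (by exact h), norm_pow, norm_norm]
    gcongr
    exact h.trans (le_abs_self x)
  · rw [Set.indicator_of_notMem (by exact h), norm_zero]
    positivity

omit [IsProbabilityMeasure P] in
theorem truncMoment_nonneg (p : ℕ) (x : ℝ) : 0 ≤ truncMoment P H p x :=
  integral_nonneg fun _ => Set.indicator_nonneg (fun _ _ => by positivity) _

theorem truncMoment_mono (hH : Measurable H) (p : ℕ) : Monotone (truncMoment P H p) :=
  fun _ _ hxy => integral_mono (integrable_truncMoment hH p _) (integrable_truncMoment hH p _)
    (Set.indicator_le_indicator_of_subset (fun _ hω => le_trans hω hxy) fun _ => by positivity)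

theorem truncMoment_le_pow (hH : Measurable H) (p : ℕ) {x : ℝ} (hx : 0 ≤ x) :
    truncMoment P H p x ≤ x ^ p := by
  have : truncMoment P H p x ≤ ∫ _, x ^ p ∂P := by
    refine integral_mono (integrable_truncMoment hH p _) (integrable_const _) fun ω => ?_
    simp only [Set.indicator_apply, Set.mem_ofPred_eq]
    split_ifs with h
    · gcongr
    · positivity
  simpa using this

theorem truncMoment_two_mul_le (hH : Measurable H) (p : ℕ) {x : ℝ} (hx : 0 ≤ x) :
    truncMoment P H p (2 * x) ≤ truncMoment P H p x + (2 * x) ^ p * normTail P H x := by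
  have hm := measurableSet_lt_norm_comp hH x
  have hi : Integrable (Set.indicator {ω | x < ‖H ω‖} (fun _ => (2 * x) ^ p)) P :=
    (integrable_const _).indicator hm
  have h1 : (2 * x) ^ p * normTail P H x =
      ∫ ω, Set.indicator {ω | x < ‖H ω‖} (fun _ => (2 * x) ^ p) ω ∂P := by
    rw [integral_indicator_const _ hm, smul_eq_mul, mul_comm]
    rfl
  rw [h1, truncMoment, truncMoment, ← integral_add (integrable_truncMoment hH p x) hi]
  refine integral_mono (integrable_truncMoment hH p _) ((integrable_truncMoment hH p x).add hi)
    fun ω => ?_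
  simp only [Set.indicator_apply, Set.mem_ofPred_eq]
  by_cases h : ‖H ω‖ ≤ x
  · rw [if_pos (by linarith), if_pos h, if_neg (not_lt.2 h), add_zero]
  · rw [if_neg h, if_pos (not_le.1 h), zero_add]
    split_ifs with h'
    · gcongr
    · positivity

/-- Since `p > α`, the function `x^p P(‖H‖ > x)` has doubling ratio tending to `2^(p-α) > 1`, and
the moment gains at most `2^p` times this function over each doubling. -/
theorem exists_truncMoment_le (hH : Measurable H) (hpos : ∀ x, 0 < normTail P H x)
    (hα : IsTailIndex P H α) {p : ℕ} (hp : α < p) :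
    ∃ C, 0 ≤ C ∧ ∀ᶠ x in atTop, truncMoment P H p x ≤ C * (x ^ p * normTail P H x) := by
  have hF := hα.2 2 two_pos
  have h1 : 1 < (2 : ℝ) ^ ((p : ℝ) - α) := Real.one_lt_rpow one_lt_two (by linarith)
  obtain ⟨ρ, hρ1, hρ2⟩ := exists_between h1
  obtain ⟨x₀, hx₀, h⟩ := exists_pos_forall_of_eventually_atTop
    (eventually_mul_le_of_lt hpos hF hρ2)
  simp only [Real.rpow_natCast] at h
  obtain ⟨C, hC, hV⟩ := exists_forall_le_mul_of_dyadic (V := truncMoment P H p)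
    (u := fun x => x ^ p * normTail P H x) (w := fun x => (2 * x) ^ p * normTail P H x)
    (D := 2 ^ p) (B := (2 * x₀) ^ p) (b := x₀ ^ p * normTail P H (2 * x₀)) hx₀ hρ1
    (by positivity) (by positivity) (by have := hpos (2 * x₀); positivity)
    (fun x hx => truncMoment_two_mul_le hH p (by linarith))
    (fun x hx => by rw [mul_pow, mul_assoc])
    (fun x hx => by have := hpos x; have : 0 < x := by linarith
                    positivity)
    h (fun x h1 h2 => (truncMoment_le_pow hH p (by linarith)).trans (by
      have : 0 < x := by linarith
      gcongr))
    (fun x h1 h2 => by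
      have := antitone_normTail P H h2
      have := (hpos (2 * x₀)).le
      have : 0 < x := by linarith
      gcongr)
  exact ⟨C, hC, (eventually_ge_atTop x₀).mono hV⟩

/-- At the critical index `α = 2` the truncated second moment may diverge, but slower than any
power; an arbitrarily small `ζ` replaces the missing growth of `x^2 P(‖H‖ > x)`. -/
theorem exists_truncMoment_two_le_rpow (hH : Measurable H) (hpos : ∀ x, 0 < normTail P H x)
    (hα : IsTailIndex P H α) (h2 : α = 2) {ζ : ℝ} (hζ : 0 < ζ) (hζ2 : ζ < 2) :
    ∃ C, 0 ≤ C ∧ ∀ᶠ x in atTop, truncMoment P H 2 x ≤ C * x ^ ζ := by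
  obtain ⟨D, hD, hD'⟩ := exists_eventually_le_rpow (antitone_normTail P H) hpos (hα.2 2 two_pos)
    (β := 2 - ζ) (by linarith) (by linarith)
  obtain ⟨x₀, hx₀, h⟩ := exists_pos_forall_of_eventually_atTop hD'
  obtain ⟨C, hC, hV⟩ := exists_forall_le_mul_of_dyadic (V := truncMoment P H 2)
    (u := fun x => x ^ ζ) (w := fun x => (2 * x) ^ 2 * normTail P H x) (ρ := 2 ^ ζ)
    (D := 4 * D) (B := (2 * x₀) ^ 2) (b := x₀ ^ ζ) hx₀ (Real.one_lt_rpow one_lt_two hζ)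
    (by positivity) (by positivity) (by positivity)
    (fun x hx => truncMoment_two_mul_le hH 2 (by linarith))
    (fun x hx => by
      have hx0 : 0 < x := by linarith
      have h3 : x ^ 2 = x ^ ζ * x ^ (2 - ζ) := by
        rw [← Real.rpow_add hx0, add_sub_cancel, Real.rpow_two]
      have h4 := h x hx
      have h5 : 0 < x ^ ζ := by positivity
      rw [mul_pow, h3]
      nlinarith)
    (fun x hx => by have : 0 < x := by linarith
                    positivity)
    (fun x hx => by rw [Real.mul_rpow two_pos.le (by linarith)])
    (fun x h1 h2 => (truncMoment_le_pow hH 2 (by linarith)).trans (by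
      have : 0 < x := by linarith
      gcongr))
    (fun x h1 h2 => by gcongr)
  exact ⟨C, hC, (eventually_ge_atTop x₀).mono hV⟩

theorem exists_truncMoment_two_le (hH : Measurable H) (hpos : ∀ x, 0 < normTail P H x)
    (hα : IsTailIndex P H α) (h2 : 2 < α) :
    ∃ C, 0 ≤ C ∧ ∀ x, truncMoment P H 2 x ≤ C := by
  set ζ := (α - 2) / 2 with hζ
  have hζ0 : 0 < ζ := by rw [hζ]; linarith
  obtain ⟨D, hD, hD'⟩ := exists_eventually_le_rpow (antitone_normTail P H) hpos (hα.2 2 two_pos)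
    (β := 2 + ζ) (by linarith) (by linarith)
  obtain ⟨x₀, hx₀, h⟩ := exists_pos_forall_of_eventually_atTop hD'
  have hc : (2 : ℝ) ^ (-ζ) < 1 := Real.rpow_lt_one_of_one_lt_of_neg one_lt_two (by linarith)
  -- The term `-B x^(-ζ)` is carried in the induction: under doubling it releases `B (1 - 2^(-ζ))
  -- x^(-ζ) = 4 D x^(-ζ)`, which pays for the increment of the moment.
  set B := 4 * D / (1 - 2 ^ (-ζ)) with hB
  have hB0 : 0 ≤ B := by
    have : 0 < 1 - (2 : ℝ) ^ (-ζ) := by linarith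
    positivity
  have hBe : B * (1 - 2 ^ (-ζ)) = 4 * D := div_mul_cancel₀ _ (by linarith)
  have key : ∀ x, x₀ ≤ x → truncMoment P H 2 x ≤ (2 * x₀) ^ 2 + B * x₀ ^ (-ζ) - B * x ^ (-ζ) := by
    refine dyadic_induction hx₀ ?_ ?_
    · intro x h1 h2
      have hx0 : 0 < x := by linarith
      have h3 : x ^ (-ζ) ≤ x₀ ^ (-ζ) := Real.rpow_le_rpow_of_nonpos hx₀ h1 (by linarith)
      have h4 : truncMoment P H 2 x ≤ (2 * x₀) ^ 2 :=
        (truncMoment_le_pow hH 2 hx0.le).trans (by gcongr)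
      have := mul_le_mul_of_nonneg_left h3 hB0
      linarith
    · intro x h1 h2
      have hx0 : 0 < x := by linarith
      have h3 := truncMoment_two_mul_le (P := P) hH 2 hx0.le
      have h4 : x ^ 2 = x ^ (-ζ) * x ^ (2 + ζ) := by
        rw [← Real.rpow_add hx0, ← Real.rpow_two]
        congr 1
        ring
      have h5 := h x h1
      have h6 : 0 < x ^ (-ζ) := by positivity
      have h7 : (2 * x) ^ 2 * normTail P H x ≤ 4 * D * x ^ (-ζ) := by
        rw [mul_pow, h4]
        nlinarith
      rw [Real.mul_rpow two_pos.le hx0.le]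
      rw [← hBe] at h7
      linarith
  refine ⟨(2 * x₀) ^ 2 + B * x₀ ^ (-ζ), by positivity, fun x => ?_⟩
  have h1 := key (max x x₀) (le_max_right _ _)
  have h2 := truncMoment_mono (P := P) hH 2 (le_max_left x x₀)
  have hx : 0 < max x x₀ := lt_max_of_lt_right hx₀
  have : 0 ≤ B * (max x x₀) ^ (-ζ) := by positivity
  linarith

/-- The first absolute moment of `H` beyond the level `x`. -/
def tailMoment (P : Measure Ω) (H : Ω → Vec d) (x : ℝ) : ℝ :=
  ∫ ω, Set.indicator {ω | x < ‖H ω‖} (fun ω => ‖H ω‖) ω ∂P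

omit [IsProbabilityMeasure P] in
theorem tendsto_tailMoment (hH : Measurable H) (hint : Integrable H P) :
    Tendsto (tailMoment P H) atTop (𝓝 0) := by
  have : Tendsto (tailMoment P H) atTop (𝓝 (∫ _, (0 : ℝ) ∂P)) := by
    refine tendsto_integral_filter_of_dominated_convergence (fun ω => ‖H ω‖)
      (Eventually.of_forall fun x => (hH.norm.indicator
        (measurableSet_lt_norm_comp hH x)).aestronglyMeasurable)
      (Eventually.of_forall fun x => Eventually.of_forall fun ω => ?_) hint.norm
      (Eventually.of_forall fun ω => ?_)
    · refine (norm_indicator_le_norm_self _ _).trans (by simp)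
    · refine tendsto_const_nhds.congr' ?_
      filter_upwards [eventually_ge_atTop ‖H ω‖] with x hx
      rw [Set.indicator_of_notMem]
      simpa using hx
  simpa using this

theorem tailMoment_le (hH : Measurable H) (hint : Integrable H P) {x : ℝ} (hx : 0 ≤ x) :
    tailMoment P H x ≤ 2 * (x * normTail P H x) + tailMoment P H (2 * x) := by
  have hm := measurableSet_lt_norm_comp hH x
  have hi : Integrable (Set.indicator {ω | x < ‖H ω‖} (fun _ => 2 * x)) P :=
    (integrable_const _).indicator hm
  have h1 : 2 * (x * normTail P H x) =
      ∫ ω, Set.indicator {ω | x < ‖H ω‖} (fun _ => 2 * x) ω ∂P := by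
    rw [integral_indicator_const _ hm, smul_eq_mul, mul_comm _ (2 * x), mul_assoc]
    rfl
  have hi2 : ∀ y, Integrable (Set.indicator {ω | y < ‖H ω‖} (fun ω => ‖H ω‖)) P := fun y =>
    hint.norm.indicator (measurableSet_lt_norm_comp hH y)
  rw [h1, tailMoment, tailMoment, ← integral_add hi (hi2 _)]
  refine integral_mono (hi2 _) (hi.add (hi2 _)) fun ω => ?_
  simp only [Set.indicator_apply, Set.mem_ofPred_eq]
  have := norm_nonneg (H ω)
  split_ifs <;> linarith

/-- For `α > 1` the dyadic contributions `x P(‖H‖ > x)` decay outward by a factor `ρ < 1`. Summing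
over `n` doublings leaves the tail moment at `2^n x`, which vanishes in the limit by integrability.
-/
theorem exists_tailMoment_le (hH : Measurable H) (hint : Integrable H P)
    (hpos : ∀ x, 0 < normTail P H x) (hα : IsTailIndex P H α) (h1 : 1 < α) :
    ∃ C, 0 ≤ C ∧ ∀ᶠ x in atTop, tailMoment P H x ≤ C * (x * normTail P H x) := by
  have hlt : (2 : ℝ) ^ (1 - α) < 1 := Real.rpow_lt_one_of_one_lt_of_neg one_lt_two (by linarith)
  obtain ⟨ρ, hρ1, hρ2⟩ := exists_between hlt
  have hρ0 : 0 < ρ := lt_trans (by positivity) hρ1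
  obtain ⟨x₀, hx₀, h⟩ := exists_pos_forall_of_eventually_atTop
    (eventually_le_mul_of_lt hpos (hα.2 2 two_pos) hρ1)
  simp only [Real.rpow_one] at h
  have hC0 : 0 ≤ 2 / (1 - ρ) := div_nonneg two_pos.le (by linarith)
  refine ⟨2 / (1 - ρ), hC0, ?_⟩
  have key : ∀ n : ℕ, ∀ x, x₀ ≤ x →
      tailMoment P H x ≤ 2 / (1 - ρ) * (x * normTail P H x) + tailMoment P H (2 ^ n * x) := by
    intro n
    induction n with
    | zero =>
      intro x hx
      have hx0 : 0 < x := by linarith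
      have : 0 ≤ 2 / (1 - ρ) * (x * normTail P H x) :=
        mul_nonneg hC0 (mul_nonneg hx0.le (hpos x).le)
      simpa using this
    | succ n ih =>
      intro x hx
      have hx0 : 0 < x := by linarith
      have h2 := tailMoment_le hH hint hx0.le
      have h3 := ih (2 * x) (by linarith)
      have h4 := mul_le_mul_of_nonneg_left (h x hx) hC0
      have h5 : 2 / (1 - ρ) * ρ = 2 / (1 - ρ) - 2 := by
        have : 1 - ρ ≠ 0 := by linarith
        field_simp
        ring
      rw [← mul_assoc (2 / (1 - ρ)) ρ, h5] at h4
      rw [show (2 : ℝ) ^ (n + 1) * x = 2 ^ n * (2 * x) by ring]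
      linarith
  filter_upwards [eventually_ge_atTop x₀] with x hx
  have hx0 : 0 < x := by linarith
  have hlim : Tendsto (fun n : ℕ => 2 / (1 - ρ) * (x * normTail P H x) +
      tailMoment P H (2 ^ n * x)) atTop (𝓝 (2 / (1 - ρ) * (x * normTail P H x) + 0)) :=
    ((tendsto_tailMoment hH hint).comp
      ((tendsto_pow_atTop_atTop_of_one_lt one_lt_two).atTop_mul_const hx0)).const_add _
  rw [add_zero] at hlim
  exact ge_of_tendsto' hlim fun n => key n x hx

end Moments

/-! ### Exponential bounds for sums of truncated vectors -/

section Exponential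

/-- The factor `exp B` is charged only to values `u > 1`. This leaves a choice of how to bound their
probability: by the second moment when `α ≤ 2`, by the tail of `‖H‖` when `α > 2`. -/
theorem exp_le_of_le {u B : ℝ} (hu : u ≤ B) :
    Real.exp u ≤ 1 + u + u ^ 2 + Set.indicator (Set.Ioi 1) (fun _ => Real.exp B) u := by
  by_cases h1 : 1 < u
  · rw [Set.indicator_of_mem (by exact h1)]
    have := Real.exp_le_exp.2 hu
    nlinarith [sq_nonneg u]
  · rw [Set.indicator_of_notMem (by exact h1), add_zero]
    rcases le_total (-1) u with h2 | h2
    · have := abs_le.1 (Real.abs_exp_sub_one_sub_id_le (abs_le.2 ⟨h2, not_lt.1 h1⟩))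
      linarith [this.2]
    · have : Real.exp u ≤ 1 := Real.exp_le_one_iff.2 (by linarith)
      nlinarith

variable {Ω : Type*} [MeasurableSpace Ω] {P : Measure Ω} [IsProbabilityMeasure P]

theorem integrable_of_abs_le {Z : Ω → ℝ} (hZ : Measurable Z) {B : ℝ} (hB : ∀ ω, |Z ω| ≤ B) :
    Integrable Z P :=
  Integrable.of_bound hZ.aestronglyMeasurable B (Eventually.of_forall hB)

theorem integrable_exp_mul_of_abs_le {Z : Ω → ℝ} (hZ : Measurable Z) {B : ℝ}
    (hB : ∀ ω, |Z ω| ≤ B) (t : ℝ) : Integrable (fun ω => Real.exp (t * Z ω)) P := by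
  refine integrable_of_abs_le (by fun_prop) (B := Real.exp (|t| * B)) fun ω => ?_
  rw [abs_of_pos (Real.exp_pos _), Real.exp_le_exp]
  calc t * Z ω ≤ |t * Z ω| := le_abs_self _
    _ = |t| * |Z ω| := abs_mul _ _
    _ ≤ |t| * B := by gcongr; exact hB ω

theorem mgf_le_exp_of_abs_le {Z : Ω → ℝ} (hZ : Measurable Z) {B t : ℝ} (ht : 0 ≤ t)
    (hB : ∀ ω, |Z ω| ≤ B) :
    mgf Z P t ≤ Real.exp (t * (∫ ω, Z ω ∂P) + t ^ 2 * (∫ ω, Z ω ^ 2 ∂P) +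
      Real.exp (t * B) * P.real {ω | 1 < t * Z ω}) := by
  have hm : MeasurableSet {ω | 1 < t * Z ω} := measurableSet_lt measurable_const (by fun_prop)
  have h1 : Integrable (fun ω => t * Z ω) P := (integrable_of_abs_le hZ hB).const_mul t
  have h2 : Integrable (fun ω => t ^ 2 * Z ω ^ 2) P := by
    refine (integrable_of_abs_le (by fun_prop) (B := B ^ 2) fun ω => ?_).const_mul _
    rw [abs_pow]
    exact pow_le_pow_left₀ (abs_nonneg _) (hB ω) 2
  have h3 : Integrable (Set.indicator {ω | 1 < t * Z ω} (fun _ => Real.exp (t * B))) P :=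
    (integrable_const _).indicator hm
  have hle : mgf Z P t ≤ ∫ ω, (1 + t * Z ω + t ^ 2 * Z ω ^ 2 +
      Set.indicator {ω | 1 < t * Z ω} (fun _ => Real.exp (t * B)) ω) ∂P := by
    refine integral_mono (integrable_exp_mul_of_abs_le hZ hB t)
      ((((integrable_const _).add h1).add h2).add h3) fun ω => ?_
    have := exp_le_of_le (u := t * Z ω) (B := t * B)
      (mul_le_mul_of_nonneg_left ((le_abs_self _).trans (hB ω)) ht)
    rw [mul_pow] at this
    exact this
  have h4 : Integrable (fun ω => 1 + t * Z ω) P := (integrable_const _).add h1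
  have h5 : Integrable (fun ω => 1 + t * Z ω + t ^ 2 * Z ω ^ 2) P := h4.add h2
  rw [integral_add h5 h3, integral_add h4 h2, integral_add (integrable_const _) h1,
    integral_const_mul, integral_const_mul, integral_indicator_const _ hm] at hle
  simp only [integral_const, probReal_univ, smul_eq_mul, one_mul] at hle
  refine hle.trans ?_
  have := Real.add_one_le_exp (t * (∫ ω, Z ω ∂P) + t ^ 2 * (∫ ω, Z ω ^ 2 ∂P) +
      Real.exp (t * B) * P.real {ω | 1 < t * Z ω})
  linarith

theorem measureReal_le_sum_le_exp {Z : ℕ → Ω → ℝ} (hZ : ∀ j, Measurable (Z j))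
    (hind : iIndepFun Z P) {B t v : ℝ} (ht : 0 ≤ t) (hB : ∀ j ω, |Z j ω| ≤ B)
    (hv : ∀ j, mgf (Z j) P t ≤ Real.exp v) (n : ℕ) (x : ℝ) :
    P.real {ω | x ≤ ∑ j ∈ Finset.range n, Z j ω} ≤ Real.exp (-t * x + n * v) := by
  have hint : Integrable (fun ω => Real.exp (t * (∑ j ∈ Finset.range n, Z j) ω)) P := by
    refine integrable_exp_mul_of_abs_le (by fun_prop) (B := n * B) (fun ω => ?_) t
    rw [Finset.sum_apply]
    refine (Finset.abs_sum_le_sum_abs _ _).trans ?_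
    refine (Finset.sum_le_sum fun j _ => hB j ω).trans ?_
    simp
  have h := measure_ge_le_exp_mul_mgf x ht hint
  simp only [Finset.sum_apply] at h
  refine h.trans ?_
  rw [hind.mgf_sum hZ, Real.exp_add]
  gcongr
  refine (Finset.prod_le_prod (fun j _ => mgf_nonneg) fun j _ => hv j).trans ?_
  rw [Finset.prod_const, Finset.card_range, ← Real.exp_nat_mul]

end Exponential

/-! ### Exponential bounds for vectors killed above a level -/

section SmallJumps

variable {d : ℕ}

/-- The vector `h` if its norm is at most `B`, and `0` otherwise. -/
def smallPart (B : ℝ) (h : Vec d) : Vec d := Set.indicator {h | ‖h‖ ≤ B} id h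

theorem measurable_smallPart (B : ℝ) : Measurable (smallPart B : Vec d → Vec d) :=
  measurable_id.indicator (measurableSet_le measurable_norm measurable_const)

theorem smallPart_of_le {B : ℝ} {h : Vec d} (hh : ‖h‖ ≤ B) : smallPart B h = h :=
  Set.indicator_of_mem (by exact hh) _

theorem smallPart_of_lt {B : ℝ} {h : Vec d} (hh : B < ‖h‖) : smallPart B h = 0 :=
  Set.indicator_of_notMem (by simpa using hh) _

theorem norm_smallPart_le {B : ℝ} (hB : 0 ≤ B) (h : Vec d) : ‖smallPart B h‖ ≤ B := by
  rcases le_or_gt ‖h‖ B with hh | hh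
  · rwa [smallPart_of_le hh]
  · rwa [smallPart_of_lt hh, norm_zero]

theorem norm_smallPart_le_self {B : ℝ} (h : Vec d) : ‖smallPart B h‖ ≤ ‖h‖ := by
  rcases le_or_gt ‖h‖ B with hh | hh
  · rw [smallPart_of_le hh]
  · rw [smallPart_of_lt hh, norm_zero]
    exact norm_nonneg _

theorem smallPart_neg (B : ℝ) (h : Vec d) : smallPart B (-h) = -smallPart B h := by
  rcases le_or_gt ‖h‖ B with hh | hh
  · rw [smallPart_of_le hh, smallPart_of_le (by rwa [norm_neg])]
  · rw [smallPart_of_lt hh, smallPart_of_lt (by rwa [norm_neg]), neg_zero]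

/-- Since `‖v‖ ≤ ∑ |v i|`, some coordinate reaches the average. This reduces the vector bound to `2
d` one-sided real bounds, one for each coordinate and sign. -/
theorem exists_abs_apply_ge_of_lt_norm {x : ℝ} {v : Vec d} (hd : 0 < d) (hv : x < ‖v‖) :
    ∃ i, x / d ≤ |v i| := by
  by_contra! hcon
  have h1 : ‖v‖ ≤ ∑ i, |v i| := by
    have h2 : ‖v‖ = ‖∑ i, EuclideanSpace.single i (v i)‖ := by
      congr 1
      ext j
      simp [Finset.sum_apply]
    rw [h2]
    refine (norm_sum_le _ _).trans (le_of_eq ?_)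
    simp
  have : Nonempty (Fin d) := ⟨⟨0, hd⟩⟩
  have h2 : ∑ i, |v i| < ∑ _i : Fin d, x / d := Finset.sum_lt_sum_of_nonempty
    Finset.univ_nonempty fun i _ => hcon i
  rw [Finset.sum_const, Finset.card_univ, Fintype.card_fin, nsmul_eq_mul] at h2
  have hd' : (d : ℝ) ≠ 0 := by positivity
  rw [mul_div_cancel₀ _ hd'] at h2
  linarith

variable {Ω : Type*} [MeasurableSpace Ω] {P : Measure Ω} [IsProbabilityMeasure P]
  {H : Ω → Vec d} {Hs : ℕ → Ω → Vec d}

theorem integrable_smallPart (hH : Measurable H) {B : ℝ} (hB : 0 ≤ B) :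
    Integrable (fun ω => smallPart B (H ω)) P :=
  Integrable.of_bound ((measurable_smallPart B).comp hH).aestronglyMeasurable B
    (Eventually.of_forall fun _ => norm_smallPart_le hB _)

omit [IsProbabilityMeasure P] in
theorem integral_norm_smallPart_pow (p : ℕ) (hp : p ≠ 0) (B : ℝ) :
    ∫ ω, ‖smallPart B (H ω)‖ ^ p ∂P = truncMoment P H p B := by
  refine integral_congr_ae (Eventually.of_forall fun ω => ?_)
  simp only [Set.indicator_apply, Set.mem_ofPred_eq]
  split_ifs with h
  · rw [smallPart_of_le h]
  · rw [smallPart_of_lt (not_le.1 h), norm_zero, zero_pow hp]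

theorem mgf_smallPart_apply_le (hH : Measurable H) {B t s : ℝ} (hB : 0 ≤ B) (ht : 0 < t)
    (hs : |s| = 1) (i : Fin d) :
    mgf (fun ω => s * smallPart B (H ω) i) P t ≤
      Real.exp (t * ‖∫ ω, smallPart B (H ω) ∂P‖ + t ^ 2 * truncMoment P H 2 B +
        Real.exp (t * B) * P.real {ω | t⁻¹ < ‖smallPart B (H ω)‖}) := by
  have hmeas : Measurable fun ω => smallPart B (H ω) := (measurable_smallPart B).comp hH
  have hcoord : ∀ v : Vec d, |s * v i| ≤ ‖v‖ := fun v => by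
    rw [abs_mul, hs, one_mul]
    exact PiLp.norm_apply_le v i
  have hmi : Measurable fun ω => s * smallPart B (H ω) i := by fun_prop
  refine (mgf_le_exp_of_abs_le hmi ht.le (B := B)
    fun ω => (hcoord _).trans (norm_smallPart_le hB _)).trans (Real.exp_le_exp.2 ?_)
  refine add_le_add (add_le_add ?_ ?_) ?_
  · refine mul_le_mul_of_nonneg_left ?_ ht.le
    have h1 : ∫ ω, s * smallPart B (H ω) i ∂P = s * (∫ ω, smallPart B (H ω) ∂P) i := by
      rw [integral_const_mul]
      congr 1
      exact (EuclideanSpace.proj (𝕜 := ℝ) i).integral_comp_comm (integrable_smallPart hH hB)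
    rw [h1]
    exact (le_abs_self _).trans (hcoord _)
  · refine mul_le_mul_of_nonneg_left ?_ (by positivity)
    rw [← integral_norm_smallPart_pow 2 two_ne_zero]
    refine integral_mono_of_nonneg (Eventually.of_forall fun ω => sq_nonneg _) ?_
      (Eventually.of_forall fun ω => ?_)
    · refine integrable_of_abs_le (by fun_prop) (B := B ^ 2) fun ω => ?_
      rw [abs_of_nonneg (by positivity)]
      have := norm_smallPart_le hB (H ω)
      gcongr
    · exact sq_le_sq' (by linarith [neg_le_of_abs_le (hcoord (smallPart B (H ω)))])
        ((le_abs_self _).trans (hcoord _))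
  · refine mul_le_mul_of_nonneg_left (measureReal_mono fun ω hω => ?_) (Real.exp_pos _).le
    simp only [Set.mem_ofPred_eq] at hω ⊢
    rw [inv_lt_iff_one_lt_mul₀' ht]
    refine lt_of_lt_of_le hω ?_
    gcongr
    exact (le_abs_self _).trans (hcoord _)

theorem measureReal_lt_norm_sum_smallPart_le (hd : 0 < d) (hH : Measurable H)
    (hHs : ∀ j, Measurable (Hs j)) (hHid : ∀ j, IdentDistrib (Hs j) H P P)
    (hHind : iIndepFun Hs P) {B t : ℝ} (hB : 0 ≤ B) (ht : 0 < t) (n : ℕ) (x : ℝ) :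
    P.real {ω | x < ‖∑ j ∈ Finset.range n, smallPart B (Hs j ω)‖} ≤
      2 * d * Real.exp (-t * (x / d) + n * (t * ‖∫ ω, smallPart B (H ω) ∂P‖ +
        t ^ 2 * truncMoment P H 2 B +
        Real.exp (t * B) * P.real {ω | t⁻¹ < ‖smallPart B (H ω)‖})) := by
  set v := t * ‖∫ ω, smallPart B (H ω) ∂P‖ + t ^ 2 * truncMoment P H 2 B +
        Real.exp (t * B) * P.real {ω | t⁻¹ < ‖smallPart B (H ω)‖} with hv
  have key : ∀ s : ℝ, |s| = 1 → ∀ i : Fin d,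
      P.real {ω | x / d ≤ ∑ j ∈ Finset.range n, s * smallPart B (Hs j ω) i} ≤
        Real.exp (-t * (x / d) + n * v) := by
    intro s hs i
    have hφ : Measurable fun h : Vec d => s * smallPart B h i := by
      have := measurable_smallPart (d := d) B
      fun_prop
    refine measureReal_le_sum_le_exp (Z := fun j ω => s * smallPart B (Hs j ω) i)
      (fun j => hφ.comp (hHs j)) (hHind.comp (fun _ h => s * smallPart B h i) fun _ => hφ) ht.le
      (B := B) (fun j ω => ?_) (fun j => ?_) n _
    · rw [abs_mul, hs, one_mul]
      exact (PiLp.norm_apply_le (smallPart B (Hs j ω)) i).trans (norm_smallPart_le hB _)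
    · rw [show mgf (fun ω => s * smallPart B (Hs j ω) i) P t =
        mgf (fun ω => s * smallPart B (H ω) i) P t from
        congrFun (mgf_congr_identDistrib ((hHid j).comp hφ)) t]
      exact mgf_smallPart_apply_le hH hB ht hs i
  have hsub : {ω | x < ‖∑ j ∈ Finset.range n, smallPart B (Hs j ω)‖} ⊆
      ⋃ i : Fin d, ({ω | x / d ≤ ∑ j ∈ Finset.range n, (1 : ℝ) * smallPart B (Hs j ω) i} ∪
        {ω | x / d ≤ ∑ j ∈ Finset.range n, (-1 : ℝ) * smallPart B (Hs j ω) i}) := by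
    intro ω hω
    obtain ⟨i, hi⟩ := exists_abs_apply_ge_of_lt_norm hd hω
    have hsum : (∑ j ∈ Finset.range n, smallPart B (Hs j ω)) i =
        ∑ j ∈ Finset.range n, smallPart B (Hs j ω) i := by
      simp
    rw [hsum] at hi
    simp only [Set.mem_iUnion, Set.mem_union, Set.mem_ofPred_eq, one_mul, neg_mul,
      Finset.sum_neg_distrib]
    rcases le_abs.1 hi with h | h
    · exact ⟨i, Or.inl h⟩
    · exact ⟨i, Or.inr h⟩
  calc _ ≤ P.real (⋃ i : Fin d,
        ({ω | x / d ≤ ∑ j ∈ Finset.range n, (1 : ℝ) * smallPart B (Hs j ω) i} ∪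
        {ω | x / d ≤ ∑ j ∈ Finset.range n, (-1 : ℝ) * smallPart B (Hs j ω) i})) :=
        measureReal_mono hsub
    _ ≤ ∑ i : Fin d, P.real
        ({ω | x / d ≤ ∑ j ∈ Finset.range n, (1 : ℝ) * smallPart B (Hs j ω) i} ∪
        {ω | x / d ≤ ∑ j ∈ Finset.range n, (-1 : ℝ) * smallPart B (Hs j ω) i}) :=
        measureReal_iUnion_fintype_le _
    _ ≤ ∑ _i : Fin d, (Real.exp (-t * (x / d) + n * v) + Real.exp (-t * (x / d) + n * v)) :=
        Finset.sum_le_sum fun i _ => (measureReal_union_le _ _).trans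
          (add_le_add (key 1 (by simp) i) (key (-1) (by simp) i))
    _ = _ := by
        rw [Finset.sum_const, Finset.card_univ, Fintype.card_fin, nsmul_eq_mul]
        ring

theorem measureReal_lt_norm_smallPart_le (hH : Measurable H) {B t : ℝ} (hB : 0 ≤ B) (ht : 0 < t) :
    P.real {ω | t⁻¹ < ‖smallPart B (H ω)‖} ≤ t ^ 2 * truncMoment P H 2 B := by
  have hmeas : Measurable fun ω => smallPart B (H ω) := (measurable_smallPart B).comp hH
  have hi : Integrable (fun ω => ‖smallPart B (H ω)‖ ^ 2) P := by
    refine integrable_of_abs_le (by fun_prop) (B := B ^ 2) fun ω => ?_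
    rw [abs_of_nonneg (by positivity)]
    have := norm_smallPart_le hB (H ω)
    gcongr
  have h1 := mul_meas_ge_le_integral_of_nonneg (Eventually.of_forall fun ω => by positivity) hi
    ((t⁻¹) ^ 2)
  rw [integral_norm_smallPart_pow 2 two_ne_zero] at h1
  have h2 : P.real {ω | t⁻¹ < ‖smallPart B (H ω)‖} ≤
      P.real {ω | (t⁻¹) ^ 2 ≤ ‖smallPart B (H ω)‖ ^ 2} := by
    refine measureReal_mono fun ω hω => ?_
    simp only [Set.mem_ofPred_eq] at hω ⊢
    gcongr
  refine h2.trans ?_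
  rw [inv_pow] at h1 ⊢
  rw [inv_mul_le_iff₀ (by positivity)] at h1
  exact h1

theorem measureReal_lt_norm_smallPart_le_normTail {B t : ℝ} :
    P.real {ω | t⁻¹ < ‖smallPart B (H ω)‖} ≤ normTail P H t⁻¹ :=
  measureReal_mono fun _ hω => lt_of_lt_of_le hω (norm_smallPart_le_self _)

end SmallJumps

/-! ### Negligibility of the sum of the small jumps -/

section SmallSum

variable {Ω : Type*} [MeasurableSpace Ω] {P : Measure Ω} [IsProbabilityMeasure P] {d : ℕ}
  {H : Ω → Vec d} {Hs : ℕ → Ω → Vec d} {M : ℕ → ℝ} {α : ℝ}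

omit [IsProbabilityMeasure P] in
theorem integral_smallPart_eq_zero_of_symm (hH : Measurable H)
    (hsymm : P.map (fun ω => -H ω) = P.map H) (B : ℝ) : ∫ ω, smallPart B (H ω) ∂P = 0 := by
  have hm := (measurable_smallPart (d := d) B).aestronglyMeasurable (μ := P.map H)
  have h1 : ∫ ω, smallPart B (H ω) ∂P = ∫ x, smallPart B x ∂(P.map H) :=
    (integral_map hH.aemeasurable hm).symm
  have h2 : ∫ ω, smallPart B (-H ω) ∂P = ∫ x, smallPart B x ∂(P.map fun ω => -H ω) :=
    (integral_map (by fun_prop) (measurable_smallPart B).aestronglyMeasurable).symm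
  simp only [smallPart_neg, integral_neg, hsymm, ← h1] at h2
  have h3 : (2 : ℝ) • ∫ ω, smallPart B (H ω) ∂P = 0 := by
    rw [two_smul]
    nth_rewrite 1 [← h2]
    exact neg_add_cancel _
  exact (smul_eq_zero.1 h3).resolve_left two_ne_zero

theorem norm_integral_smallPart_le_of_centered (hH : Measurable H) (hint : Integrable H P)
    (h0 : ∫ ω, H ω ∂P = 0) {B : ℝ} (hB : 0 ≤ B) :
    ‖∫ ω, smallPart B (H ω) ∂P‖ ≤ tailMoment P H B := by
  have h1 : ∫ ω, smallPart B (H ω) ∂P = ∫ ω, (smallPart B (H ω) - H ω) ∂P := by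
    rw [integral_sub (integrable_smallPart hH hB) hint, h0, sub_zero]
  rw [h1]
  refine (norm_integral_le_integral_norm _).trans (le_of_eq (integral_congr_ae
    (Eventually.of_forall fun ω => ?_)))
  simp only [Set.indicator_apply, Set.mem_ofPred_eq]
  split_ifs with h
  · rw [smallPart_of_lt h, zero_sub, norm_neg]
  · rw [smallPart_of_le (not_lt.1 h), sub_self, norm_zero]

/-- For `α < 1` the truncated first moment is `O(M P(‖H‖ > M))`. For `α = 1` the mean is zero by
symmetry. For `α > 1` centering turns the mean of the small part into minus that of the large part,
which is of the same order. Soft truncation concludes. -/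
theorem tendsto_mean_smallPart (hH : Measurable H) (hpos : ∀ x, 0 < normTail P H x)
    (hα : IsTailIndex P H α) (hsymm : α = 1 → P.map (fun ω => -H ω) = P.map H)
    (hcent : 1 < α → Integrable H P ∧ ∫ ω, H ω ∂P = 0) (hMpos : ∀ n, 0 < M n)
    (hM : Tendsto M atTop atTop)
    (hsoft : Tendsto (fun n : ℕ => n * normTail P H (M n)) atTop (𝓝 0)) {ε : ℝ} (hε : 0 < ε)
    (hε1 : ε ≤ 1) :
    Tendsto (fun n : ℕ => n * (‖∫ ω, smallPart (ε * M n) (H ω) ∂P‖ / M n)) atTop (𝓝 0) := by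
  rcases lt_trichotomy α 1 with h | h | h
  · obtain ⟨C, hC, hbound⟩ := exists_truncMoment_le (p := 1) hH hpos hα (by simpa using h)
    have hlim := hsoft.const_mul C
    rw [mul_zero] at hlim
    refine squeeze_zero' (Eventually.of_forall fun n => by have := hMpos n; positivity) ?_ hlim
    filter_upwards [hM.eventually hbound] with n hn
    have hMn := hMpos n
    have h1 : ‖∫ ω, smallPart (ε * M n) (H ω) ∂P‖ ≤ truncMoment P H 1 (M n) := by
      refine (norm_integral_le_integral_norm _).trans ?_
      have := integral_norm_smallPart_pow (P := P) (H := H) 1 one_ne_zero (ε * M n)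
      simp only [pow_one] at this
      rw [this]
      exact truncMoment_mono hH 1 (by nlinarith)
    rw [pow_one] at hn
    calc (n : ℝ) * (‖∫ ω, smallPart (ε * M n) (H ω) ∂P‖ / M n)
        ≤ n * (C * (M n * normTail P H (M n)) / M n) := by
          gcongr
          exact h1.trans hn
      _ = C * (n * normTail P H (M n)) := by field_simp
  · simp [integral_smallPart_eq_zero_of_symm hH (hsymm h)]
  · obtain ⟨hint, h0⟩ := hcent h
    obtain ⟨C, hC, hbound⟩ := exists_tailMoment_le hH hint hpos hα h
    have hlim := ((hsoft.mul ((hα.2 ε hε).comp hM)).const_mul (C * ε))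
    rw [zero_mul, mul_zero] at hlim
    refine squeeze_zero' (Eventually.of_forall fun n => by have := hMpos n; positivity) ?_ hlim
    filter_upwards [(hM.const_mul_atTop hε).eventually hbound] with n hn
    have hMn := hMpos n
    have hp := hpos (M n)
    have h1 := norm_integral_smallPart_le_of_centered hH hint h0 (mul_pos hε hMn).le
    calc (n : ℝ) * (‖∫ ω, smallPart (ε * M n) (H ω) ∂P‖ / M n)
        ≤ n * (C * (ε * M n * normTail P H (ε * M n)) / M n) := by
          gcongr
          exact h1.trans hn
      _ = C * ε * (n * normTail P H (M n) *
            (normTail P H (ε * M n) / normTail P H (M n))) := by field_simp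

/-- A power bound in `n P(‖H‖ > M)` is what later beats the logarithmic size of the exponential
parameter. For `α < 2` the truncated moment bound gives exponent one; for `α = 2` a positive
exponent is gained from the growth of `M`. -/
theorem exists_variance_le_rpow (hH : Measurable H) (hpos : ∀ x, 0 < normTail P H x)
    (hα : IsTailIndex P H α) (hα2 : α ≤ 2) (hMpos : ∀ n, 0 < M n) (hM : Tendsto M atTop atTop)
    (hM2 : α = 2 → ∃ γ : ℝ, 0 < γ ∧
      Tendsto (fun n : ℕ => M n / √((n : ℝ) ^ (1 + γ))) atTop atTop) :
    ∃ κ C : ℝ, 0 < κ ∧ 0 ≤ C ∧ ∀ᶠ n : ℕ in atTop,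
      n * (truncMoment P H 2 (M n) / M n ^ 2) ≤ C * (n * normTail P H (M n)) ^ κ := by
  rcases hα2.lt_or_eq with h | h
  · obtain ⟨C, hC, hbound⟩ := exists_truncMoment_le (p := 2) hH hpos hα (by simpa using h)
    refine ⟨1, C, one_pos, hC, ?_⟩
    filter_upwards [hM.eventually hbound] with n hn
    have hMn := hMpos n
    rw [Real.rpow_one]
    calc (n : ℝ) * (truncMoment P H 2 (M n) / M n ^ 2)
        ≤ n * (C * (M n ^ 2 * normTail P H (M n)) / M n ^ 2) := by gcongr
      _ = C * (n * normTail P H (M n)) := by field_simp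
  · obtain ⟨γ, hγ, hγM⟩ := hM2 h
    -- With this `ζ` the growth condition reads `n ≤ M^(2 - 2ζ)`. A truncated variance of order
    -- `M^ζ` then leaves `M^(-ζ)` after multiplication by `n / M^2`.
    set ζ := γ / (1 + γ) with hζ
    have hζ0 : 0 < ζ := by positivity
    have hζ1 : ζ < 1 := by rw [hζ, div_lt_one (by positivity)]; linarith
    obtain ⟨C, hC, hbound⟩ := exists_truncMoment_two_le_rpow hH hpos hα h hζ0 (by linarith)
    -- Any exponent above `α = 2` would do: `M^(-3) ≤ n P(‖H‖ > M)` turns `M^(-ζ)` into the power `ζ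
    -- / 3`.
    have hlow := eventually_rpow_neg_le (antitone_normTail P H) hpos (hα.2 2 two_pos) hα.1
      (β := 3) (by linarith)
    refine ⟨ζ / 3, C, by positivity, hC, ?_⟩
    filter_upwards [hM.eventually hbound, hM.eventually hlow, hγM.eventually_ge_atTop 1,
      eventually_ge_atTop 1] with n h1 h2 h3 h4
    have hMn := hMpos n
    have hn1 : (1 : ℝ) ≤ n := by exact_mod_cast h4
    have hn0 : (0 : ℝ) < n := by linarith
    have h5 : (n : ℝ) ^ (1 + γ) ≤ M n ^ 2 := by
      rw [one_le_div (by positivity), Real.sqrt_le_left hMn.le] at h3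
      exact h3
    have h6 : (n : ℝ) ≤ M n ^ (2 - 2 * ζ) := by
      have e1 : (n : ℝ) = ((n : ℝ) ^ (1 + γ)) ^ (1 + γ)⁻¹ := by
        rw [← Real.rpow_mul hn0.le, mul_inv_cancel₀ (by positivity), Real.rpow_one]
      have e2 : M n ^ (2 - 2 * ζ) = (M n ^ 2) ^ (1 + γ)⁻¹ := by
        rw [← Real.rpow_two, ← Real.rpow_mul hMn.le]
        congr 1
        rw [hζ]
        field_simp
        ring
      rw [e2]
      conv_lhs => rw [e1]
      gcongr
    have h7 : (M n ^ (-(3 : ℝ))) ^ (ζ / 3) ≤ (n * normTail P H (M n)) ^ (ζ / 3) := by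
      have := (hpos (M n)).le
      gcongr
      nlinarith
    have h8 : (M n ^ (-(3 : ℝ))) ^ (ζ / 3) = M n ^ (-ζ) := by
      rw [← Real.rpow_mul hMn.le]
      congr 1
      ring
    calc (n : ℝ) * (truncMoment P H 2 (M n) / M n ^ 2)
        ≤ M n ^ (2 - 2 * ζ) * (C * M n ^ ζ / M n ^ 2) := by
          have := truncMoment_nonneg (P := P) (H := H) 2 (M n)
          gcongr
      _ = C * M n ^ (-ζ) := by
          have : M n ^ (-ζ) = M n ^ (2 - 2 * ζ) * M n ^ ζ / M n ^ (2 : ℝ) := by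
            rw [← Real.rpow_add hMn, ← Real.rpow_sub hMn]
            congr 1
            ring
          rw [this, Real.rpow_two]
          ring
      _ ≤ C * (n * normTail P H (M n)) ^ (ζ / 3) := by
          rw [← h8]
          gcongr

/-- The exponential bound with the parameter `θ / M`, at levels proportional to `M`. -/
theorem measureReal_smallSum_le (hd : 0 < d) (hH : Measurable H)
    (hHs : ∀ j, Measurable (Hs j)) (hHid : ∀ j, IdentDistrib (Hs j) H P P)
    (hHind : iIndepFun Hs P) {m ε η θ : ℝ} (hm : 0 < m) (hε : 0 < ε) (hε1 : ε ≤ 1)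
    (hθ : 0 < θ) (n : ℕ)
    (hmean : n * (‖∫ ω, smallPart (ε * m) (H ω) ∂P‖ / m) ≤ η / (4 * d))
    (hvar : θ ^ 2 * (n * (truncMoment P H 2 m / m ^ 2)) + n * (Real.exp (θ * ε) *
      P.real {ω | (θ / m)⁻¹ < ‖smallPart (ε * m) (H ω)‖}) ≤ θ * η / (4 * d) + 1) :
    P.real {ω | η * m < ‖∑ j ∈ Finset.range n, smallPart (ε * m) (Hs j ω)‖} ≤
      2 * d * Real.exp (1 - θ * η / (2 * d)) := by
  refine (measureReal_lt_norm_sum_smallPart_le hd hH hHs hHid hHind (mul_pos hε hm).le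
    (div_pos hθ hm) n (η * m)).trans ?_
  have hd' : (0 : ℝ) < d := by exact_mod_cast hd
  gcongr 2 * d * Real.exp ?_
  -- Budget of the exponent: the main term is `-θη/d`, the mean costs `θη/(4d)`, the variance and
  -- the jumps together cost `θη/(4d) + 1`, and `1 - θη/(2d)` remains.
  have e1 : -(θ / m) * (η * m / d) = -(θ * η / d) := by field_simp
  have e2 : θ / m * (ε * m) = θ * ε := by field_simp
  have h1 : truncMoment P H 2 (ε * m) ≤ truncMoment P H 2 m :=
    truncMoment_mono hH 2 (by nlinarith)
  have h2 : (n : ℝ) * ((θ / m) ^ 2 * truncMoment P H 2 (ε * m)) ≤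
      θ ^ 2 * (n * (truncMoment P H 2 m / m ^ 2)) := by
    calc (n : ℝ) * ((θ / m) ^ 2 * truncMoment P H 2 (ε * m))
        ≤ n * ((θ / m) ^ 2 * truncMoment P H 2 m) := by gcongr
      _ = _ := by field_simp
  have h3 : (n : ℝ) * (θ / m * ‖∫ ω, smallPart (ε * m) (H ω) ∂P‖) ≤ θ * (η / (4 * d)) := by
    calc (n : ℝ) * (θ / m * ‖∫ ω, smallPart (ε * m) (H ω) ∂P‖)
        = θ * (n * (‖∫ ω, smallPart (ε * m) (H ω) ∂P‖ / m)) := by field_simp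
      _ ≤ _ := by gcongr
  rw [e1, e2, mul_add, mul_add]
  have e3 : θ * (η / (4 * d)) + θ * η / (4 * d) = θ * η / (2 * d) := by
    field_simp
    ring
  have e4 : θ * η / d = 2 * (θ * η / (2 * d)) := by field_simp
  linarith

theorem exists_forall_isLittleO_smallSum_of_le_two (hd : 0 < d) (hH : Measurable H)
    (hpos : ∀ x, 0 < normTail P H x)
    (hα : IsTailIndex P H α) (hα2 : α ≤ 2) (hsymm : α = 1 → P.map (fun ω => -H ω) = P.map H)
    (hcent : 1 < α → Integrable H P ∧ ∫ ω, H ω ∂P = 0)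
    (hHs : ∀ j, Measurable (Hs j)) (hHid : ∀ j, IdentDistrib (Hs j) H P P)
    (hHind : iIndepFun Hs P) (hMpos : ∀ n, 0 < M n) (hM : Tendsto M atTop atTop)
    (hsoft : Tendsto (fun n : ℕ => n * normTail P H (M n)) atTop (𝓝 0))
    (hM2 : α = 2 → ∃ γ : ℝ, 0 < γ ∧
      Tendsto (fun n : ℕ => M n / √((n : ℝ) ^ (1 + γ))) atTop atTop)
    (k : ℕ) {η : ℝ} (hη : 0 < η) :
    ∃ ε₀ : ℝ, 0 < ε₀ ∧ ∀ ε, 0 < ε → ε ≤ ε₀ → (fun n : ℕ =>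
      P.real {ω | η * M n < ‖∑ j ∈ Finset.range n, smallPart (ε * M n) (Hs j ω)‖}) =o[atTop]
      (fun n : ℕ => (n * normTail P H (M n)) ^ k) := by
  obtain ⟨κ, C, hκ, hC, hvar⟩ := exists_variance_le_rpow hH hpos hα hα2 hMpos hM hM2
  have hd' : (0 : ℝ) < d := by exact_mod_cast hd
  -- With `p = n P(‖H‖ > M)` and `θ = A log (1/p)`, this `A` makes `exp (-θη/(2d))` equal to
  -- `p^(k+1)`. The bound on `ε` makes `exp (θε) ≤ p^(-κ/2)`, so a variance of order `p^κ` still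
  -- leaves `p^(κ/2)`, which beats `(log p)^2`.
  set A : ℝ := 2 * d * (k + 1) / η with hA
  have hA0 : 0 < A := by positivity
  refine ⟨min 1 (κ / (2 * A)), by positivity, fun ε hε hε0 => ?_⟩
  have hε1 : ε ≤ 1 := hε0.trans (min_le_left _ _)
  have hε2 : ε * A ≤ κ / 2 := by
    have := hε0.trans (min_le_right _ _)
    rw [le_div_iff₀ (by positivity)] at this
    linarith
  set p : ℕ → ℝ := fun n => n * normTail P H (M n) with hp
  have hp0 : ∀ᶠ n in atTop, 0 < p n := by
    filter_upwards [eventually_gt_atTop 0] with n hn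
    have := hpos (M n)
    positivity
  have hpw : Tendsto p atTop (𝓝[>] 0) := tendsto_nhdsWithin_iff.2 ⟨hsoft, hp0⟩
  have hlog : Tendsto (fun n => A ^ 2 * C * 2 * (Real.log (p n) ^ 2 * (p n) ^ (κ / 2))) atTop
      (𝓝 0) := by
    have h1 : Tendsto (fun x : ℝ => Real.log x * x ^ (κ / 4)) (𝓝[>] 0) (𝓝 0) :=
      tendsto_log_mul_rpow_nhdsGT_zero (by positivity)
    have h2 := ((h1.comp hpw).pow 2).const_mul (A ^ 2 * C * 2)
    rw [zero_pow two_ne_zero, mul_zero] at h2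
    refine h2.congr' ?_
    filter_upwards [hp0] with n hn
    simp only [Function.comp]
    rw [mul_pow, ← Real.rpow_natCast (p n ^ (κ / 4)), ← Real.rpow_mul hn.le]
    congr 3
    push_cast
    ring
  have hmean := tendsto_mean_smallPart hH hpos hα hsymm hcent hMpos hM hsoft hε hε1
  have hmain : ∀ᶠ n : ℕ in atTop,
      P.real {ω | η * M n < ‖∑ j ∈ Finset.range n, smallPart (ε * M n) (Hs j ω)‖} ≤
        2 * d * Real.exp 1 * p n ^ (k + 1) := by
    filter_upwards [hvar, hlog.eventually_lt_const one_pos, hp0, hsoft.eventually_lt_const one_pos,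
      hmean.eventually_lt_const (by positivity : 0 < η / (4 * d))] with n h1 h2 h3 h4 h5
    have hl : Real.log (p n) < 0 := Real.log_neg h3 h4
    have hMn := hMpos n
    have hθ : 0 < A * (-Real.log (p n)) := mul_pos hA0 (by linarith)
    have hV0 := truncMoment_nonneg (P := P) (H := H) 2 (M n)
    have h6 := measureReal_lt_norm_smallPart_le (P := P) hH (mul_pos hε hMn).le (div_pos hθ hMn)
    have h7 : truncMoment P H 2 (ε * M n) ≤ truncMoment P H 2 (M n) :=
      truncMoment_mono hH 2 (by nlinarith)
    have h8 : Real.exp (A * (-Real.log (p n)) * ε) ≤ p n ^ (-(κ / 2)) := by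
      rw [Real.rpow_def_of_pos h3, Real.exp_le_exp]
      nlinarith
    have h9 : 1 ≤ p n ^ (-(κ / 2)) := Real.one_le_rpow_of_pos_of_le_one_of_nonpos h3 h4.le
      (by linarith)
    have h10 : p n ^ κ * p n ^ (-(κ / 2)) = p n ^ (κ / 2) := by
      rw [← Real.rpow_add h3]
      congr 1
      ring
    set θ := A * (-Real.log (p n)) with hθdef
    set q := (n : ℝ) * (truncMoment P H 2 (M n) / M n ^ 2) with hq
    have hq0 : 0 ≤ q := by positivity
    have h11 : n * (Real.exp (θ * ε) *
        P.real {ω | (θ / M n)⁻¹ < ‖smallPart (ε * M n) (H ω)‖}) ≤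
        p n ^ (-(κ / 2)) * (θ ^ 2 * q) := by
      calc _ ≤ n * (p n ^ (-(κ / 2)) * ((θ / M n) ^ 2 * truncMoment P H 2 (M n))) := by
            gcongr
            exact h6.trans (by gcongr)
        _ = _ := by rw [hq]; field_simp
    have h12 : θ ^ 2 * q ≤ p n ^ (-(κ / 2)) * (θ ^ 2 * q) :=
      le_mul_of_one_le_left (by positivity) h9
    have h13 : p n ^ (-(κ / 2)) * (θ ^ 2 * q) ≤ 1 / 2 := by
      calc p n ^ (-(κ / 2)) * (θ ^ 2 * q) ≤ p n ^ (-(κ / 2)) * (θ ^ 2 * (C * p n ^ κ)) := by gcongr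
        _ = C * θ ^ 2 * (p n ^ κ * p n ^ (-(κ / 2))) := by ring
        _ = A ^ 2 * C * 2 * (Real.log (p n) ^ 2 * (p n) ^ (κ / 2)) / 2 := by
          rw [h10, hθdef]; ring
        _ ≤ 1 / 2 := by linarith
    have hmainbound := measureReal_smallSum_le hd hH hHs hHid hHind hMn hε hε1 hθ n h5.le (by
      have : 0 ≤ θ * η / (4 * d) := by positivity
      linarith)
    refine hmainbound.trans (le_of_eq ?_)
    have e1 : θ * η / (2 * d) = -(((k + 1 : ℕ) : ℝ) * Real.log (p n)) := by
      rw [hθdef, hA]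
      push_cast
      field_simp
    rw [e1, sub_neg_eq_add, Real.exp_add, Real.exp_nat_mul, Real.exp_log h3]
    ring
  refine IsBigO.trans_isLittleO (g := fun n => p n ^ (k + 1)) ?_ ?_
  · refine IsBigO.of_bound (2 * d * Real.exp 1) ?_
    filter_upwards [hmain, hp0] with n h1 h2
    rw [Real.norm_of_nonneg measureReal_nonneg, Real.norm_of_nonneg (by positivity)]
    exact h1
  · rw [isLittleO_iff_tendsto' (hp0.mono fun n hn h0 => absurd h0 (by positivity))]
    refine hsoft.congr' (hp0.mono fun n hn => ?_)
    change p n = p n ^ (k + 1) / p n ^ k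
    rw [pow_succ, mul_div_cancel_left₀ _ (by positivity)]

theorem exists_forall_isLittleO_smallSum_of_two_lt (hd : 0 < d) (hH : Measurable H)
    (hpos : ∀ x, 0 < normTail P H x)
    (hα : IsTailIndex P H α) (hα2 : 2 < α)
    (hcent : 1 < α → Integrable H P ∧ ∫ ω, H ω ∂P = 0)
    (hHs : ∀ j, Measurable (Hs j)) (hHid : ∀ j, IdentDistrib (Hs j) H P P)
    (hHind : iIndepFun Hs P) (hMpos : ∀ n, 0 < M n) (hM : Tendsto M atTop atTop)
    (hsoft : Tendsto (fun n : ℕ => n * normTail P H (M n)) atTop (𝓝 0))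
    (hMgt2 : Tendsto (fun n : ℕ => M n / √(n * Real.log (M n))) atTop atTop)
    (k : ℕ) {η : ℝ} (hη : 0 < η) :
    ∃ ε₀ : ℝ, 0 < ε₀ ∧ ∀ ε, 0 < ε → ε ≤ ε₀ → (fun n : ℕ =>
      P.real {ω | η * M n < ‖∑ j ∈ Finset.range n, smallPart (ε * M n) (Hs j ω)‖}) =o[atTop]
      (fun n : ℕ => (n * normTail P H (M n)) ^ k) := by
  obtain ⟨C, hC, hV⟩ := exists_truncMoment_two_le hH hpos hα hα2
  have hd' : (0 : ℝ) < d := by exact_mod_cast hd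
  have hα0 := hα.1
  -- With `θ = A log M` the final bound is a constant times `M^(-(α+1)k - 1)`. It suffices because
  -- `M^(-(α+1)) ≤ n P(‖H‖ > M)` eventually; the extra `M⁻¹` gives the little-o.
  set A : ℝ := 2 * d * ((α + 1) * k + 1) / η with hA
  have hA0 : 0 < A := by positivity
  -- An exponent strictly between `2` and `α`: the tail at `M / θ` is `O((θ/M)^β)`. With `n ≤ M^2`
  -- and `exp (θε) ≤ M^((β-2)/2)`, the jump term is at most a constant times `(log M)^β /
  -- M^((β-2)/2) → 0`.
  set β : ℝ := (α + 2) / 2 with hβ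
  obtain ⟨D, hD, hFD⟩ := exists_eventually_le_rpow (antitone_normTail P H) hpos (hα.2 2 two_pos)
    (β := β) (by linarith) (by linarith)
  have hβ2 : 0 < β - 2 := by linarith
  refine ⟨min 1 ((β - 2) / (2 * A)), by positivity, fun ε hε hε0 => ?_⟩
  have hε1 : ε ≤ 1 := hε0.trans (min_le_left _ _)
  have hε2 : ε * A ≤ (β - 2) / 2 := by
    have := hε0.trans (min_le_right _ _)
    rw [le_div_iff₀ (by positivity)] at this
    linarith
  have hlogM : Tendsto (fun n => Real.log (M n)) atTop atTop := Real.tendsto_log_atTop.comp hM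
  have hscale : Tendsto (fun n => M n / (A * Real.log (M n))) atTop atTop := by
    have h1 : Tendsto (fun x : ℝ => Real.log x / x) atTop (𝓝[>] 0) := by
      refine tendsto_nhdsWithin_iff.2 ⟨?_, ?_⟩
      · simpa using Real.isLittleO_log_id_atTop.tendsto_div_nhds_zero
      · filter_upwards [eventually_gt_atTop 1] with x hx
        exact div_pos (Real.log_pos hx) (by linarith)
    have h2 := ((tendsto_inv_nhdsGT_zero.comp h1).comp hM).const_mul_atTop (inv_pos.2 hA0)
    refine h2.congr fun n => ?_
    simp only [Function.comp, inv_div]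
    rw [mul_comm A, ← div_div, div_eq_mul_inv _ A, mul_comm]
  have hratio : Tendsto (fun n : ℕ => n * Real.log (M n) / M n ^ 2) atTop (𝓝 0) := by
    have h1 := (hMgt2.inv_tendsto_atTop).pow 2
    rw [zero_pow two_ne_zero] at h1
    refine h1.congr' ?_
    filter_upwards [hlogM.eventually_gt_atTop 0] with n hn
    simp only [Pi.inv_apply, inv_div]
    rw [div_pow, Real.sq_sqrt (by positivity)]
  have hsub : Tendsto (fun n => D * A ^ β * (Real.log (M n) ^ β / M n ^ ((β - 2) / 2))) atTop
      (𝓝 0) := by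
    have h1 := ((isLittleO_log_rpow_rpow_atTop β
      (by positivity : 0 < (β - 2) / 2)).tendsto_div_nhds_zero.comp hM).const_mul (D * A ^ β)
    simpa using h1
  have hlow := eventually_rpow_neg_le (antitone_normTail P H) hpos (hα.2 2 two_pos) hα.1
      (β := α + 1) (by linarith)
  have hmean := tendsto_mean_smallPart hH hpos hα (fun h => by linarith) hcent hMpos hM hsoft
    hε hε1
  have hmain : ∀ᶠ n : ℕ in atTop,
      P.real {ω | η * M n < ‖∑ j ∈ Finset.range n, smallPart (ε * M n) (Hs j ω)‖} ≤
        2 * d * Real.exp 1 * ((M n)⁻¹ * (n * normTail P H (M n)) ^ k) := by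
    filter_upwards [hlogM.eventually_gt_atTop 1, hscale.eventually hFD,
      (hratio.const_mul (A * C)).eventually_lt_const (by
        rw [mul_zero]; positivity : A * C * 0 < η / (4 * d)),
      hratio.eventually_lt_const one_pos, hsub.eventually_lt_const one_pos, hM.eventually hlow,
      hmean.eventually_lt_const (by positivity : 0 < η / (4 * d)), eventually_ge_atTop 1]
      with n h1 h2 h3 h4 h5 h6 h7 h8
    have hMn := hMpos n
    have hl0 : 0 < Real.log (M n) := by linarith
    have hn1 : (1 : ℝ) ≤ n := by exact_mod_cast h8
    set θ := A * Real.log (M n) with hθdef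
    have hθ : 0 < θ := by positivity
    have h9 : (n : ℝ) ≤ M n ^ 2 := by
      rw [div_lt_one (by positivity)] at h4
      nlinarith
    have h10 : Real.exp (θ * ε) ≤ M n ^ ((β - 2) / 2) := by
      rw [Real.rpow_def_of_pos hMn, Real.exp_le_exp, hθdef]
      nlinarith
    have hτ : P.real {ω | (θ / M n)⁻¹ < ‖smallPart (ε * M n) (H ω)‖} ≤
        D * A ^ β * Real.log (M n) ^ β / M n ^ β := by
      refine (measureReal_lt_norm_smallPart_le_normTail (P := P)).trans ?_
      rw [inv_div]
      have h11 : 0 < (M n / θ) ^ β := by positivity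
      rw [mul_comm, ← le_div_iff₀ h11] at h2
      refine h2.trans (le_of_eq ?_)
      rw [Real.div_rpow hMn.le hθ.le, hθdef, Real.mul_rpow hA0.le hl0.le]
      field_simp
    have hjump : n * (Real.exp (θ * ε) *
        P.real {ω | (θ / M n)⁻¹ < ‖smallPart (ε * M n) (H ω)‖}) ≤ 1 := by
      calc _ ≤ M n ^ 2 * (M n ^ ((β - 2) / 2) *
            (D * A ^ β * Real.log (M n) ^ β / M n ^ β)) := by gcongr
        _ = D * A ^ β * (Real.log (M n) ^ β / M n ^ ((β - 2) / 2)) := by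
          have e : M n ^ β = M n ^ 2 * M n ^ ((β - 2) / 2) * M n ^ ((β - 2) / 2) := by
            rw [← Real.rpow_two, ← Real.rpow_add hMn, ← Real.rpow_add hMn]
            congr 1
            ring
          rw [e]
          field_simp
        _ ≤ 1 := h5.le
    -- This is where `M / √(n log M) → ∞` is needed: one of the two factors `θ`, together with `n /
    -- M^2`, must be small.
    have hvar : θ ^ 2 * (n * (truncMoment P H 2 (M n) / M n ^ 2)) ≤ θ * η / (4 * d) := by
      calc θ ^ 2 * (n * (truncMoment P H 2 (M n) / M n ^ 2))
          ≤ θ ^ 2 * (n * (C / M n ^ 2)) := by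
            gcongr
            exact hV _
        _ = θ * (A * C * (n * Real.log (M n) / M n ^ 2)) := by rw [hθdef]; ring
        _ ≤ θ * (η / (4 * d)) := by gcongr
        _ = θ * η / (4 * d) := by ring
    refine (measureReal_smallSum_le hd hH hHs hHid hHind hMn hε hε1 hθ n h7.le
      (by linarith)).trans ?_
    have e1 : θ * η / (2 * d) = ((α + 1) * k + 1) * Real.log (M n) := by
      rw [hθdef, hA]
      field_simp
    have e2 : Real.exp (-(((α + 1) * k + 1) * Real.log (M n))) =
        (M n)⁻¹ * (M n ^ (-(α + 1))) ^ k := by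
      rw [← Real.rpow_natCast, ← Real.rpow_mul hMn.le, ← Real.rpow_neg_one,
        ← Real.rpow_add hMn, Real.rpow_def_of_pos hMn]
      congr 1
      ring
    rw [e1, sub_eq_add_neg, Real.exp_add, e2, ← mul_assoc]
    have : M n ^ (-(α + 1)) ≤ n * normTail P H (M n) := by
      have := (hpos (M n)).le
      nlinarith
    gcongr
  refine IsBigO.trans_isLittleO (g := fun n : ℕ => (M n)⁻¹ * (n * normTail P H (M n)) ^ k) ?_ ?_
  · refine IsBigO.of_bound (2 * d * Real.exp 1) ?_
    filter_upwards [hmain] with n h1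
    have h2 := (hpos (M n)).le
    have h3 := hMpos n
    rw [Real.norm_of_nonneg measureReal_nonneg, Real.norm_of_nonneg (by positivity)]
    exact h1
  · have h1 : (fun n : ℕ => (M n)⁻¹) =o[atTop] (fun _ => (1 : ℝ)) :=
      (isLittleO_one_iff ℝ).2 hM.inv_tendsto_atTop
    simpa using h1.mul_isBigO (isBigO_refl (fun n : ℕ => ((n : ℝ) * normTail P H (M n)) ^ k) _)

end SmallSum

/-! ### Comparison of the row sum with its largest terms -/

section Comparison

variable {d : ℕ}

theorem ballRetract_smul_inv_of_le {m : ℝ} (hm : 0 < m) {h : Vec d} (hh : ‖h‖ ≤ m) :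
    ballRetract (m⁻¹ • h) = m⁻¹ • h := by
  have : ‖m⁻¹ • h‖ ≤ 1 := by
    rwa [norm_smul, norm_inv, Real.norm_of_nonneg hm.le, inv_mul_le_iff₀ hm, mul_one]
  rw [ballRetract, max_eq_left this, inv_one, one_smul]

theorem ballRetract_smul_inv_of_lt {m : ℝ} (hm : 0 < m) {h : Vec d} (hh : m < ‖h‖) :
    ballRetract (m⁻¹ • h) = ‖h‖⁻¹ • h := by
  have h1 : ‖m⁻¹ • h‖ = m⁻¹ * ‖h‖ := by
    rw [norm_smul, norm_inv, Real.norm_of_nonneg hm.le]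
  have h2 : 1 ≤ ‖m⁻¹ • h‖ := by
    rw [h1, le_inv_mul_iff₀ hm, mul_one]
    exact hh.le
  have h3 : 0 < ‖h‖ := hm.trans hh
  rw [ballRetract, max_eq_right h2, h1, smul_smul]
  congr 1
  field_simp

theorem norm_ballRetract_smul_inv_le {m : ℝ} (hm : 0 < m) {c : ℝ} {h : Vec d}
    (hh : ‖h‖ ≤ c * m) : ‖ballRetract (m⁻¹ • h)‖ ≤ c := by
  rw [norm_ballRetract, norm_smul, norm_inv, Real.norm_of_nonneg hm.le]
  refine (min_le_left _ _).trans ?_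
  rwa [inv_mul_le_iff₀ hm, mul_comm]

theorem norm_ballRetract_le_one (x : Vec d) : ‖ballRetract x‖ ≤ 1 := by
  rw [norm_ballRetract]
  exact min_le_right _ _

/-- The two vectors agree when `‖h‖ ≤ m` and otherwise differ by `l / m` times a unit vector. -/
theorem norm_smul_inv_truncate_sub_le {m : ℝ} (hm : 0 < m) {h : Vec d} {l η : ℝ} (hl : 0 ≤ l)
    (hη : 0 ≤ η) (hlη : m < ‖h‖ → l ≤ η * m) :
    ‖m⁻¹ • truncate m h l - ballRetract (m⁻¹ • h)‖ ≤ η := by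
  rcases le_or_gt ‖h‖ m with hh | hh
  · rw [truncate, if_pos hh, ballRetract_smul_inv_of_le hm hh, sub_self, norm_zero]
    exact hη
  · have h3 : 0 < ‖h‖ := hm.trans hh
    rw [truncate, if_neg (not_le.2 hh), ballRetract_smul_inv_of_lt hm hh, smul_smul]
    have : m⁻¹ * (m + l) = l / m + 1 := by field_simp; ring
    rw [this, add_smul, one_smul, add_sub_cancel_right, norm_smul, norm_smul, norm_inv, norm_norm,
      inv_mul_cancel₀ h3.ne', mul_one, Real.norm_of_nonneg (by positivity), div_le_iff₀ hm]
    exact hlη hh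

theorem norm_sum_le_of_mem {ι : Type*} {J : Finset ι} {u : ι → Vec d} {k : ℕ} {c : ℝ}
    (hJ : J.card = k) (hu : ∀ j ∈ J, ‖u j‖ ≤ 1) {j₀ : ι} (hj₀ : j₀ ∈ J) (hc : ‖u j₀‖ ≤ c) :
    ‖∑ j ∈ J, u j‖ ≤ (k : ℝ) - 1 + c := by
  classical
  refine (norm_sum_le _ _).trans ?_
  rw [← Finset.add_sum_erase _ _ hj₀]
  have h1 : ∑ j ∈ J.erase j₀, ‖u j‖ ≤ ∑ _j ∈ J.erase j₀, (1 : ℝ) :=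
    Finset.sum_le_sum fun j hj => hu j (Finset.mem_of_mem_erase hj)
  rw [Finset.sum_const, nsmul_one, Finset.card_erase_of_mem hj₀, hJ] at h1
  have hk : 1 ≤ k := hJ ▸ Finset.card_pos.2 ⟨j₀, hj₀⟩
  rw [Nat.cast_sub hk, Nat.cast_one] at h1
  linarith

theorem norm_sum_le_card {ι : Type*} {J : Finset ι} {u : ι → Vec d} {c : ℝ}
    (hu : ∀ j ∈ J, ‖u j‖ ≤ c) : ‖∑ j ∈ J, u j‖ ≤ J.card * c := by
  refine (norm_sum_le _ _).trans ((Finset.sum_le_sum hu).trans (le_of_eq ?_))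
  rw [Finset.sum_const, nsmul_eq_mul]

/-- The number of `k`-element sets of indices below `n` such that all the corresponding vectors
have norm larger than `c`. -/
def countLarge (h : ℕ → Vec d) (n k : ℕ) (c : ℝ) : ℕ :=
  ((Finset.powersetCard k (Finset.range n)).filter fun J => ∀ j ∈ J, c < ‖h j‖).card

theorem filter_powersetCard_eq (h : ℕ → Vec d) (n k : ℕ) (c : ℝ) :
    (Finset.powersetCard k (Finset.range n)).filter (fun J => ∀ j ∈ J, c < ‖h j‖) =
      Finset.powersetCard k ((Finset.range n).filter fun j => c < ‖h j‖) := by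
  ext J
  simp only [Finset.mem_filter, Finset.mem_powersetCard, Finset.subset_iff]
  grind

theorem countLarge_eq_choose (h : ℕ → Vec d) (n k : ℕ) (c : ℝ) :
    countLarge h n k c = ((Finset.range n).filter fun j => c < ‖h j‖).card.choose k := by
  rw [countLarge, filter_powersetCard_eq, Finset.card_powersetCard]

theorem choose_le_succ_mul_choose {N k : ℕ} (h : k + 1 ≤ N) :
    N.choose k ≤ (k + 1) * N.choose (k + 1) := by
  have h1 := Nat.choose_succ_right_eq N k
  have h2 : 1 ≤ N - k := by omega
  calc N.choose k = N.choose k * 1 := (mul_one _).symm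
    _ ≤ N.choose k * (N - k) := Nat.mul_le_mul_left _ h2
    _ = (k + 1) * N.choose (k + 1) := by rw [← h1, mul_comm]

/-- Pathwise form of the `k`-jump heuristic. Let `B` be the set of jumps above `ε m`. If `B` has
more than `k` elements, the error is paid by the count of `(k+1)`-subsets. Otherwise, off the two
bad events, `S` is within `(k+1) η` of the sum of the retracted jumps in `B`: with fewer than `k`
jumps both quantities vanish, and with exactly `k` only the subset `B` contributes. -/
theorem abs_sub_sum_powersetCard_le {f : Vec d → ℝ} {C δ η ε e m : ℝ} {k n : ℕ}
    {h : ℕ → Vec d} {l : ℕ → ℝ} (hm : 0 < m) (hl : ∀ j, 0 ≤ l j) (hC : ∀ x, |f x| ≤ C)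
    (hf0 : ∀ x, ‖x‖ ≤ (k : ℝ) - 1 + δ → f x = 0) (hδ : 0 < δ) (hη : 0 < η)
    (hηδ : (k + 1) * η ≤ δ / 2) (hε1 : ε ≤ 1) (hεδ : ε ≤ δ) (he : 0 ≤ e)
    (hf : ∀ x y, ‖x‖ ≤ k → ‖y - x‖ ≤ (k + 1) * η → |f y - f x| ≤ e) :
    |f (m⁻¹ • ∑ j ∈ Finset.range n, truncate m (h j) (l j)) -
      ∑ J ∈ Finset.powersetCard k (Finset.range n), f (∑ j ∈ J, ballRetract (m⁻¹ • h j))| ≤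
      2 * C * ((if η * m < ‖∑ j ∈ Finset.range n, smallPart (ε * m) (h j)‖ then 1 else 0) +
        (if ∃ j < n, m < ‖h j‖ ∧ η * m < l j then 1 else 0)) +
      e * countLarge h n k (δ / 2 * m) + (k + 2) * C * countLarge h n (k + 1) (ε * m) := by
  set S := m⁻¹ • ∑ j ∈ Finset.range n, truncate m (h j) (l j) with hS
  set B := (Finset.range n).filter fun j => ε * m < ‖h j‖ with hB
  set T : ℕ → Vec d := fun j => ballRetract (m⁻¹ • h j) with hT
  have hT1 : ∀ j, ‖T j‖ ≤ 1 := fun j => norm_ballRetract_le_one _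
  have hC0 : 0 ≤ C := (abs_nonneg _).trans (hC 0)
  -- A `k`-subset containing a jump of size at most `ε m` has sum of norm at most `k - 1 + ε ≤ k - 1
  -- + δ`, where `f` vanishes.
  have hsum : ∑ J ∈ Finset.powersetCard k (Finset.range n), f (∑ j ∈ J, T j) =
      ∑ J ∈ Finset.powersetCard k B, f (∑ j ∈ J, T j) := by
    symm
    rw [hB, ← filter_powersetCard_eq]
    refine Finset.sum_filter_of_ne fun J hJ hne j hj => ?_
    by_contra hlt
    refine hne (hf0 _ ((norm_sum_le_of_mem (Finset.mem_powersetCard.1 hJ).2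
      (fun j _ => hT1 j) hj (norm_ballRetract_smul_inv_le hm (not_lt.1 hlt))).trans ?_))
    linarith
  rw [hsum]
  have hone : ∀ p : Prop, [Decidable p] → (0 : ℝ) ≤ if p then 1 else 0 := fun p _ => by
    split_ifs <;> norm_num
  have hn1 : (0 : ℝ) ≤ e * countLarge h n k (δ / 2 * m) := by positivity
  have hn2 : (0 : ℝ) ≤ (k + 2) * C * countLarge h n (k + 1) (ε * m) := by positivity
  have hsumle : |∑ J ∈ Finset.powersetCard k B, f (∑ j ∈ J, T j)| ≤ B.card.choose k * C := by
    refine (Finset.abs_sum_le_sum_abs _ _).trans ((Finset.sum_le_sum fun J _ => hC _).trans ?_)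
    rw [Finset.sum_const, Finset.card_powersetCard, nsmul_eq_mul]
  have hD := (abs_sub _ _ : |f S - ∑ J ∈ Finset.powersetCard k B, f (∑ j ∈ J, T j)| ≤ _)
  rcases lt_or_ge k B.card with hN | hN
  · have h1 : countLarge h n (k + 1) (ε * m) = B.card.choose (k + 1) := countLarge_eq_choose _ _ _ _
    have h2 : (B.card.choose k : ℝ) ≤ (k + 1) * B.card.choose (k + 1) := by
      exact_mod_cast choose_le_succ_mul_choose hN
    have h3 : (1 : ℝ) ≤ B.card.choose (k + 1) := by
      exact_mod_cast Nat.choose_pos hN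
    have h4 : (0 : ℝ) ≤ 2 * C * ((if η * m < ‖∑ j ∈ Finset.range n, smallPart (ε * m) (h j)‖
        then 1 else 0) + (if ∃ j < n, m < ‖h j‖ ∧ η * m < l j then 1 else 0)) :=
      mul_nonneg (by positivity) (add_nonneg (hone _) (hone _))
    have h5 : |f S - ∑ J ∈ Finset.powersetCard k B, f (∑ j ∈ J, T j)| ≤
        (k + 2) * C * countLarge h n (k + 1) (ε * m) := by
      rw [h1]
      have := hC S
      have h6 := mul_le_mul_of_nonneg_right h2 hC0
      have h7 := mul_le_mul_of_nonneg_right h3 hC0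
      linarith
    linarith
  have hcard : (B.card.choose k : ℝ) ≤ 1 := by
    have := Nat.choose_le_choose k hN
    rw [Nat.choose_self] at this
    exact_mod_cast this
  have hD2 : |f S - ∑ J ∈ Finset.powersetCard k B, f (∑ j ∈ J, T j)| ≤ 2 * C := by
    have := hC S
    have := mul_le_mul_of_nonneg_right hcard hC0
    linarith
  by_cases hbad1 : η * m < ‖∑ j ∈ Finset.range n, smallPart (ε * m) (h j)‖
  · rw [if_pos hbad1]
    have := mul_nonneg (mul_nonneg two_pos.le hC0) (hone (∃ j < n, m < ‖h j‖ ∧ η * m < l j))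
    linarith
  by_cases hbad2 : ∃ j < n, m < ‖h j‖ ∧ η * m < l j
  · rw [if_neg hbad1, if_pos hbad2]
    linarith
  rw [if_neg hbad1, if_neg hbad2, add_zero, mul_zero, zero_add]
  have hsplit : S = m⁻¹ • ∑ j ∈ Finset.range n, smallPart (ε * m) (h j) +
      ∑ j ∈ B, m⁻¹ • truncate m (h j) (l j) := by
    rw [hS, hB, ← Finset.smul_sum, ← smul_add, Finset.sum_filter, ← Finset.sum_add_distrib]
    congr 1
    refine Finset.sum_congr rfl fun j _ => ?_
    split_ifs with hj
    · rw [smallPart_of_lt hj, zero_add]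
    · rw [smallPart_of_le (not_lt.1 hj), add_zero, truncate, if_pos]
      exact (not_lt.1 hj).trans (by nlinarith)
  have hsmall : ‖m⁻¹ • ∑ j ∈ Finset.range n, smallPart (ε * m) (h j)‖ ≤ η := by
    rw [norm_smul, norm_inv, Real.norm_of_nonneg hm.le, inv_mul_le_iff₀ hm, mul_comm m η]
    exact not_lt.1 hbad1
  have hdist : ‖S - ∑ j ∈ B, T j‖ ≤ (B.card + 1) * η := by
    rw [hsplit, add_sub_assoc, ← Finset.sum_sub_distrib]
    refine (norm_add_le _ _).trans ?_
    have : ‖∑ j ∈ B, (m⁻¹ • truncate m (h j) (l j) - T j)‖ ≤ B.card * η := by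
      refine norm_sum_le_card fun j hj =>
        norm_smul_inv_truncate_sub_le hm (hl j) hη.le fun hj' => ?_
      by_contra hcon
      exact hbad2 ⟨j, by simpa using (Finset.mem_filter.1 hj).1, hj', not_le.1 hcon⟩
    linarith
  rcases hN.lt_or_eq with hN | hN
  · rw [Finset.powersetCard_eq_empty.2 hN, Finset.sum_empty, sub_zero, hf0, abs_zero]
    · positivity
    · have h1 : ‖∑ j ∈ B, T j‖ ≤ B.card * 1 := norm_sum_le_card fun j _ => hT1 j
      have h2 : (B.card : ℝ) ≤ k - 1 := by
        have : ((B.card + 1 : ℕ) : ℝ) ≤ k := by exact_mod_cast hN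
        push_cast at this
        linarith
      have h3 := norm_le_norm_add_norm_sub' S (∑ j ∈ B, T j)
      have h4 : ((B.card : ℝ) + 1) * η ≤ (k + 1) * η := by
        gcongr
      linarith
  · have hpk : Finset.powersetCard k B = {B} := by rw [← hN]; exact Finset.powersetCard_self B
    rw [hpk, Finset.sum_singleton]
    rw [hN] at hdist
    have h1 : ‖∑ j ∈ B, T j‖ ≤ k := by
      have : ‖∑ j ∈ B, T j‖ ≤ B.card * 1 := norm_sum_le_card fun j _ => hT1 j
      rwa [mul_one, hN] at this
    -- The modulus `e` is charged to jumps above `δ m / 2` rather than `ε m`. Its cost is then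
    -- independent of `ε`, which can only be chosen after `e`. If some jump in `B` is below `δ m /
    -- 2`, both values of `f` are zero.
    by_cases hall : ∀ j ∈ B, δ / 2 * m < ‖h j‖
    · have h2 : (1 : ℝ) ≤ countLarge h n k (δ / 2 * m) := by
        have : B ∈ (Finset.powersetCard k (Finset.range n)).filter
            fun J => ∀ j ∈ J, δ / 2 * m < ‖h j‖ :=
          Finset.mem_filter.2 ⟨Finset.mem_powersetCard.2 ⟨Finset.filter_subset _ _, hN⟩, hall⟩
        exact_mod_cast Finset.card_pos.2 ⟨B, this⟩
      have h3 := hf _ _ h1 hdist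
      nlinarith
    · push Not at hall
      obtain ⟨j, hj, hj'⟩ := hall
      have h2 : ‖∑ j ∈ B, T j‖ ≤ (k : ℝ) - 1 + δ / 2 :=
        norm_sum_le_of_mem hN (fun j _ => hT1 j) hj (norm_ballRetract_smul_inv_le hm hj')
      have h3 := norm_le_norm_add_norm_sub' S (∑ j ∈ B, T j)
      rw [hf0 S (by linarith), hf0 _ (by linarith), sub_self, abs_zero]
      positivity

end Comparison

/-! ### Expectation of the pathwise comparison -/

section Expectation

variable {Ω : Type*} [MeasurableSpace Ω] {P : Measure Ω} [IsProbabilityMeasure P] {d : ℕ}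
  {H : Ω → Vec d} {Hs : ℕ → Ω → Vec d} {L : Ω → ℝ} {Ls : ℕ → Ω → ℝ} {M : ℕ → ℝ} {α : ℝ}

omit [IsProbabilityMeasure P] in
theorem measureReal_forall_lt_norm (hHid : ∀ j, IdentDistrib (Hs j) H P P)
    (hHind : iIndepFun Hs P) (J : Finset ℕ) (c : ℝ) :
    P.real {ω | ∀ j ∈ J, c < ‖Hs j ω‖} = normTail P H c ^ J.card := by
  have h1 : {ω | ∀ j ∈ J, c < ‖Hs j ω‖} = ⋂ j ∈ J, Hs j ⁻¹' {y | c < ‖y‖} := by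
    ext ω
    simp
  have h2 := hHind.measure_inter_preimage_eq_mul J (sets := fun _ => {y | c < ‖y‖})
    (fun _ _ => measurableSet_lt_norm c)
  rw [h1, Measure.real, h2, ENNReal.toReal_prod, ← Finset.prod_const]
  refine Finset.prod_congr rfl fun j _ => ?_
  rw [(hHid j).measure_mem_eq (measurableSet_lt_norm c)]
  rfl

omit [MeasurableSpace Ω] in
theorem countLarge_eq_sum_indicator (n k : ℕ) (c : ℝ) (ω : Ω) :
    (countLarge (fun j => Hs j ω) n k c : ℝ) = ∑ J ∈ Finset.powersetCard k (Finset.range n),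
      Set.indicator {ω | ∀ j ∈ J, c < ‖Hs j ω‖} (fun _ => (1 : ℝ)) ω := by
  rw [countLarge, Finset.card_filter]
  push_cast
  refine Finset.sum_congr rfl fun J _ => ?_
  simp only [Set.indicator_apply, Set.mem_ofPred_eq]

theorem measurableSet_forall_lt_norm (hHs : ∀ j, Measurable (Hs j)) (J : Finset ℕ) (c : ℝ) :
    MeasurableSet {ω | ∀ j ∈ J, c < ‖Hs j ω‖} := by
  have h1 : {ω | ∀ j ∈ J, c < ‖Hs j ω‖} = ⋂ j ∈ J, Hs j ⁻¹' {y | c < ‖y‖} := by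
    ext ω
    simp
  rw [h1]
  exact J.measurableSet_biInter fun j _ => hHs j (measurableSet_lt_norm c)

theorem integrable_countLarge (hHs : ∀ j, Measurable (Hs j)) (n k : ℕ) (c : ℝ) :
    Integrable (fun ω => (countLarge (fun j => Hs j ω) n k c : ℝ)) P := by
  simp_rw [countLarge_eq_sum_indicator]
  exact integrable_finsetSum _ fun J _ => (integrable_const _).indicator
    (measurableSet_forall_lt_norm hHs J c)

theorem integral_countLarge_le (hHs : ∀ j, Measurable (Hs j))
    (hHid : ∀ j, IdentDistrib (Hs j) H P P) (hHind : iIndepFun Hs P) (n k : ℕ) (c : ℝ) :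
    ∫ ω, (countLarge (fun j => Hs j ω) n k c : ℝ) ∂P ≤ (n * normTail P H c) ^ k := by
  simp_rw [countLarge_eq_sum_indicator]
  rw [integral_finsetSum _ fun J _ => (integrable_const _).indicator
    (measurableSet_forall_lt_norm hHs J c)]
  have h1 : ∀ J ∈ Finset.powersetCard k (Finset.range n),
      ∫ ω, Set.indicator {ω | ∀ j ∈ J, c < ‖Hs j ω‖} (fun _ => (1 : ℝ)) ω ∂P =
        normTail P H c ^ k := by
    intro J hJ
    rw [integral_indicator_const _ (measurableSet_forall_lt_norm hHs J c), smul_eq_mul, mul_one,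
      measureReal_forall_lt_norm hHid hHind, (Finset.mem_powersetCard.1 hJ).2]
  rw [Finset.sum_congr rfl h1, Finset.sum_const, Finset.card_powersetCard, Finset.card_range,
    nsmul_eq_mul, mul_pow]
  have h2 : (n.choose k : ℝ) ≤ (n : ℝ) ^ k := by exact_mod_cast Nat.choose_le_pow n k
  have h3 : 0 ≤ normTail P H c := measureReal_nonneg
  gcongr

-- Union bound and independence of the two sequences: the excess has to be large at an index where
-- truncation occurs. This supplies the factor `n P(‖H‖ > M)` that makes a tail `o(P(‖H‖ >
-- x)^(k-1))` for `L` sufficient.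
omit [IsProbabilityMeasure P] in
theorem measureReal_exists_large_excess_le (hHid : ∀ j, IdentDistrib (Hs j) H P P)
    (hLid : ∀ j, IdentDistrib (Ls j) L P P)
    (hHL : IndepFun (fun ω j => Hs j ω) (fun ω j => Ls j ω) P) (n : ℕ) (m c : ℝ) :
    P.real {ω | ∃ j < n, m < ‖Hs j ω‖ ∧ c < Ls j ω} ≤
      n * normTail P H m * P.real {ω | c < L ω} := by
  have h1 : {ω | ∃ j < n, m < ‖Hs j ω‖ ∧ c < Ls j ω} =
      ⋃ j ∈ Finset.range n, (Hs j ⁻¹' {y | m < ‖y‖} ∩ Ls j ⁻¹' Set.Ioi c) := by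
    ext ω
    simp only [Set.mem_ofPred_eq, Set.mem_iUnion, Finset.mem_range, Set.mem_inter_iff,
      Set.mem_preimage, Set.mem_Ioi, exists_prop]
  rw [h1]
  refine (measureReal_biUnion_finset_le _ _).trans ?_
  have h2 : ∀ j ∈ Finset.range n, P.real (Hs j ⁻¹' {y | m < ‖y‖} ∩ Ls j ⁻¹' Set.Ioi c) =
      normTail P H m * P.real {ω | c < L ω} := by
    intro j _
    have h3 : IndepFun (Hs j) (Ls j) P :=
      hHL.comp (measurable_pi_apply j) (measurable_pi_apply j)
    rw [Measure.real, h3.measure_inter_preimage_eq_mul _ _ (measurableSet_lt_norm m)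
      measurableSet_Ioi, ENNReal.toReal_mul, (hHid j).measure_mem_eq (measurableSet_lt_norm m),
      (hLid j).measure_mem_eq measurableSet_Ioi]
    rfl
  rw [Finset.sum_congr rfl h2, Finset.sum_const, Finset.card_range, nsmul_eq_mul, mul_assoc]

/-- The law of the vector `H / m`, retracted radially to the unit ball. -/
def retractedLaw (P : Measure Ω) (H : Ω → Vec d) (m : ℝ) : Measure (Vec d) :=
  P.map fun ω => ballRetract (m⁻¹ • H ω)

theorem measurable_ballRetract : Measurable (ballRetract : Vec d → Vec d) :=
  continuous_ballRetract.measurable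

theorem isProbabilityMeasure_retractedLaw (hH : Measurable H) (m : ℝ) :
    IsProbabilityMeasure (retractedLaw P H m) :=
  Measure.isProbabilityMeasure_map
    (measurable_ballRetract.comp (by fun_prop)).aemeasurable

theorem integral_comp_sum_ballRetract (hHs : ∀ j, Measurable (Hs j))
    (hHid : ∀ j, IdentDistrib (Hs j) H P P) (hHind : iIndepFun Hs P) {f : Vec d → ℝ}
    (hf : Continuous f) (m : ℝ) {k : ℕ} {J : Finset ℕ} (hJ : J.card = k) :
    ∫ ω, f (∑ j ∈ J, ballRetract (m⁻¹ • Hs j ω)) ∂P =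
      ∫ x, f (∑ i, x i) ∂(Measure.pi fun _ : Fin k => retractedLaw P H m) := by
  have hφ : Measurable fun h : Vec d => ballRetract (m⁻¹ • h) :=
    measurable_ballRetract.comp (by fun_prop)
  let e : Fin k ≃ J := (J.orderIsoOfFin hJ).toEquiv
  let X : Fin k → Ω → Vec d := fun i ω => ballRetract (m⁻¹ • Hs (e i) ω)
  have hX : ∀ i, Measurable (X i) := fun i => hφ.comp (hHs _)
  have hind : iIndepFun X P :=
    (hHind.precomp (g := fun i => (e i : ℕ))
      (Subtype.val_injective.comp e.injective)).comp (fun _ h => ballRetract (m⁻¹ • h)) fun _ => hφ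
  have hlaw : P.map (fun ω i => X i ω) = Measure.pi fun _ : Fin k => retractedLaw P H m := by
    rw [(iIndepFun_iff_map_fun_eq_pi_map fun i => (hX i).aemeasurable).1 hind]
    congr 1
    ext1 i
    exact ((hHid (e i)).comp hφ).map_eq
  have hsum : ∀ ω, ∑ j ∈ J, ballRetract (m⁻¹ • Hs j ω) = ∑ i, X i ω := by
    intro ω
    rw [← Finset.sum_coe_sort J (fun j => ballRetract (m⁻¹ • Hs j ω))]
    exact (Equiv.sum_comp e fun j : J => ballRetract (m⁻¹ • Hs j ω)).symm
  simp_rw [hsum]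
  rw [← hlaw, integral_map (measurable_pi_lambda _ hX).aemeasurable]
  exact (hf.comp (continuous_finsetSum _ fun i _ => continuous_apply i)).aestronglyMeasurable

theorem integrable_comp_of_bounded {f : Vec d → ℝ} (hf : Continuous f) {C : ℝ}
    (hC : ∀ x, |f x| ≤ C) {Y : Ω → Vec d} (hY : Measurable Y) :
    Integrable (fun ω => f (Y ω)) P :=
  Integrable.of_bound (hf.measurable.comp hY).aestronglyMeasurable C
    (Eventually.of_forall fun _ => hC _)

theorem measurable_truncate (m : ℝ) {X : Ω → Vec d} (hX : Measurable X) {Y : Ω → ℝ}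
    (hY : Measurable Y) : Measurable fun ω => truncate m (X ω) (Y ω) := by
  unfold truncate
  exact Measurable.ite (measurableSet_le hX.norm measurable_const) hX (by fun_prop)

theorem measurable_rowSum (hHs : ∀ j, Measurable (Hs j)) (hLs : ∀ j, Measurable (Ls j)) (n : ℕ) :
    Measurable (rowSum M Hs Ls n) := by
  unfold rowSum
  exact Finset.measurable_fun_sum _ fun j _ => measurable_truncate _ (hHs j) (hLs j)

theorem abs_integral_rowSum_sub_le (hHs : ∀ j, Measurable (Hs j))
    (hHid : ∀ j, IdentDistrib (Hs j) H P P) (hHind : iIndepFun Hs P)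
    (hLs : ∀ j, Measurable (Ls j)) (hLs0 : ∀ j ω, 0 ≤ Ls j ω)
    (hLid : ∀ j, IdentDistrib (Ls j) L P P)
    (hHL : IndepFun (fun ω j => Hs j ω) (fun ω j => Ls j ω) P) (hMpos : ∀ n, 0 < M n)
    {f : Vec d → ℝ} (hfc : Continuous f) {C δ η ε e : ℝ} {k : ℕ} (hC : ∀ x, |f x| ≤ C)
    (hf0 : ∀ x, ‖x‖ ≤ (k : ℝ) - 1 + δ → f x = 0) (hδ : 0 < δ) (hη : 0 < η)
    (hηδ : (k + 1) * η ≤ δ / 2) (hε1 : ε ≤ 1) (hεδ : ε ≤ δ) (he : 0 ≤ e)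
    (hf : ∀ x y, ‖x‖ ≤ k → ‖y - x‖ ≤ (k + 1) * η → |f y - f x| ≤ e) (n : ℕ) :
    |∫ ω, f ((M n)⁻¹ • rowSum M Hs Ls n ω) ∂P - n.choose k *
      ∫ x, f (∑ i, x i) ∂(Measure.pi fun _ : Fin k => retractedLaw P H (M n))| ≤
      2 * C * (P.real {ω | η * M n < ‖∑ j ∈ Finset.range n, smallPart (ε * M n) (Hs j ω)‖} +
        n * normTail P H (M n) * P.real {ω | η * M n < L ω}) +
      e * (n * normTail P H (δ / 2 * M n)) ^ k +
      (k + 2) * C * (n * normTail P H (ε * M n)) ^ (k + 1) := by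
  have hC0 : 0 ≤ C := (abs_nonneg _).trans (hC 0)
  have hφ : Measurable fun h : Vec d => ballRetract ((M n)⁻¹ • h) :=
    measurable_ballRetract.comp (by fun_prop)
  have hi1 : Integrable (fun ω => f ((M n)⁻¹ • rowSum M Hs Ls n ω)) P :=
    integrable_comp_of_bounded hfc hC (by have := measurable_rowSum (M := M) hHs hLs n; fun_prop)
  have hi2 : ∀ J : Finset ℕ,
      Integrable (fun ω => f (∑ j ∈ J, ballRetract ((M n)⁻¹ • Hs j ω))) P := fun J =>
    integrable_comp_of_bounded hfc hC
      (Finset.measurable_fun_sum _ fun j _ => hφ.comp (hHs j))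
  have hsum : n.choose k *
      ∫ x, f (∑ i, x i) ∂(Measure.pi fun _ : Fin k => retractedLaw P H (M n)) =
      ∫ ω, ∑ J ∈ Finset.powersetCard k (Finset.range n),
        f (∑ j ∈ J, ballRetract ((M n)⁻¹ • Hs j ω)) ∂P := by
    rw [integral_finsetSum _ fun J _ => hi2 J, Finset.sum_congr rfl fun J hJ =>
      integral_comp_sum_ballRetract hHs hHid hHind hfc (M n) (Finset.mem_powersetCard.1 hJ).2,
      Finset.sum_const, Finset.card_powersetCard, Finset.card_range, nsmul_eq_mul]
  rw [hsum, ← integral_sub hi1 (integrable_finsetSum _ fun J _ => hi2 J)]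
  set E1 := {ω | η * M n < ‖∑ j ∈ Finset.range n, smallPart (ε * M n) (Hs j ω)‖} with hE1
  set E2 := {ω | ∃ j < n, M n < ‖Hs j ω‖ ∧ η * M n < Ls j ω} with hE2
  have hmE1 : MeasurableSet E1 := measurableSet_lt measurable_const
    (Finset.measurable_fun_sum _ fun j _ => (measurable_smallPart _).comp (hHs j)).norm
  have hmE2 : MeasurableSet E2 := by
    have : E2 = ⋃ j ∈ Finset.range n, ({ω | M n < ‖Hs j ω‖} ∩ {ω | η * M n < Ls j ω}) := by
      ext ω
      simp only [hE2, Set.mem_ofPred_eq, Set.mem_iUnion, Finset.mem_range, Set.mem_inter_iff,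
        exists_prop]
    rw [this]
    exact Finset.measurableSet_biUnion _ fun j _ =>
      (measurableSet_lt measurable_const (hHs j).norm).inter
        (measurableSet_lt measurable_const (hLs j))
  have hI1 : Integrable (Set.indicator E1 fun _ => (1 : ℝ)) P := (integrable_const _).indicator hmE1
  have hI2 : Integrable (Set.indicator E2 fun _ => (1 : ℝ)) P := (integrable_const _).indicator hmE2
  have hI12 : Integrable (fun ω => 2 * C * (Set.indicator E1 (fun _ => (1 : ℝ)) ω +
      Set.indicator E2 (fun _ => (1 : ℝ)) ω)) P := (hI1.add hI2).const_mul _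
  have hK1 : Integrable (fun ω => e * countLarge (fun j => Hs j ω) n k (δ / 2 * M n)) P :=
    (integrable_countLarge hHs n k _).const_mul e
  have hK2 : Integrable (fun ω => (k + 2) * C *
      countLarge (fun j => Hs j ω) n (k + 1) (ε * M n)) P :=
    (integrable_countLarge hHs n (k + 1) _).const_mul _
  have hIK : Integrable (fun ω => 2 * C * (Set.indicator E1 (fun _ => (1 : ℝ)) ω +
      Set.indicator E2 (fun _ => (1 : ℝ)) ω) +
      e * countLarge (fun j => Hs j ω) n k (δ / 2 * M n)) P := hI12.add hK1
  rw [← Real.norm_eq_abs]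
  refine (norm_integral_le_of_norm_le (hIK.add hK2) (Eventually.of_forall fun ω => ?_)).trans ?_
  · have := abs_sub_sum_powersetCard_le (hMpos n) (h := fun j => Hs j ω) (l := fun j => Ls j ω)
      (n := n) (fun j => hLs0 j ω) hC hf0 hδ hη hηδ hε1 hεδ he hf
    rw [Real.norm_eq_abs]
    refine this.trans (le_of_eq ?_)
    simp only [Pi.add_apply, Set.indicator_apply, hE1, hE2, Set.mem_ofPred_eq]
  · simp only [Pi.add_apply]
    rw [integral_add hIK hK2, integral_add hI12 hK1, integral_const_mul, integral_const_mul,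
      integral_const_mul, integral_add hI1 hI2, integral_indicator_const _ hmE1,
      integral_indicator_const _ hmE2, smul_eq_mul, mul_one, smul_eq_mul, mul_one]
    have h1 := measureReal_exists_large_excess_le hHid hLid hHL n (M n) (η * M n)
    have h2 := integral_countLarge_le hHs hHid hHind n k (δ / 2 * M n)
    have h3 := integral_countLarge_le hHs hHid hHind n (k + 1) (ε * M n)
    gcongr

end Expectation

/-! ### Weak convergence of products -/

section Product

variable {d k : ℕ}

theorem pi_const_smul (m : Measure (Vec d)) [SigmaFinite m] {c : ℝ≥0∞} (hc : c ≠ ∞) :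
    Measure.pi (fun _ : Fin k => c • m) = c ^ k • Measure.pi fun _ : Fin k => m := by
  lift c to NNReal using hc
  have : SigmaFinite ((c : ℝ≥0∞) • m) := SMul.sigmaFinite (μ := m) c
  refine Measure.pi_eq fun s _ => ?_
  simp [Measure.pi_pi, Finset.prod_mul_distrib]

/-- The measure with density `s` times a continuous cutoff that is `0` on the ball of radius `δ / 2`
and `1` outside the ball of radius `δ`. -/
def cutoffMeasure (m : Measure (Vec d)) (s δ : ℝ) : Measure (Vec d) :=
  m.withDensity fun x => ((Real.toNNReal (s * ramp (δ / 2) δ ‖x‖) : NNReal) : ℝ≥0∞)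

theorem measurable_cutoff (s δ : ℝ) :
    Measurable fun x : Vec d => Real.toNNReal (s * ramp (δ / 2) δ ‖x‖) := by
  have := (continuous_ramp (δ / 2) δ).measurable
  exact (measurable_const.mul (this.comp measurable_norm)).real_toNNReal

theorem integral_cutoffMeasure (m : Measure (Vec d)) {s δ : ℝ} (hs : 0 ≤ s) (g : Vec d → ℝ) :
    ∫ x, g x ∂(cutoffMeasure m s δ) = s * ∫ x, ramp (δ / 2) δ ‖x‖ * g x ∂m := by
  rw [cutoffMeasure, integral_withDensity_eq_integral_smul (measurable_cutoff s δ),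
    ← integral_const_mul]
  refine integral_congr_ae (Eventually.of_forall fun x => ?_)
  simp only [NNReal.smul_def, smul_eq_mul]
  rw [Real.coe_toNNReal _ (mul_nonneg hs (ramp_nonneg _ _ _)), mul_assoc]

theorem isFiniteMeasure_cutoffMeasure {m : Measure (Vec d)} (s : ℝ) {δ : ℝ} (hδ : 0 < δ)
    (hm : m {x | δ / 2 < ‖x‖} ≠ ∞) : IsFiniteMeasure (cutoffMeasure m s δ) := by
  refine isFiniteMeasure_withDensity (ne_of_lt ?_)
  have h1 : ∀ x : Vec d, ((Real.toNNReal (s * ramp (δ / 2) δ ‖x‖) : NNReal) : ℝ≥0∞) ≤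
      Set.indicator {x | δ / 2 < ‖x‖} (fun _ => ENNReal.ofReal |s|) x := by
    intro x
    by_cases hx : δ / 2 < ‖x‖
    · rw [Set.indicator_of_mem (by exact hx)]
      refine ENNReal.ofReal_le_ofReal ?_
      calc s * ramp (δ / 2) δ ‖x‖ ≤ |s| * ramp (δ / 2) δ ‖x‖ :=
            mul_le_mul_of_nonneg_right (le_abs_self s) (ramp_nonneg _ _ _)
        _ ≤ |s| * 1 := mul_le_mul_of_nonneg_left (ramp_le_one _ _ _) (abs_nonneg s)
        _ = |s| := mul_one _
    · rw [Set.indicator_of_notMem (by exact hx), ramp_eq_zero (half_lt_self hδ) (not_lt.1 hx)]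
      simp
  refine lt_of_le_of_lt (lintegral_mono h1) ?_
  rw [lintegral_indicator_const (measurableSet_lt_norm _)]
  exact ENNReal.mul_lt_top ENNReal.ofReal_lt_top hm.lt_top

theorem restrict_cutoffMeasure (m : Measure (Vec d)) (s : ℝ) {δ : ℝ} (hδ : 0 < δ) :
    (cutoffMeasure m s δ).restrict {x | δ < ‖x‖} =
      ENNReal.ofReal s • m.restrict {x | δ < ‖x‖} := by
  rw [cutoffMeasure, restrict_withDensity (measurableSet_lt_norm δ), ← withDensity_const]
  refine withDensity_congr_ae ?_
  filter_upwards [ae_restrict_mem (measurableSet_lt_norm δ)] with x hx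
  rw [ramp_eq_one (half_lt_self hδ) (le_of_lt hx), mul_one]
  rfl

theorem integral_pi_eq_integral_pi_restrict {m : Measure (Vec d)} [SigmaFinite m] {δ : ℝ}
    (hm : ∀ᵐ x ∂m, ‖x‖ ≤ 1) {f : Vec d → ℝ}
    (hf0 : ∀ x : Fin k → Vec d, (∀ i, ‖x i‖ ≤ 1) → (∃ i, ‖x i‖ ≤ δ) → f (∑ i, x i) = 0) :
    ∫ x, f (∑ i, x i) ∂(Measure.pi fun _ : Fin k => m) =
      ∫ x, f (∑ i, x i) ∂(Measure.pi fun _ : Fin k => m.restrict {x | δ < ‖x‖}) := by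
  rw [← Measure.restrict_pi_pi]
  symm
  refine setIntegral_eq_integral_of_ae_compl_eq_zero ?_
  have h1 : ∀ᵐ x ∂(Measure.pi fun _ : Fin k => m), ∀ i, ‖x i‖ ≤ 1 :=
    eventually_all.2 fun i =>
      (Measure.tendsto_eval_ae_ae (μ := fun _ : Fin k => m) (i := i)).eventually hm
  filter_upwards [h1] with x hx hx'
  simp only [Set.mem_pi, Set.mem_univ, Set.mem_ofPred_eq, true_implies, not_forall, not_lt] at hx'
  exact hf0 x hx hx'

/-- The integrand lives where every coordinate exceeds `δ`, and there the cutoff equals one. So the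
possibly infinite `ν` can be replaced by a finite measure, with a continuous density that preserves
weak convergence. -/
theorem integral_pi_cutoffMeasure {m : Measure (Vec d)} [SigmaFinite m] {s δ : ℝ} (hs : 0 ≤ s)
    (hδ : 0 < δ) (hfin : m {x | δ / 2 < ‖x‖} ≠ ∞)
    (hm : ∀ᵐ x ∂m, ‖x‖ ≤ 1) {f : Vec d → ℝ}
    (hf0 : ∀ x : Fin k → Vec d, (∀ i, ‖x i‖ ≤ 1) → (∃ i, ‖x i‖ ≤ δ) → f (∑ i, x i) = 0) :
    ∫ x, f (∑ i, x i) ∂(Measure.pi fun _ : Fin k => cutoffMeasure m s δ) =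
      s ^ k * ∫ x, f (∑ i, x i) ∂(Measure.pi fun _ : Fin k => m) := by
  have := isFiniteMeasure_cutoffMeasure s hδ hfin
  have hm' : ∀ᵐ x ∂(cutoffMeasure m s δ), ‖x‖ ≤ 1 :=
    (withDensity_absolutelyContinuous m _).ae_le hm
  rw [integral_pi_eq_integral_pi_restrict hm' hf0, integral_pi_eq_integral_pi_restrict hm hf0,
    restrict_cutoffMeasure m s hδ, pi_const_smul _ ENNReal.ofReal_ne_top, integral_smul_measure,
    ENNReal.toReal_pow, ENNReal.toReal_ofReal hs, smul_eq_mul]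

/-- Normalization reduces to probability measures, for which the product is weakly continuous; the
masses converge separately and contribute their `k`-th power. A nonzero limit is needed to
normalize. -/
theorem tendsto_integral_pi_of_tendsto_finiteMeasure {ρs : ℕ → FiniteMeasure (Vec d)}
    {ρ : FiniteMeasure (Vec d)} (hρ : ρ ≠ 0) (h : Tendsto ρs atTop (𝓝 ρ)) {f : Vec d → ℝ}
    (hf : Continuous f) {C : ℝ} (hC : ∀ x, |f x| ≤ C) :
    Tendsto (fun n => ∫ x, f (∑ i, x i) ∂(Measure.pi fun _ : Fin k => (ρs n : Measure (Vec d))))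
      atTop (𝓝 (∫ x, f (∑ i, x i) ∂(Measure.pi fun _ : Fin k => (ρ : Measure (Vec d))))) := by
  have : Nonempty (Vec d) := ⟨0⟩
  have key : ∀ τ : FiniteMeasure (Vec d),
      ∫ x, f (∑ i, x i) ∂(Measure.pi fun _ : Fin k => (τ : Measure (Vec d))) =
        (τ.mass : ℝ) ^ k * ∫ x, f (∑ i, x i)
          ∂(ProbabilityMeasure.pi fun _ : Fin k => τ.normalize : Measure (Fin k → Vec d)) := by
    intro τ
    have h1 : (τ : Measure (Vec d)) =
        (τ.mass : ℝ≥0∞) • (τ.normalize : Measure (Vec d)) := by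
      conv_lhs => rw [τ.self_eq_mass_smul_normalize]
      rfl
    conv_lhs => rw [h1, pi_const_smul _ ENNReal.coe_ne_top, integral_smul_measure,
      ENNReal.toReal_pow, ENNReal.coe_toReal, smul_eq_mul]
    rfl
  simp_rw [key]
  have hmass : Tendsto (fun n => ((ρs n).mass : ℝ)) atTop (𝓝 (ρ.mass : ℝ)) :=
    (NNReal.continuous_coe.tendsto _).comp ((FiniteMeasure.continuous_mass.tendsto _).comp h)
  have hprob := FiniteMeasure.tendsto_normalize_of_tendsto h hρ
  have hpi : Tendsto (fun n => ProbabilityMeasure.pi fun _ : Fin k => (ρs n).normalize) atTop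
      (𝓝 (ProbabilityMeasure.pi fun _ : Fin k => ρ.normalize)) :=
    (ProbabilityMeasure.continuous_pi.tendsto _).comp (tendsto_pi_nhds.2 fun _ => hprob)
  let F : BoundedContinuousFunction (Fin k → Vec d) ℝ :=
    BoundedContinuousFunction.ofNormedAddCommGroup (fun x => f (∑ i, x i))
      (hf.comp (continuous_finsetSum _ fun i _ => continuous_apply i)) C fun x => hC _
  exact (hmass.pow k).mul (ProbabilityMeasure.tendsto_iff_forall_integral_tendsto.1 hpi F)

theorem tendsto_integral_pi_sum_div {m : ℕ → Measure (Vec d)} [∀ n, IsProbabilityMeasure (m n)]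
    {ν : Measure (Vec d)} [SigmaFinite ν] {t : ℕ → ℝ} (ht : ∀ n, 0 < t n) {δ : ℝ} (hδ : 0 < δ)
    (hm : ∀ n, ∀ᵐ x ∂(m n), ‖x‖ ≤ 1) (hν : ∀ᵐ x ∂ν, ‖x‖ ≤ 1) (hνfin : ν {x | δ / 2 < ‖x‖} ≠ ∞)
    (hνpos : ν {x | δ < ‖x‖} ≠ 0)
    (hconv : ∀ g : Vec d → ℝ, Continuous g → (∀ x, ‖x‖ ≤ δ / 2 → g x = 0) →
      Tendsto (fun n => (∫ x, g x ∂(m n)) / t n) atTop (𝓝 (∫ x, g x ∂ν)))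
    {f : Vec d → ℝ} (hf : Continuous f) {C : ℝ} (hC : ∀ x, |f x| ≤ C)
    (hf0 : ∀ x : Fin k → Vec d, (∀ i, ‖x i‖ ≤ 1) → (∃ i, ‖x i‖ ≤ δ) → f (∑ i, x i) = 0) :
    Tendsto (fun n => (∫ x, f (∑ i, x i) ∂(Measure.pi fun _ : Fin k => m n)) / t n ^ k) atTop
      (𝓝 (∫ x, f (∑ i, x i) ∂(Measure.pi fun _ : Fin k => ν))) := by
  have hfin := isFiniteMeasure_cutoffMeasure 1 hδ hνfin
  have hfins : ∀ n, IsFiniteMeasure (cutoffMeasure (m n) (t n)⁻¹ δ) := fun n =>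
    isFiniteMeasure_cutoffMeasure _ hδ (measure_ne_top _ _)
  let ρ : FiniteMeasure (Vec d) := ⟨cutoffMeasure ν 1 δ, hfin⟩
  let ρs : ℕ → FiniteMeasure (Vec d) := fun n => ⟨cutoffMeasure (m n) (t n)⁻¹ δ, hfins n⟩
  have hρ : ρ ≠ 0 := by
    intro h0
    have h1 : cutoffMeasure ν 1 δ = 0 := congrArg (fun τ : FiniteMeasure (Vec d) => τ.1) h0
    have h2 := restrict_cutoffMeasure ν 1 hδ
    rw [h1, Measure.restrict_zero, ENNReal.ofReal_one, one_smul] at h2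
    exact hνpos (Measure.restrict_eq_zero.1 h2.symm)
  have hlim : Tendsto ρs atTop (𝓝 ρ) := by
    rw [FiniteMeasure.tendsto_iff_forall_integral_tendsto]
    intro g
    have h1 := hconv (fun x => ramp (δ / 2) δ ‖x‖ * g x)
      (((continuous_ramp _ _).comp continuous_norm).mul g.continuous)
      (fun x hx => by rw [ramp_eq_zero (half_lt_self hδ) hx, zero_mul])
    have h2 : ∫ x, g x ∂(ρ : Measure (Vec d)) = ∫ x, ramp (δ / 2) δ ‖x‖ * g x ∂ν := by
      rw [show (ρ : Measure (Vec d)) = cutoffMeasure ν 1 δ from rfl,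
        integral_cutoffMeasure ν zero_le_one, one_mul]
    rw [h2]
    refine h1.congr fun n => ?_
    rw [show (ρs n : Measure (Vec d)) = cutoffMeasure (m n) (t n)⁻¹ δ from rfl,
      integral_cutoffMeasure _ (inv_pos.2 (ht n)).le, div_eq_inv_mul]
  have h3 := tendsto_integral_pi_of_tendsto_finiteMeasure (k := k) hρ hlim hf hC
  have h4 : ∫ x, f (∑ i, x i) ∂(Measure.pi fun _ : Fin k => (ρ : Measure (Vec d))) =
      ∫ x, f (∑ i, x i) ∂(Measure.pi fun _ : Fin k => ν) := by
    rw [show (ρ : Measure (Vec d)) = cutoffMeasure ν 1 δ from rfl,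
      integral_pi_cutoffMeasure zero_le_one hδ hνfin hν hf0, one_pow, one_mul]
  rw [h4] at h3
  refine h3.congr fun n => ?_
  rw [show (ρs n : Measure (Vec d)) = cutoffMeasure (m n) (t n)⁻¹ δ from rfl,
    integral_pi_cutoffMeasure (inv_pos.2 (ht n)).le hδ (measure_ne_top _ _) (hm n) hf0, inv_pow,
    div_eq_inv_mul]

end Product

/-! ### The limit measures -/

section LimitMeasures

variable {d k : ℕ} {μ : Measure (Vec d)} {κ α : ℝ}

theorem norm_sum_le_of_norm_le_of_forall_le_one {x : Fin k → Vec d} (hx : ∀ i, ‖x i‖ ≤ 1)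
    {δ : ℝ} {i : Fin k} (hi : ‖x i‖ ≤ δ) : ‖∑ j, x j‖ ≤ (k : ℝ) - 1 + δ := by
  have h1 : ‖∑ j, x j‖ ≤ ∑ j, ‖x j‖ := norm_sum_le _ _
  have h2 : ∑ j ∈ Finset.univ.erase i, ‖x j‖ ≤ (k : ℝ) - 1 := by
    have h3 := Finset.sum_le_card_nsmul (Finset.univ.erase i) (fun j => ‖x j‖) 1 fun j _ => hx j
    rw [Finset.card_erase_of_mem (Finset.mem_univ i), Finset.card_univ, Fintype.card_fin,
      nsmul_eq_mul, mul_one, Nat.cast_sub (Nat.one_le_of_lt i.2), Nat.cast_one] at h3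
    exact h3
  rw [← Finset.add_sum_erase _ (fun j => ‖x j‖) (Finset.mem_univ i)] at h1
  linarith

/-- The tail of `μ` is continuous at one. This matters because the two pieces of `nu` both involve
the unit sphere, which must not be counted twice. -/
theorem measure_sphere_eq_zero (hfin : ∀ x : ℝ, 0 < x → μ {y | x < ‖y‖} ≠ ∞)
    (hG : ∀ x, 0 < x → μ.real {y | x < ‖y‖} = κ * x ^ (-α)) : μ {x | ‖x‖ = 1} = 0 := by
  have hcont : ContinuousAt (fun y : ℝ => κ * y ^ (-α)) 1 :=
    (Real.continuousAt_rpow_const _ (-α) (Or.inl one_ne_zero)).const_mul κ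
  have hlim : Tendsto (fun y : ℝ => κ * y ^ (-α) - κ * 1 ^ (-α)) (𝓝[<] 1) (𝓝 0) := by
    have := (hcont.tendsto.mono_left (nhdsWithin_le_nhds : 𝓝[<] (1 : ℝ) ≤ 𝓝 1)).sub_const
      (κ * (1 : ℝ) ^ (-α))
    rwa [sub_self] at this
  have hpos : ∀ᶠ y in 𝓝[<] (1 : ℝ), 0 < y := nhdsWithin_le_nhds (lt_mem_nhds one_pos)
  have hle : ∀ᶠ y in 𝓝[<] (1 : ℝ), μ.real {x | ‖x‖ = 1} ≤ κ * y ^ (-α) - κ * 1 ^ (-α) := by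
    filter_upwards [hpos, self_mem_nhdsWithin] with y hy hy1
    have hy1' : y < 1 := hy1
    have hsub : ({x | 1 < ‖x‖} : Set (Vec d)) ⊆ {x | y < ‖x‖} := fun x hx => hy1'.trans hx
    rw [← hG y hy, ← hG 1 one_pos, ← measureReal_sdiff hsub (measurableSet_lt_norm 1) (hfin y hy)]
    refine measureReal_mono (fun x hx => ?_)
      (ne_top_of_le_ne_top (hfin y hy) (measure_mono Set.sdiff_subset))
    simp only [Set.mem_ofPred_eq] at hx
    exact ⟨by simp only [Set.mem_ofPred_eq, hx]; exact hy1', by simp [hx]⟩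
  have h0 : μ.real {x | ‖x‖ = 1} = 0 :=
    le_antisymm (ge_of_tendsto hlim hle) measureReal_nonneg
  refine (measureReal_eq_zero_iff (ne_top_of_le_ne_top (hfin (1 / 2) (by norm_num))
    (measure_mono fun x hx => ?_))).1 h0
  simp only [Set.mem_ofPred_eq] at hx ⊢
  rw [hx]
  norm_num

/-- The retraction is the identity on the unit ball and radial projection outside it. Its image
measure therefore splits into the two pieces of `nu`. -/
theorem nu_eq_smul_map (h1 : μ {x | ‖x‖ = 1} = 0) :
    nu μ = (μ (Metric.closedBall 0 1)ᶜ)⁻¹ • μ.map ballRetract := by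
  have hmT := measurable_ballRetract (d := d)
  have hball : MeasurableSet (Metric.closedBall (0 : Vec d) 1) :=
    Metric.isClosed_closedBall.measurableSet
  have hin : (μ.restrict (Metric.closedBall 0 1)).map ballRetract =
      μ.restrict (Metric.closedBall 0 1) := by
    rw [Measure.map_congr (g := id), Measure.map_id]
    filter_upwards [ae_restrict_mem hball] with x hx
    rw [mem_closedBall_zero_iff] at hx
    rw [ballRetract, max_eq_left hx, inv_one, one_smul, id]
  have hset : ({x | 1 ≤ ‖x‖} : Set (Vec d)) =ᵐ[μ] (Metric.closedBall (0 : Vec d) 1)ᶜ := by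
    have : ∀ᵐ x ∂μ, ‖x‖ ≠ 1 := by
      rw [ae_iff]
      simpa using h1
    filter_upwards [this] with x hx
    apply propext
    change 1 ≤ ‖x‖ ↔ ¬ x ∈ Metric.closedBall (0 : Vec d) 1
    rw [mem_closedBall_zero_iff, not_le]
    exact ⟨fun h => lt_of_le_of_ne h hx.symm, le_of_lt⟩
  have hout : (μ.restrict (Metric.closedBall 0 1)ᶜ).map ballRetract =
      (μ.restrict {x | 1 ≤ ‖x‖}).map (fun x => (‖x‖)⁻¹ • x) := by
    rw [Measure.restrict_congr_set hset]
    refine Measure.map_congr ?_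
    filter_upwards [ae_restrict_mem hball.compl] with x hx
    rw [Set.mem_compl_iff, mem_closedBall_zero_iff, not_le] at hx
    rw [ballRetract, max_eq_right hx.le]
  have hsphere : (spectralMeasure μ).restrict (Metric.sphere 0 1) = spectralMeasure μ := by
    rw [spectralMeasure, Measure.restrict_smul]
    congr 1
    refine Measure.restrict_eq_self_of_ae_mem ?_
    refine (ae_map_iff (p := fun x => x ∈ Metric.sphere (0 : Vec d) 1)
      (Measurable.aemeasurable (by fun_prop)) Metric.isClosed_sphere.measurableSet).2 ?_
    filter_upwards [ae_restrict_mem (measurableSet_le measurable_const measurable_norm)] with x hx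
    have hx' : 0 < ‖x‖ := lt_of_lt_of_le one_pos hx
    rw [mem_sphere_zero_iff_norm, norm_smul, norm_inv, norm_norm, inv_mul_cancel₀ hx'.ne']
  rw [nu, hsphere, spectralMeasure, ← hout, ← smul_add]
  nth_rw 1 [← hin]
  rw [← Measure.map_add _ _ hmT, Measure.restrict_add_restrict_compl hball]

theorem sigmaFinite_of_measure_lt_norm_lt_top {m : Measure (Vec d)} (h0 : m {0} ≠ ∞)
    (h : ∀ x : ℝ, 0 < x → m {y | x < ‖y‖} ≠ ∞) : SigmaFinite m := by
  refine Measure.sigmaFinite_of_countable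
    (S := insert {0} (Set.range fun n : ℕ => {y : Vec d | 1 / ((n : ℝ) + 1) < ‖y‖}))
    ((Set.countable_range _).insert _) ?_ ?_
  · rintro s (rfl | ⟨n, rfl⟩)
    · exact h0.lt_top
    · exact (h _ Nat.one_div_pos_of_nat).lt_top
  · rw [Set.sUnion_insert, Set.sUnion_range, Set.eq_univ_iff_forall]
    intro y
    rcases eq_or_ne y 0 with rfl | hy
    · exact Or.inl rfl
    · obtain ⟨n, hn⟩ := exists_nat_one_div_lt (norm_pos_iff.2 hy)
      exact Or.inr (Set.mem_iUnion.2 ⟨n, hn⟩)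


theorem nu_eq_ofReal_smul_map (hκ : 0 < κ) (hfin : ∀ x : ℝ, 0 < x → μ {y | x < ‖y‖} ≠ ∞)
    (hG : ∀ x, 0 < x → μ.real {y | x < ‖y‖} = κ * x ^ (-α)) :
    nu μ = ENNReal.ofReal κ⁻¹ • μ.map ballRetract := by
  rw [nu_eq_smul_map (measure_sphere_eq_zero hfin hG)]
  have hset : (Metric.closedBall (0 : Vec d) 1)ᶜ = {y | 1 < ‖y‖} := by
    ext y
    rw [Set.mem_compl_iff, mem_closedBall_zero_iff, not_le, Set.mem_ofPred_eq]
  have h1 := hG 1 one_pos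
  rw [Real.one_rpow, mul_one] at h1
  rw [hset, ← ENNReal.ofReal_toReal (hfin 1 one_pos), ENNReal.ofReal_inv_of_pos hκ]
  rw [measureReal_def] at h1
  rw [h1]

section

variable (hκ : 0 < κ) (hfin : ∀ x : ℝ, 0 < x → μ {y | x < ‖y‖} ≠ ∞)
  (hG : ∀ x, 0 < x → μ.real {y | x < ‖y‖} = κ * x ^ (-α))

include hκ hfin hG

theorem integral_nu {g : Vec d → ℝ} (hg : Continuous g) :
    ∫ x, g x ∂(nu μ) = κ⁻¹ * ∫ x, g (ballRetract x) ∂μ := by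
  rw [nu_eq_ofReal_smul_map hκ hfin hG, integral_smul_measure,
    integral_map measurable_ballRetract.aemeasurable hg.aestronglyMeasurable,
    ENNReal.toReal_ofReal (inv_pos.2 hκ).le, smul_eq_mul]

theorem ae_nu_norm_le_one : ∀ᵐ x ∂(nu μ), ‖x‖ ≤ 1 := by
  rw [nu_eq_ofReal_smul_map hκ hfin hG]
  refine Measure.ae_smul_measure ?_ _
  refine (ae_map_iff (p := fun x : Vec d => ‖x‖ ≤ 1) measurable_ballRetract.aemeasurable
    (measurableSet_le measurable_norm measurable_const)).2 ?_
  exact Eventually.of_forall norm_ballRetract_le_one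

theorem nu_setOf_lt_norm {s : ℝ} (hs : 0 < s) (hs1 : s < 1) :
    nu μ {x | s < ‖x‖} = ENNReal.ofReal (s ^ (-α)) := by
  have hpre : ballRetract ⁻¹' {x : Vec d | s < ‖x‖} = {x | s < ‖x‖} := by
    ext x
    simp only [Set.mem_preimage, Set.mem_ofPred_eq, norm_ballRetract, lt_min_iff, hs1, and_true]
  rw [nu_eq_ofReal_smul_map hκ hfin hG, Measure.smul_apply,
    Measure.map_apply measurable_ballRetract (measurableSet_lt_norm s), hpre, smul_eq_mul,
    ← ENNReal.ofReal_toReal (hfin s hs), ← measureReal_def, hG s hs,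
    ← ENNReal.ofReal_mul (inv_pos.2 hκ).le, inv_mul_cancel_left₀ hκ.ne']

theorem nu_setOf_lt_norm_ne_top {s : ℝ} (hs : 0 < s) : nu μ {x | s < ‖x‖} ≠ ∞ := by
  have hm : 0 < min s (1 / 2) := lt_min hs (by norm_num)
  refine ne_top_of_le_ne_top ?_
    (measure_mono fun x (hx : s < ‖x‖) => (min_le_left s (1 / 2)).trans_lt hx)
  change nu μ {x | min s (1 / 2) < ‖x‖} ≠ ∞
  rw [nu_setOf_lt_norm hκ hfin hG hm ((min_le_right _ _).trans_lt (by norm_num))]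
  exact ENNReal.ofReal_ne_top

theorem nu_setOf_lt_norm_ne_zero {s : ℝ} (hs : 0 < s) (hs1 : s < 1) :
    nu μ {x | s < ‖x‖} ≠ 0 := by
  rw [nu_setOf_lt_norm hκ hfin hG hs hs1]
  exact (ENNReal.ofReal_pos.2 (Real.rpow_pos_of_pos hs _)).ne'

theorem sigmaFinite_nu (hμ0 : μ {0} = 0) : SigmaFinite (nu μ) := by
  refine sigmaFinite_of_measure_lt_norm_lt_top ?_
    fun x hx => nu_setOf_lt_norm_ne_top hκ hfin hG hx
  have hpre : ballRetract ⁻¹' {(0 : Vec d)} = {0} := by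
    ext x
    simp only [Set.mem_preimage, Set.mem_singleton_iff]
    rw [← norm_eq_zero, norm_ballRetract, ← norm_eq_zero (a := x)]
    rcases le_total ‖x‖ 1 with h | h
    · rw [min_eq_left h]
    · rw [min_eq_right h]
      exact ⟨fun h => absurd h one_ne_zero, fun h0 => absurd h (by rw [h0]; norm_num)⟩
  rw [nu_eq_ofReal_smul_map hκ hfin hG, Measure.smul_apply,
    Measure.map_apply measurable_ballRetract (measurableSet_singleton 0), hpre, hμ0, smul_zero]
  exact ENNReal.zero_ne_top

/-- As `ν` is carried by the unit ball, a sum of norm above `k - 1 + δ` forces every summand above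
`δ`, and the corresponding box has finite product mass. -/
theorem nuConv_setOf_lt_norm_ne_top (hμ0 : μ {0} = 0) {δ : ℝ} (hδ : 0 < δ) :
    nuConv μ k {x | (k : ℝ) - 1 + δ < ‖x‖} ≠ ∞ := by
  have := sigmaFinite_nu hκ hfin hG hμ0
  rw [nuConv, Measure.map_apply (by fun_prop) (measurableSet_lt_norm _)]
  have hbox : (Measure.pi fun _ : Fin k => nu μ) (Set.univ.pi fun _ => {x | δ < ‖x‖}) ≠ ∞ := by
    rw [Measure.pi_pi]
    exact ENNReal.prod_ne_top fun _ _ => nu_setOf_lt_norm_ne_top hκ hfin hG hδ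
  refine ne_top_of_le_ne_top hbox (measure_mono_ae ?_)
  have hall : ∀ᵐ x ∂(Measure.pi fun _ : Fin k => nu μ), ∀ i, ‖x i‖ ≤ 1 :=
    ae_all_iff.2 fun i => (Measure.tendsto_eval_ae_ae (μ := fun _ : Fin k => nu μ)
      (i := i)).eventually (ae_nu_norm_le_one hκ hfin hG)
  filter_upwards [hall] with x hx
  intro (h : (k : ℝ) - 1 + δ < ‖∑ j, x j‖) i _
  change δ < ‖x i‖
  by_contra hi
  exact h.not_ge (norm_sum_le_of_norm_le_of_forall_le_one hx (not_lt.1 hi))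

/-- Some point `x` of norm above `r / k` has `ν`-mass in each of its neighbourhoods, and `k` vectors
close to the same `x` do not cancel: their sum is close to `k x`. -/
theorem nuConv_setOf_lt_norm_ne_zero (hμ0 : μ {0} = 0) (hk : 1 ≤ k) {r : ℝ} (hr : 0 ≤ r)
    (hrk : r < k) : nuConv μ k {x | r < ‖x‖} ≠ 0 := by
  have := sigmaFinite_nu hκ hfin hG hμ0
  have hk0 : (0 : ℝ) < k := by exact_mod_cast hk
  have hq0 : 0 ≤ r / k := by positivity
  have hq1 : r / k < 1 := (div_lt_one hk0).2 hrk
  -- The level `s` is halfway between `r / k` and `1`, and `ρ` is half the gap to `r / k`, so that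
  -- `k (s - ρ) > r`.
  set s : ℝ := (r / k + 1) / 2 with hs
  set ρ : ℝ := (s - r / k) / 2 with hρ
  have hρ0 : 0 < ρ := by linarith
  obtain ⟨x, hxs, hx⟩ := exists_mem_forall_mem_nhdsWithin_pos_measure
    (nu_setOf_lt_norm_ne_zero hκ hfin hG (s := s) (by linarith) (by linarith))
  have hpos := hx ({y | s < ‖y‖} ∩ Metric.ball x ρ)
    (inter_mem self_mem_nhdsWithin (mem_nhdsWithin_of_mem_nhds (Metric.ball_mem_nhds x hρ0)))
  rw [nuConv, Measure.map_apply (by fun_prop) (measurableSet_lt_norm _)]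
  have hbox : (Measure.pi fun _ : Fin k => nu μ)
      (Set.univ.pi fun _ => {y | s < ‖y‖} ∩ Metric.ball x ρ) ≠ 0 := by
    rw [Measure.pi_pi]
    exact Finset.prod_ne_zero_iff.2 fun _ _ => hpos.ne'
  refine fun h0 => hbox (measure_mono_null (fun y hy => ?_) h0)
  change r < ‖∑ j, y j‖
  have hxs' : s < ‖x‖ := hxs
  have h1 : ‖∑ j, (y j - x)‖ ≤ k * ρ := by
    refine (norm_sum_le _ _).trans ?_
    have h2 := Finset.sum_le_card_nsmul Finset.univ (fun j => ‖y j - x‖) ρ fun j _ =>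
      (mem_ball_iff_norm.1 (hy j trivial).2).le
    rwa [Finset.card_univ, Fintype.card_fin, nsmul_eq_mul] at h2
  rw [Finset.sum_sub_distrib, Finset.sum_const, Finset.card_univ, Fintype.card_fin,
    norm_sub_rev] at h1
  have h2 := norm_sub_norm_le (k • x) (∑ j, y j)
  rw [RCLike.norm_nsmul ℝ, nsmul_eq_mul] at h2
  have h3 : (k : ℝ) * s ≤ k * ‖x‖ := by gcongr
  have h4 : r < k * (s - ρ) := by
    rw [← div_lt_iff₀' hk0]
    linarith
  linarith

theorem countable_nuConv_sphere_ne_zero (hμ0 : μ {0} = 0) :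
    {r : ℝ | nuConv μ k {x | ‖x‖ = r} ≠ 0}.Countable := by
  have := sigmaFinite_nu hκ hfin hG hμ0
  have : SFinite (nuConv μ k) := by rw [nuConv]; infer_instance
  refine (Measure.countable_meas_level_set_pos (μ := nuConv μ k) (g := fun x => ‖x‖)
    measurable_norm).mono ?_
  exact fun r hr => pos_iff_ne_zero.2 hr

end

theorem integral_nuConv {f : Vec d → ℝ} (hf : Continuous f) :
    ∫ x, f x ∂(nuConv μ k) = ∫ x, f (∑ i, x i) ∂(Measure.pi fun _ : Fin k => nu μ) := by
  rw [nuConv, integral_map (Measurable.aemeasurable (by fun_prop)) hf.aestronglyMeasurable]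

end LimitMeasures

/-! ### Convergence of the integrals with respect to the normalized sum -/

section Main

variable {Ω : Type*} [MeasurableSpace Ω] {P : Measure Ω} [IsProbabilityMeasure P] {d : ℕ}
  {H : Ω → Vec d} {L : Ω → ℝ} {Hs : ℕ → Ω → Vec d} {Ls : ℕ → Ω → ℝ} {M : ℕ → ℝ} {α : ℝ} {k : ℕ}

theorem exists_forall_abs_sub_le {f : Vec d → ℝ} (hf : Continuous f) {e c b : ℝ} (he : 0 < e)
    (hc : 0 < c) (hb : 0 < b) : ∃ η, 0 < η ∧ b * η ≤ c ∧
      ∀ x y, ‖x‖ ≤ k → ‖y - x‖ ≤ b * η → |f y - f x| ≤ e := by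
  have h := (isCompact_closedBall (0 : Vec d) k).uniformContinuousAt_of_continuousAt f
    (fun a _ => hf.continuousAt) (Metric.dist_mem_uniformity he)
  obtain ⟨ρ, hρ, hρf⟩ := Metric.mem_uniformity_dist.1 h
  refine ⟨min c (ρ / 2) / b, by positivity, ?_, fun x y hx hy => ?_⟩
  · rw [mul_div_cancel₀ _ hb.ne']
    exact min_le_left _ _
  · rw [mul_div_cancel₀ _ hb.ne'] at hy
    have h1 : dist x y < ρ := by
      rw [dist_eq_norm_sub']
      exact (hy.trans (min_le_right _ _)).trans_lt (half_lt_self hρ)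
    have h2 : dist (f x) (f y) < e := hρf h1 (mem_closedBall_zero_iff.2 hx)
    rw [dist_comm, Real.dist_eq] at h2
    exact h2.le

omit [IsProbabilityMeasure P] in
theorem isBigO_normTail_mul (hα : IsTailIndex P H α) (hpos : ∀ x, 0 < normTail P H x)
    (hM : Tendsto M atTop atTop) {c : ℝ} (hc : 0 < c) :
    (fun n => normTail P H (c * M n)) =O[atTop] fun n => normTail P H (M n) :=
  isBigO_of_div_tendsto_nhds (Eventually.of_forall fun _ h0 => absurd h0 (hpos _).ne') _
    ((hα.2 c hc).comp hM)

omit [IsProbabilityMeasure P] in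
theorem isLittleO_remainder (hα : IsTailIndex P H α) (hpos : ∀ x, 0 < normTail P H x)
    (hM : Tendsto M atTop atTop)
    (hsoft : Tendsto (fun n : ℕ => n * normTail P H (M n)) atTop (𝓝 0)) (hk : 1 ≤ k)
    (hLtail : (fun x : ℝ => P.real {ω | x < L ω}) =o[atTop]
      (fun x : ℝ => normTail P H x ^ (k - 1))) {s : ℕ → ℝ}
    (hs : s =o[atTop] fun n : ℕ => (n * normTail P H (M n)) ^ k) {η ε A B : ℝ}
    (hη : 0 < η) (hε : 0 < ε) :
    (fun n : ℕ => A * (s n + n * normTail P H (M n) * P.real {ω | η * M n < L ω}) +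
      B * (n * normTail P H (ε * M n)) ^ (k + 1)) =o[atTop]
      fun n : ℕ => (n * normTail P H (M n)) ^ k := by
  have h1 : (fun n => P.real {ω | η * M n < L ω}) =o[atTop]
      fun n : ℕ => (n * normTail P H (M n)) ^ (k - 1) := by
    refine ((hLtail.comp_tendsto (hM.const_mul_atTop hη)).trans_isBigO
      ((isBigO_normTail_mul hα hpos hM hη).pow (k - 1))).trans_isBigO (IsBigO.pow ?_ _)
    refine IsBigO.of_bound 1 ?_
    filter_upwards [eventually_ge_atTop 1] with n hn
    have hn' : (1 : ℝ) ≤ n := by exact_mod_cast hn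
    rw [one_mul, norm_mul, RCLike.norm_natCast]
    exact le_mul_of_one_le_left (norm_nonneg _) hn'
  have h2 : (fun n : ℕ => n * normTail P H (M n) * P.real {ω | η * M n < L ω}) =o[atTop]
      fun n : ℕ => (n * normTail P H (M n)) ^ k := by
    refine ((isBigO_refl (fun n : ℕ => n * normTail P H (M n)) atTop).mul_isLittleO h1).congr_right
      fun n => ?_
    rw [← pow_succ', Nat.sub_add_cancel hk]
  have h3 : (fun n : ℕ => (n * normTail P H (ε * M n)) ^ (k + 1)) =o[atTop]
      fun n : ℕ => (n * normTail P H (M n)) ^ k := by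
    refine (((isBigO_refl (fun n : ℕ => (n : ℝ)) atTop).mul
      (isBigO_normTail_mul hα hpos hM hε)).pow (k + 1)).trans_isLittleO ?_
    refine ((isBigO_refl (fun n : ℕ => (n * normTail P H (M n)) ^ k) atTop).mul_isLittleO
      ((isLittleO_one_iff ℝ).2 hsoft)).congr_right (fun n => mul_one _) |>.congr_left fun n => ?_
    rw [pow_succ]
  exact ((hs.add h2).const_mul_left A).add (h3.const_mul_left B)

/-- The order of choice matters: `δ` comes from `f`, then the modulus `e` from `δ` and the target
accuracy, then `η` from uniform continuity, and `ε` last, from the small-jump estimate at `η`. -/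
theorem isLittleO_integral_rowSum_sub (hα : IsTailIndex P H α) (hpos : ∀ x, 0 < normTail P H x)
    (hHs : ∀ j, Measurable (Hs j))
    (hHid : ∀ j, IdentDistrib (Hs j) H P P) (hHind : iIndepFun Hs P)
    (hLs : ∀ j, Measurable (Ls j)) (hLs0 : ∀ j ω, 0 ≤ Ls j ω)
    (hLid : ∀ j, IdentDistrib (Ls j) L P P)
    (hHL : IndepFun (fun ω j => Hs j ω) (fun ω j => Ls j ω) P)
    (hMpos : ∀ n, 0 < M n) (hM : Tendsto M atTop atTop)
    (hsoft : Tendsto (fun n : ℕ => n * normTail P H (M n)) atTop (𝓝 0)) (hk : 1 ≤ k)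
    (hLtail : (fun x : ℝ => P.real {ω | x < L ω}) =o[atTop]
      (fun x : ℝ => normTail P H x ^ (k - 1)))
    (hsmall : ∀ η : ℝ, 0 < η → ∃ ε₀ : ℝ, 0 < ε₀ ∧ ∀ ε, 0 < ε → ε ≤ ε₀ → (fun n : ℕ =>
      P.real {ω | η * M n < ‖∑ j ∈ Finset.range n, smallPart (ε * M n) (Hs j ω)‖}) =o[atTop]
      (fun n : ℕ => (n * normTail P H (M n)) ^ k))
    {f : Vec d → ℝ} (hf : Continuous f) {C δ : ℝ} (hC : ∀ x, |f x| ≤ C)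
    (hf0 : ∀ x, ‖x‖ ≤ (k : ℝ) - 1 + δ → f x = 0) (hδ : 0 < δ) :
    (fun n : ℕ => ∫ ω, f ((M n)⁻¹ • rowSum M Hs Ls n ω) ∂P - n.choose k *
      ∫ x, f (∑ i, x i) ∂(Measure.pi fun _ : Fin k => retractedLaw P H (M n))) =o[atTop]
      fun n : ℕ => (n * normTail P H (M n)) ^ k := by
  refine isLittleO_iff.2 fun c hc => ?_
  set D : ℝ := ((δ / 2) ^ (-α)) ^ k with hD
  have hD0 : 0 ≤ D := by positivity
  set e : ℝ := c / 2 / (D + 1) with he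
  have he0 : 0 < e := by positivity
  obtain ⟨η, hη, hηδ, hfη⟩ := exists_forall_abs_sub_le (k := k) hf he0 (half_pos hδ)
    (by positivity : (0 : ℝ) < k + 1)
  obtain ⟨ε₀, hε₀, hs⟩ := hsmall η hη
  set ε : ℝ := min ε₀ (min 1 δ) with hεdef
  have hε : 0 < ε := lt_min hε₀ (lt_min one_pos hδ)
  have hrem := isLittleO_remainder (A := 2 * C) (B := (k + 2) * C) hα hpos hM hsoft hk hLtail
    (hs ε hε (min_le_left _ _)) hη hε
  have hlim := ((hα.2 (δ / 2) (half_pos hδ)).comp hM).pow k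
  filter_upwards [isLittleO_iff.1 hrem (half_pos hc),
    hlim.eventually_le_const (show D < D + 1 by linarith)] with n hn1 hn2
  have hp : 0 < normTail P H (M n) := hpos _
  have hmain := abs_integral_rowSum_sub_le (ε := ε) hHs hHid hHind
    hLs hLs0 hLid hHL hMpos hf hC hf0 hδ hη
    hηδ ((min_le_right _ _).trans (min_le_left _ _)) ((min_le_right _ _).trans (min_le_right _ _))
    he0.le hfη n
  have h2 : e * (n * normTail P H (δ / 2 * M n)) ^ k ≤ c / 2 * (n * normTail P H (M n)) ^ k := by
    have h3 : (n * normTail P H (δ / 2 * M n)) ^ k ≤ (D + 1) * (n * normTail P H (M n)) ^ k := by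
      rw [Function.comp_apply, div_pow, div_le_iff₀ (pow_pos hp k)] at hn2
      rw [mul_pow, mul_pow]
      calc (n : ℝ) ^ k * normTail P H (δ / 2 * M n) ^ k
          ≤ n ^ k * ((D + 1) * normTail P H (M n) ^ k) := by gcongr
        _ = _ := by ring
    calc _ ≤ e * ((D + 1) * (n * normTail P H (M n)) ^ k) := by gcongr
      _ = _ := by rw [he]; field_simp
  have hpn : ‖(n * normTail P H (M n)) ^ k‖ = (n * normTail P H (M n)) ^ k :=
    Real.norm_of_nonneg (by positivity)
  rw [hpn] at hn1 ⊢
  rw [Real.norm_eq_abs]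
  have h4 := (le_abs_self _).trans hn1
  linarith

theorem tendsto_choose_div_pow (k : ℕ) :
    Tendsto (fun n : ℕ => (n.choose k : ℝ) / (n : ℝ) ^ k) atTop (𝓝 ((k.factorial : ℝ)⁻¹)) := by
  have h := tendsto_choose_mul_pow_atTop (p := fun n : ℕ => (n : ℝ)⁻¹) (r := 1) k ?_
  · rw [one_pow, one_div] at h
    refine h.congr fun n => ?_
    rw [inv_pow, div_eq_mul_inv]
  · refine tendsto_const_nhds.congr' ?_
    filter_upwards [eventually_gt_atTop 0] with n hn
    rw [mul_inv_cancel₀ (by exact_mod_cast hn.ne')]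

theorem tendsto_integral_rowSum_div {μ : Measure (Vec d)} {a : ℕ → ℝ} {κ : ℝ}
    (hH : Measurable H) (hμ0 : μ {0} = 0)
    (hHμ : VagueTendstoOutside 0 (fun n => (n : ℝ≥0∞) • P.map (fun ω => (a n)⁻¹ • H ω)) μ)
    (hS : ScaledTailLimit (normTail P H) a (fun x => μ.real {y | x < ‖y‖}))
    (hα : 0 < α) (hκ : 0 < κ) (hG : ∀ x, 0 < x → μ.real {y | x < ‖y‖} = κ * x ^ (-α))
    (hHs : ∀ j, Measurable (Hs j))
    (hHid : ∀ j, IdentDistrib (Hs j) H P P) (hHind : iIndepFun Hs P)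
    (hLs : ∀ j, Measurable (Ls j)) (hLs0 : ∀ j ω, 0 ≤ Ls j ω)
    (hLid : ∀ j, IdentDistrib (Ls j) L P P)
    (hHL : IndepFun (fun ω j => Hs j ω) (fun ω j => Ls j ω) P)
    (hMpos : ∀ n, 0 < M n) (hM : Tendsto M atTop atTop)
    (hsoft : Tendsto (fun n : ℕ => n * normTail P H (M n)) atTop (𝓝 0)) (hk : 1 ≤ k)
    (hLtail : (fun x : ℝ => P.real {ω | x < L ω}) =o[atTop]
      (fun x : ℝ => normTail P H x ^ (k - 1)))
    (hsmall : ∀ η : ℝ, 0 < η → ∃ ε₀ : ℝ, 0 < ε₀ ∧ ∀ ε, 0 < ε → ε ≤ ε₀ → (fun n : ℕ =>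
      P.real {ω | η * M n < ‖∑ j ∈ Finset.range n, smallPart (ε * M n) (Hs j ω)‖}) =o[atTop]
      (fun n : ℕ => (n * normTail P H (M n)) ^ k))
    {f : Vec d → ℝ} (hf : Continuous f) {C δ : ℝ} (hC : ∀ x, |f x| ≤ C)
    (hf0 : ∀ x, ‖x‖ ≤ (k : ℝ) - 1 + δ → f x = 0) (hδ : 0 < δ) :
    Tendsto (fun n : ℕ => (∫ ω, f ((M n)⁻¹ • rowSum M Hs Ls n ω) ∂P) /
      (n * normTail P H (M n)) ^ k) atTop (𝓝 ((k.factorial : ℝ)⁻¹ * ∫ x, f x ∂(nuConv μ k))) := by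
  have hfin : ∀ x : ℝ, 0 < x → μ {y | x < ‖y‖} ≠ ∞ := fun x hx =>
    ne_top_of_le_ne_top (measure_setOf_le_norm_lt_top hHμ.1 hx).ne
      (measure_mono fun y hy => (le_of_lt hy : x ≤ ‖y‖))
  -- Shrinking `δ` only weakens the vanishing of `f`; below one, `ν` charges the vectors of norm
  -- above `δ`.
  wlog hδ1 : δ < 1 generalizing δ
  · refine this (δ := 1 / 2) (fun x hx => hf0 x ?_) (by norm_num) (by norm_num)
    have := not_lt.1 hδ1
    linarith
  have hσ := sigmaFinite_nu hκ hfin hG hμ0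
  have hprob := fun n => isProbabilityMeasure_retractedLaw (P := P) hH (M n)
  have hmT : ∀ n, Measurable fun ω => ballRetract ((M n)⁻¹ • H ω) := fun n =>
    measurable_ballRetract.comp (by fun_prop)
  have h1 := tendsto_integral_pi_sum_div (k := k) (m := fun n => retractedLaw P H (M n))
    (ν := nu μ) (t := fun n => normTail P H (M n)) (fun n => hS.pos _) hδ
    (fun n => (ae_map_iff (p := fun x : Vec d => ‖x‖ ≤ 1) (hmT n).aemeasurable
      (measurableSet_le measurable_norm measurable_const)).2
      (Eventually.of_forall fun ω => norm_ballRetract_le_one _))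
    (ae_nu_norm_le_one hκ hfin hG) (nu_setOf_lt_norm_ne_top hκ hfin hG (half_pos hδ))
    (nu_setOf_lt_norm_ne_zero hκ hfin hG hδ hδ1)
    (fun g hg hg0 => by
      rw [integral_nu hκ hfin hG hg]
      refine (tendsto_integral_ballRetract_div hH hHμ hS hα hκ hG hM g hg (half_pos hδ)
        hg0).congr fun n => ?_
      rw [retractedLaw, integral_map (hmT n).aemeasurable hg.aestronglyMeasurable])
    hf hC (fun x hx ⟨i, hi⟩ => hf0 _ (norm_sum_le_of_norm_le_of_forall_le_one hx hi))
  have h2 := (isLittleO_integral_rowSum_sub (isTailIndex_of_scaledTailLimit hH hS hα hκ hG) hS.pos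
    hHs hHid hHind hLs hLs0 hLid hHL hMpos hM hsoft hk hLtail hsmall hf hC hf0
    hδ).tendsto_div_nhds_zero
  have h3 := ((tendsto_choose_div_pow k).mul h1).add h2
  rw [add_zero, ← integral_nuConv hf] at h3
  refine h3.congr fun n => ?_
  rw [mul_pow, div_mul_div_comm, ← add_div]
  congr 1
  ring

end Main

/-! ### Vague convergence and tails of the norm -/

section Tails

variable {Ω : Type*} [MeasurableSpace Ω] {P : Measure Ω} [IsProbabilityMeasure P] {d : ℕ}

/-- Left-continuity of the tail at `r`: the sets above levels increasing to `r` shrink to `{r ≤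
‖y‖}`, whose boundary sphere is null. -/
theorem exists_measureReal_setOf_lt_norm_lt {m : Measure (Vec d)} {s r : ℝ} (hsr : s < r)
    (hfin : ∀ δ : ℝ, 0 < δ → m {y | s + δ < ‖y‖} ≠ ∞) (hr : m {y | ‖y‖ = r} = 0) {b : ℝ}
    (hb : m.real {y | r < ‖y‖} < b) : ∃ p, s < p ∧ p < r ∧ m.real {y | p < ‖y‖} < b := by
  set c : ℝ := (r - s) / 2 with hc
  have hc0 : 0 < c := by linarith
  have hanti : Antitone fun n : ℕ => {y : Vec d | r - c / ((n : ℝ) + 1) < ‖y‖} := by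
    intro n k hnk y (hy : r - c / ((k : ℝ) + 1) < ‖y‖)
    refine lt_of_le_of_lt ?_ hy
    have : c / ((k : ℝ) + 1) ≤ c / ((n : ℝ) + 1) := by gcongr
    linarith
  have hle : ∀ n : ℕ, s + c ≤ r - c / ((n : ℝ) + 1) := by
    intro n
    have : c / ((n : ℝ) + 1) ≤ c := div_le_self hc0.le (by linarith [Nat.cast_nonneg (α := ℝ) n])
    linarith
  have hfinn : ∀ n : ℕ, m {y | r - c / ((n : ℝ) + 1) < ‖y‖} ≠ ∞ := fun n =>
    ne_top_of_le_ne_top (hfin c hc0)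
      (measure_mono fun y (hy : r - c / ((n : ℝ) + 1) < ‖y‖) => (hle n).trans_lt hy)
  have hlim := tendsto_measure_iInter_atTop (μ := m)
    (fun n => (measurableSet_lt_norm _).nullMeasurableSet) hanti ⟨0, hfinn 0⟩
  have hInter : m (⋂ n : ℕ, {y : Vec d | r - c / ((n : ℝ) + 1) < ‖y‖}) ≤ m {y | r < ‖y‖} := by
    have hsub : (⋂ n : ℕ, {y : Vec d | r - c / ((n : ℝ) + 1) < ‖y‖}) ⊆
        {y | r < ‖y‖} ∪ {y | ‖y‖ = r} := by
      intro y hy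
      have hry : r ≤ ‖y‖ := by
        have h1 := (tendsto_one_div_add_atTop_nhds_zero_nat (𝕜 := ℝ)).const_mul c |>.const_sub r
        rw [mul_zero, sub_zero] at h1
        refine le_of_tendsto' h1 fun n => ?_
        have h2 : r - c / ((n : ℝ) + 1) < ‖y‖ := Set.mem_iInter.1 hy n
        rw [mul_one_div]
        exact h2.le
      rcases hry.lt_or_eq with h | h
      · exact Or.inl h
      · exact Or.inr h.symm
    refine (measure_mono hsub).trans ((measure_union_le _ _).trans ?_)
    rw [hr, add_zero]
  have hInter_ne : m (⋂ n : ℕ, {y : Vec d | r - c / ((n : ℝ) + 1) < ‖y‖}) ≠ ∞ :=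
    ne_top_of_le_ne_top (hfinn 0) (measure_mono (Set.iInter_subset _ 0))
  have hrfin : m {y | r < ‖y‖} ≠ ∞ := ne_top_of_le_ne_top (hfin c hc0)
    (measure_mono fun y (hy : r < ‖y‖) => (show s + c < r by linarith).trans hy)
  have hreal := (ENNReal.tendsto_toReal hInter_ne).comp hlim
  have hlt : (m (⋂ n : ℕ, {y : Vec d | r - c / ((n : ℝ) + 1) < ‖y‖})).toReal < b :=
    lt_of_le_of_lt (ENNReal.toReal_mono hrfin hInter) hb
  obtain ⟨n, hn⟩ := (hreal.eventually_lt_const hlt).exists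
  refine ⟨r - c / ((n : ℝ) + 1), by linarith [hle n], ?_, hn⟩
  have : 0 < c / ((n : ℝ) + 1) := by positivity
  linarith

/-- The indicator is squeezed between ramps. The lower bound uses only right-continuity of the tail;
the upper one needs the sphere of radius `r` to be null. -/
theorem tendsto_measureReal_lt_norm_div {m : Measure (Vec d)} {Y : ℕ → Ω → Vec d}
    (hY : ∀ n, Measurable (Y n)) {q : ℕ → ℝ} (hq : ∀ n, 0 ≤ q n) {c s r : ℝ} (hc : 0 < c)
    (hsr : s < r) (hfin : ∀ δ : ℝ, 0 < δ → m {y | s + δ < ‖y‖} ≠ ∞) (hr : m {y | ‖y‖ = r} = 0)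
    (hlim : ∀ f : Vec d → ℝ, Continuous f → (∀ x, |f x| ≤ 1) →
      (∃ δ : ℝ, 0 < δ ∧ ∀ x, ‖x‖ ≤ s + δ → f x = 0) →
      Tendsto (fun n => (∫ ω, f (Y n ω) ∂P) / q n) atTop (𝓝 (c * ∫ x, f x ∂m))) :
    Tendsto (fun n => P.real {ω | r < ‖Y n ω‖} / q n) atTop (𝓝 (c * m.real {y | r < ‖y‖})) := by
  have hfin' : ∀ p, s < p → m {y | p < ‖y‖} ≠ ∞ := by
    intro p hp
    have := hfin (p - s) (sub_pos.2 hp)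
    rwa [add_sub_cancel] at this
  have hramp : ∀ p z, s < p → p < z → Tendsto (fun n => (∫ ω, ramp p z ‖Y n ω‖ ∂P) / q n) atTop
      (𝓝 (c * ∫ x, ramp p z ‖x‖ ∂m)) := fun p z hp hz =>
    hlim (fun x => ramp p z ‖x‖) ((continuous_ramp p z).comp continuous_norm)
      (fun x => by rw [abs_of_nonneg (ramp_nonneg _ _ _)]; exact ramp_le_one _ _ _)
      ⟨p - s, sub_pos.2 hp, fun x hx => ramp_eq_zero hz (by linarith)⟩
  have hreal : ∀ n p, P.real {ω | p < ‖Y n ω‖} = (P.map (Y n)).real {y | p < ‖y‖} := fun n p =>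
    (map_measureReal_apply (hY n) (measurableSet_lt_norm p)).symm
  have hint : ∀ n p z, ∫ ω, ramp p z ‖Y n ω‖ ∂P = ∫ y, ramp p z ‖y‖ ∂(P.map (Y n)) :=
    fun n p z => (integral_map (hY n).aemeasurable
      ((continuous_ramp p z).comp continuous_norm).aestronglyMeasurable).symm
  have hprob : ∀ n, IsProbabilityMeasure (P.map (Y n)) := fun n =>
    Measure.isProbabilityMeasure_map (hY n).aemeasurable
  refine tendsto_order.2 ⟨fun b hb => ?_, fun b hb => ?_⟩
  · rw [← div_lt_iff₀' hc] at hb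
    obtain ⟨z, hrz, hz⟩ := exists_lt_measureReal_setOf_lt_norm (hfin' r hsr) hb
    have h1 : b < c * ∫ x, ramp r z ‖x‖ ∂m := by
      rw [← div_lt_iff₀' hc]
      exact hz.trans_le (le_integral_ramp_norm hrz (hfin' r hsr))
    filter_upwards [(hramp r z hsr hrz).eventually_const_lt h1] with n hn
    refine hn.trans_le (div_le_div_of_nonneg_right ?_ (hq n))
    rw [hreal, hint]
    exact integral_ramp_norm_le hrz (measure_ne_top _ _)
  · rw [gt_iff_lt, ← lt_div_iff₀' hc] at hb
    obtain ⟨p, hsp, hpr, hp⟩ := exists_measureReal_setOf_lt_norm_lt hsr hfin hr hb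
    have h1 : c * ∫ x, ramp p r ‖x‖ ∂m < b := by
      rw [← lt_div_iff₀' hc]
      exact (integral_ramp_norm_le hpr (hfin' p hsp)).trans_lt hp
    filter_upwards [(hramp p r hsp hpr).eventually_lt_const h1] with n hn
    refine (div_le_div_of_nonneg_right ?_ (hq n)).trans_lt hn
    rw [hreal, hint]
    exact le_integral_ramp_norm hpr (measure_ne_top _ _)

theorem isFiniteMeasureOnCompacts_extendOutside_smul {m : Measure (Vec d)} {r : ℝ} (hr : 0 ≤ r)
    (h : ∀ δ : ℝ, 0 < δ → m {x | r + δ < ‖x‖} ≠ ∞) {c : ℝ≥0∞} (hc : c ≠ ∞) :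
    IsFiniteMeasureOnCompacts (extendOutside r (c • m)) :=
  isFiniteMeasureOnCompacts_extendOutside hr fun δ hδ =>
    ENNReal.mul_lt_top hc.lt_top (h δ hδ).lt_top

omit [IsProbabilityMeasure P] in
theorem vagueTendstoOutside_of_tendsto_integral {m : Measure (Vec d)} {Y : ℕ → Ω → Vec d}
    (hY : ∀ n, Measurable (Y n)) {q : ℕ → ℝ} (hq : ∀ n, 0 ≤ q n) {r : ℝ} (hr : 0 ≤ r)
    {c : ℝ≥0∞} (hc : c ≠ ∞) (hfin : ∀ δ : ℝ, 0 < δ → m {y | r + δ < ‖y‖} ≠ ∞)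
    (hlim : ∀ f : Vec d → ℝ, Continuous f → (∃ C, ∀ x, |f x| ≤ C) →
      (∃ δ : ℝ, 0 < δ ∧ ∀ x, ‖x‖ ≤ r + δ → f x = 0) →
      Tendsto (fun n => (∫ ω, f (Y n ω) ∂P) / q n) atTop (𝓝 (c.toReal * ∫ x, f x ∂m))) :
    VagueTendstoOutside r (fun n => (ENNReal.ofReal (q n))⁻¹ • P.map (Y n)) (c • m) := by
  refine ⟨isFiniteMeasureOnCompacts_extendOutside_smul hr hfin hc, fun f => ?_⟩
  obtain ⟨g, hg, hgC, hgδ, hfg⟩ := exists_continuous_integral_extendOutside_eq hr f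
  simp only [hfg, integral_smul_measure]
  refine (hlim g hg hgC hgδ).congr fun n => ?_
  rw [integral_map (hY n).aemeasurable hg.aestronglyMeasurable, ENNReal.toReal_inv,
    ENNReal.toReal_ofReal (hq n), smul_eq_mul, div_eq_inv_mul]

end Tails

end TruncatedTails

end

/-! ### Assembly of the main theorem -/

theorem theorem2p2
    {Ω : Type*} [MeasurableSpace Ω] (P : Measure Ω) [IsProbabilityMeasure P] {d : ℕ}
    -- the heavy-tailed vector `H`, with limit measure `μ` and norming sequence `a`
    (H : Ω → TruncatedTails.Vec d) (hH : Measurable H)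
    (μ : Measure (TruncatedTails.Vec d)) (hμ0 : μ {0} = 0) (hμ : μ ≠ 0)
    (a : ℕ → ℝ) (ha : Tendsto a atTop atTop)
    (hHμ : TruncatedTails.VagueTendstoOutside 0
      (fun n => (n : ℝ≥0∞) • P.map (fun ω => (a n)⁻¹ • H ω)) μ)
    -- symmetry or centering of `H`, according to its tail index `α`: the index is unique and its
    -- existence follows from the previous hypothesis, hence it is not assumed
    (hsymm : ∀ α, TruncatedTails.IsTailIndex P H α → α = 1 →
      P.map (fun ω => -H ω) = P.map H)
    (hcent : ∀ α, TruncatedTails.IsTailIndex P H α → 1 < α →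
      Integrable H P ∧ ∫ ω, H ω ∂P = 0)
    -- the nonnegative random variable `L`, and the i.i.d. copies of `H` and `L`
    (L : Ω → ℝ) (hL : Measurable L) (hL0 : ∀ ω, 0 ≤ L ω)
    (Hs : ℕ → Ω → TruncatedTails.Vec d) (hHs : ∀ j, Measurable (Hs j))
    (Ls : ℕ → Ω → ℝ) (hLs : ∀ j, Measurable (Ls j)) (hLs0 : ∀ j ω, 0 ≤ Ls j ω)
    (hHid : ∀ j, IdentDistrib (Hs j) H P P) (hLid : ∀ j, IdentDistrib (Ls j) L P P)
    (hHind : iIndepFun Hs P) (hLind : iIndepFun Ls P)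
    (hHL : IndepFun (fun ω j => Hs j ω) (fun ω j => Ls j ω) P)
    -- the truncation levels: soft truncation, and growth according to the tail index
    (M : ℕ → ℝ) (hMpos : ∀ n, 0 < M n) (hM : Tendsto M atTop atTop)
    (hsoft : Tendsto (fun n : ℕ => n * TruncatedTails.normTail P H (M n)) atTop (𝓝 0))
    (hM2 : ∀ α, TruncatedTails.IsTailIndex P H α → α = 2 →
      ∃ γ : ℝ, 0 < γ ∧ Tendsto (fun n : ℕ => M n / √((n : ℝ) ^ (1 + γ))) atTop atTop)
    (hMgt2 : ∀ α, TruncatedTails.IsTailIndex P H α → 2 < α →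
      Tendsto (fun n : ℕ => M n / √(n * Real.log (M n))) atTop atTop)
    (k : ℕ) (hk : 1 ≤ k)
    (hLtail : (fun x : ℝ => P.real {ω | x < L ω}) =o[atTop]
      (fun x : ℝ => TruncatedTails.normTail P H x ^ (k - 1))) :
    -- vague convergence
    TruncatedTails.VagueTendstoOutside ((k : ℝ) - 1)
      (fun n => (ENNReal.ofReal ((n * TruncatedTails.normTail P H (M n)) ^ k))⁻¹ •
        P.map (fun ω => (M n)⁻¹ • TruncatedTails.rowSum M Hs Ls n ω))
      ((k.factorial : ℝ≥0∞)⁻¹ • TruncatedTails.nuConv μ k) ∧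
    -- decay rate of the tail probabilities of the norm, for all but countably many `r`
    (∀ r : ℝ, r ∈ Set.Ioo ((k : ℝ) - 1) k →
      TruncatedTails.nuConv μ k {x | ‖x‖ = r} = 0 →
      ∃ C : ℝ, 0 < C ∧
        (fun n : ℕ => P.real {ω | r * M n < ‖TruncatedTails.rowSum M Hs Ls n ω‖}) ~[atTop]
          (fun n : ℕ => C * (n * TruncatedTails.normTail P H (M n)) ^ k)) ∧
    {r : ℝ | r ∈ Set.Ioo ((k : ℝ) - 1) k ∧
      TruncatedTails.nuConv μ k {x | ‖x‖ = r} ≠ 0}.Countable := by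
  have hS := TruncatedTails.scaledTailLimit hH hμ0 hμ ha hHμ
  obtain ⟨α, κ, hα, hκ, hG⟩ := hS.exists_rpow
  have hidx := TruncatedTails.isTailIndex_of_scaledTailLimit hH hS hα hκ hG
  have hfin : ∀ x : ℝ, 0 < x → μ {y | x < ‖y‖} ≠ ∞ := fun x hx =>
    ne_top_of_le_ne_top (TruncatedTails.measure_setOf_le_norm_lt_top hHμ.1 hx).ne
      (measure_mono fun y hy => (le_of_lt hy : x ≤ ‖y‖))
  -- In dimension zero there are no vectors of norm above one, contradicting the tail `κ > 0` of `μ`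
  -- at level one. The coordinatewise bounds require `d > 0`.
  have hd : 0 < d := by
    rcases Nat.eq_zero_or_pos d with rfl | hd
    · have h1 := hG 1 one_pos
      have h2 : ({y | 1 < ‖y‖} : Set (TruncatedTails.Vec 0)) = ∅ := by
        ext y
        rw [Subsingleton.elim y 0]
        simp
      rw [h2, measureReal_empty, Real.one_rpow, mul_one] at h1
      exact absurd h1 hκ.ne
    · exact hd
  have hsmall : ∀ η : ℝ, 0 < η → ∃ ε₀ : ℝ, 0 < ε₀ ∧ ∀ ε, 0 < ε → ε ≤ ε₀ → (fun n : ℕ =>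
      P.real {ω | η * M n <
        ‖∑ j ∈ Finset.range n, TruncatedTails.smallPart (ε * M n) (Hs j ω)‖}) =o[atTop]
      (fun n : ℕ => (n * TruncatedTails.normTail P H (M n)) ^ k) := by
    intro η hη
    rcases le_or_gt α 2 with h2 | h2
    · exact TruncatedTails.exists_forall_isLittleO_smallSum_of_le_two hd hH hS.pos hidx h2
        (hsymm α hidx) (hcent α hidx) hHs hHid hHind hMpos hM hsoft (hM2 α hidx) k hη
    · exact TruncatedTails.exists_forall_isLittleO_smallSum_of_two_lt hd hH hS.pos hidx h2
        (hcent α hidx) hHs hHid hHind hMpos hM hsoft (hMgt2 α hidx h2) k hη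
  have hk1 : (0 : ℝ) ≤ (k : ℝ) - 1 := sub_nonneg.2 (by exact_mod_cast hk)
  have hlim : ∀ f : TruncatedTails.Vec d → ℝ, Continuous f → (∃ C, ∀ x, |f x| ≤ C) →
      (∃ δ : ℝ, 0 < δ ∧ ∀ x, ‖x‖ ≤ (k : ℝ) - 1 + δ → f x = 0) →
      Tendsto (fun n : ℕ => (∫ ω, f ((M n)⁻¹ • TruncatedTails.rowSum M Hs Ls n ω) ∂P) /
        (n * TruncatedTails.normTail P H (M n)) ^ k) atTop
        (𝓝 ((k.factorial : ℝ)⁻¹ * ∫ x, f x ∂(TruncatedTails.nuConv μ k))) :=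
    fun f hf ⟨C, hC⟩ ⟨δ, hδ, hf0⟩ =>
      TruncatedTails.tendsto_integral_rowSum_div hH hμ0 hHμ hS hα hκ hG hHs hHid hHind hLs hLs0
        hLid hHL hMpos hM hsoft hk hLtail hsmall hf hC hf0 hδ
  have hY : ∀ n, Measurable fun ω => (M n)⁻¹ • TruncatedTails.rowSum M Hs Ls n ω := fun n => by
    have := TruncatedTails.measurable_rowSum (M := M) hHs hLs n
    fun_prop
  have hq : ∀ n : ℕ, 0 ≤ (n * TruncatedTails.normTail P H (M n)) ^ k := fun n =>
    pow_nonneg (mul_nonneg n.cast_nonneg (hS.nonneg _)) k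
  have hconvfin : ∀ δ : ℝ, 0 < δ →
      TruncatedTails.nuConv μ k {x | (k : ℝ) - 1 + δ < ‖x‖} ≠ ∞ := fun δ hδ =>
    TruncatedTails.nuConv_setOf_lt_norm_ne_top hκ hfin hG hμ0 hδ
  refine ⟨?_, fun r hr hr0 => ?_, ?_⟩
  · refine TruncatedTails.vagueTendstoOutside_of_tendsto_integral hY hq hk1
      (ENNReal.inv_ne_top.2 (by exact_mod_cast k.factorial_ne_zero)) hconvfin ?_
    rw [ENNReal.toReal_inv, ENNReal.toReal_natCast]
    exact hlim
  · have hfact : (0 : ℝ) < (k.factorial : ℝ)⁻¹ :=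
      inv_pos.2 (by exact_mod_cast k.factorial_pos)
    have hnuConv : 0 < (TruncatedTails.nuConv μ k).real {x | r < ‖x‖} := by
      refine ENNReal.toReal_pos (TruncatedTails.nuConv_setOf_lt_norm_ne_zero hκ hfin hG hμ0 hk
        (hk1.trans hr.1.le) hr.2) ?_
      have h1 := hconvfin (r - (k - 1)) (sub_pos.2 hr.1)
      rwa [add_sub_cancel] at h1
    have h1 := TruncatedTails.tendsto_measureReal_lt_norm_div hY hq hfact hr.1 hconvfin hr0
      fun f hf hf1 => hlim f hf ⟨1, hf1⟩
    refine ⟨_, mul_pos hfact hnuConv, ?_⟩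
    have hne : ∀ᶠ n : ℕ in atTop, (n * TruncatedTails.normTail P H (M n)) ^ k ≠ 0 := by
      filter_upwards [eventually_gt_atTop 0] with n hn
      have hn' : (0 : ℝ) < n := by exact_mod_cast hn
      exact (pow_pos (mul_pos hn' (hS.pos _)) k).ne'
    have hC0 := (mul_pos hfact hnuConv).ne'
    rw [isEquivalent_iff_tendsto_one (hne.mono fun n hn => mul_ne_zero hC0 hn)]
    have h2 := h1.div_const
      ((k.factorial : ℝ)⁻¹ * (TruncatedTails.nuConv μ k).real {x | r < ‖x‖})
    rw [div_self hC0] at h2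
    refine h2.congr fun n => ?_
    have h3 : P.real {ω | r < ‖(M n)⁻¹ • TruncatedTails.rowSum M Hs Ls n ω‖} =
        P.real {ω | r * M n < ‖TruncatedTails.rowSum M Hs Ls n ω‖} := by
      rw [TruncatedTails.measureReal_lt_norm_smul_inv (hMpos n), TruncatedTails.normTail,
        mul_comm]
    rw [h3, Pi.div_apply, div_div, mul_comm (_ ^ k)]
  · exact (TruncatedTails.countable_nuConv_sphere_ne_zero hκ hfin hG hμ0).mono fun r hr => hr.2
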